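/- All graphs are finite, simple and undirected. A path is *shortest* if its length equals the distance of its endpoints; the eccentricity of a path $P$ in $G$ is $\mathrm{ecc}_G(P)=\max_{u\in V(G)}\min_{s\in P}d_G(u,s)$. The Minimum Eccentricity Shortest Path problem (MESP) asks, for a connected graph $G$ and $k\in\mathbb N$, whether $G$ has a shortest path $P$ with $\mathrm{ecc}_G(P)\le k$. Given a pattern graph $T$ and disjoint nonempty graphs $G_i$ $(i\in V(T))$, the *substitution* $T[G_i]$ is the union of the $G_i$ together with all edges $uv$ with $u\in V(G_i)$, $v\in V(G_j)$, $ij\in E(T)$; the sets $V(G_i)$ are its modules. The *modular width* of $G$ is the least $w$ such that $G$ can be built from single vertices by disjoint unions of two graphs, complete joins of two graphs, and substitutions with at most $w$ operands each. **Theorem.** (1) There is an algorithm (a fixed random access machine program with unit-cost operations on words of $O(\log(n+k))$ bits, the graph being given by its adjacency matrix) that solves MESP on every connected graph $G$ with $n$ vertices and every $k\in\mathbb N$ in $O(2^w\cdot n^3)$ steps, where $w$ is the modular width of $G$ (which is not part of the input) and the implied constant is absolute. (2) Let $G=T[G_i]$ be connected, where $T$ has at least $3$ vertices. Then: (a) among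 the shortest paths of $G$ with minimum eccentricity there is one that contains at most one vertex of each $V(G_i)$; (b) if $P$ is a shortest path of $G$ that is not contained in $V(G_i)$, $p\in P\cap V(G_i)$ and $p'\in V(G_i)$, then the sequence $P'$ obtained from $P$ by replacing $p$ by $p'$ satisfies $\mathrm{ecc}_G(P')=\mathrm{ecc}_G(P)$, and if $p$ is the only vertex of $P$ in $V(G_i)$, then $P'$ is again a shortest path of $G$; (c) for any choice of one vertex $r_i\in V(G_i)$ for each $i$ and every $k\in\mathbb N$, $G$ has a shortest path of eccentricity at most $k$ if and only if $T$ has a shortest path $(\pi_1,\dots,\pi_\ell)$ with $\ell\ge 2$ such that $(r_{\pi_1},\dots,r_{\pi_\ell})$ is a shortest path of $G$ of eccentricity at most $k$. -/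

import Mathlib

namespace MESP

/-! ## Shortest paths and eccentricity -/

/-- The list `P` of vertices is a path of `G` that is shortest between its endpoints. -/
def IsShortestPath {V : Type} (G : SimpleGraph V) (P : List V) : Prop :=
  ∃ (u v : V) (p : G.Walk u v), p.length = G.dist u v ∧ p.support = P

/-- The distance from a vertex to a set (`⊤` for the empty set). -/
noncomputable def distToSet {V : Type} (G : SimpleGraph V) (u : V) (S : Set V) : ℕ∞ :=
  ⨅ s ∈ S, G.edist u s

/-- The eccentricity of a set: the largest distance of a vertex of the graph from it. -/
noncomputable def setEcc {V : Type} (G : SimpleGraph V) (S : Set V) : ℕ∞ :=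
  ⨆ u, distToSet G u S

/-- The eccentricity of (the vertex set of) a path. -/
noncomputable def pathEcc {V : Type} (G : SimpleGraph V) (P : List V) : ℕ∞ :=
  setEcc G {v | v ∈ P}

/-- `(G, k)` is a yes-instance of the Minimum Eccentricity Shortest Path problem. -/
def YesInstance {V : Type} (G : SimpleGraph V) (k : ℕ) : Prop :=
  ∃ P : List V, IsShortestPath G P ∧ pathEcc G P ≤ k

/-- `P` is a shortest path whose eccentricity is least among all shortest paths of `G`. -/
def IsMinEccShortestPath {V : Type} (G : SimpleGraph V) (P : List V) : Prop :=
  IsShortestPath G P ∧ ∀ Q : List V, IsShortestPath G Q → pathEcc G P ≤ pathEcc G Q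

/-! ## Modular width -/

/-- The complete join of two disjoint graphs. -/
def joinGraph {V W : Type} (G : SimpleGraph V) (H : SimpleGraph W) : SimpleGraph (V ⊕ W) :=
  SimpleGraph.sum G H ⊔ completeBipartiteGraph V W

/-- The substitution of the vertices `i` of the pattern graph `T` by the graphs `H i`. -/
def substGraph {ι : Type} (T : SimpleGraph ι) {V : ι → Type} (H : ∀ i, SimpleGraph (V i)) :
    SimpleGraph (Σ i, V i) where
  Adj x y := T.Adj x.1 y.1 ∨ ∃ (i : ι) (a b : V i), (H i).Adj a b ∧ x = ⟨i, a⟩ ∧ y = ⟨i, b⟩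
  symm := ⟨by
    rintro x y (h | ⟨i, a, b, h, hx, hy⟩)
    · exact Or.inl h.symm
    · exact Or.inr ⟨i, b, a, h.symm, hy, hx⟩⟩
  loopless := ⟨by
    rintro x (h | ⟨i, a, b, h, rfl, hy⟩)
    · exact h.ne rfl
    · exact h.ne (by simpa using hy)⟩

/-- Algebraic expressions over the operations: isolated vertex, disjoint union, complete join,
substitution into a pattern graph (with at least one operand). -/
inductive ModExpr : Type
  | vertex : ModExpr
  | union (A B : ModExpr) : ModExpr
  | join (A B : ModExpr) : ModExpr
  | subst (r : ℕ) (T : SimpleGraph (Fin (r + 1))) (A : Fin (r + 1) → ModExpr) : ModExpr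

/-- The vertex set of the graph described by an expression. -/
def ModExpr.Carrier : ModExpr → Type
  | .vertex => Unit
  | .union A B => A.Carrier ⊕ B.Carrier
  | .join A B => A.Carrier ⊕ B.Carrier
  | .subst _ _ A => Σ i, (A i).Carrier

/-- The graph described by an expression. -/
def ModExpr.graph : (A : ModExpr) → SimpleGraph A.Carrier
  | .vertex => (⊥ : SimpleGraph Unit)
  | .union A B => SimpleGraph.sum A.graph B.graph
  | .join A B => joinGraph A.graph B.graph
  | .subst _ T A => substGraph T (fun i => (A i).graph)

/-- The width: the maximum number of operands of a substitution in the expression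
(`0` if there is none). -/
def ModExpr.width : ModExpr → ℕ
  | .vertex => 0
  | .union A B => max A.width B.width
  | .join A B => max A.width B.width
  | .subst r _ A => max (r + 1) (Finset.univ.sup fun i => (A i).width)

/-- The modular width of a (finite nonempty) graph: the least `m` such that the graph is
described, up to isomorphism, by an expression of width at most `m`. -/
noncomputable def modularWidth {V : Type} (G : SimpleGraph V) : ℕ :=
  sInf {m | ∃ A : ModExpr, A.width ≤ m ∧ Nonempty (A.graph ≃g G)}

/-- A defining expression exists for every finite nonempty graph, so that `modularWidth` is
attained. -/
theorem exists_modExpr {n : ℕ} (hn : 0 < n) (G : SimpleGraph (Fin n)) :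
    ∃ A : ModExpr, A.width ≤ modularWidth G ∧ Nonempty (A.graph ≃g G) := by
  refine Nat.sInf_mem (s := {m | ∃ A : ModExpr, A.width ≤ m ∧ Nonempty (A.graph ≃g G)}) ?_
  obtain ⟨r, rfl⟩ : ∃ r, n = r + 1 := ⟨n - 1, by omega⟩
  refine ⟨_, .subst r G (fun _ => .vertex), le_rfl, ⟨?_⟩⟩
  refine ⟨⟨fun x => x.1, fun i => ⟨i, ()⟩, fun _ => rfl, fun _ => rfl⟩, ?_⟩
  rintro ⟨i, a⟩ ⟨j, b⟩
  constructor
  · intro h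
    exact Or.inl h
  · rintro (h | ⟨_, _, _, h, _, _⟩)
    · exact h
    · exact h.elim

/-! ## Random access machine programs with unit-cost operations on bounded words -/

/-- A memory state: finitely many of the variables `var x` and of the arrays `arr a` occur in
any given program. -/
structure State where
  var : ℕ → ℕ
  arr : ℕ → ℕ → ℕ

/-- Expressions; `sub` is truncated, `lt` and `eq` return `1` or `0`. -/
inductive Expr : Type
  | const (c : ℕ) : Expr
  | var (x : ℕ) : Expr
  | read (a : ℕ) (i : Expr) : Expr
  | add (e f : Expr) : Expr
  | sub (e f : Expr) : Expr
  | mul (e f : Expr) : Expr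
  | lt (e f : Expr) : Expr
  | eq (e f : Expr) : Expr

/-- The value of an expression. -/
def Expr.eval (s : State) : Expr → ℕ
  | .const c => c
  | .var x => s.var x
  | .read a i => s.arr a (i.eval s)
  | .add e f => e.eval s + f.eval s
  | .sub e f => e.eval s - f.eval s
  | .mul e f => e.eval s * f.eval s
  | .lt e f => if e.eval s < f.eval s then 1 else 0
  | .eq e f => if e.eval s = f.eval s then 1 else 0

/-- The number of operations needed to evaluate an expression. -/
def Expr.cost : Expr → ℕ
  | .const _ => 1
  | .var _ => 1
  | .read _ i => i.cost + 1
  | .add e f => e.cost + f.cost + 1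
  | .sub e f => e.cost + f.cost + 1
  | .mul e f => e.cost + f.cost + 1
  | .lt e f => e.cost + f.cost + 1
  | .eq e f => e.cost + f.cost + 1

/-- No value larger than `W` occurs in the evaluation of an expression. -/
def Expr.Fits (W : ℕ) (s : State) : Expr → Prop
  | .const c => c ≤ W
  | .var x => s.var x ≤ W
  | .read a i => i.Fits W s ∧ s.arr a (i.eval s) ≤ W
  | .add e f => e.Fits W s ∧ f.Fits W s ∧ e.eval s + f.eval s ≤ W
  | .sub e f => e.Fits W s ∧ f.Fits W s
  | .mul e f => e.Fits W s ∧ f.Fits W s ∧ e.eval s * f.eval s ≤ W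
  | .lt e f => e.Fits W s ∧ f.Fits W s ∧ 1 ≤ W
  | .eq e f => e.Fits W s ∧ f.Fits W s ∧ 1 ≤ W

/-- Programs; a condition holds if its value is not `0`. -/
inductive Prog : Type
  | skip : Prog
  | assign (x : ℕ) (e : Expr) : Prog
  | write (a : ℕ) (i e : Expr) : Prog
  | seq (p q : Prog) : Prog
  | ite (e : Expr) (p q : Prog) : Prog
  | while (e : Expr) (p : Prog) : Prog

/-- `Exec W p s s' t`: started in state `s`, the program `p` halts in state `s'` after `t` steps,
and no value larger than `W` is computed (a run that exceeds `W` is stuck). -/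
inductive Exec (W : ℕ) : Prog → State → State → ℕ → Prop
  | skip (s : State) : Exec W .skip s s 1
  | assign (x : ℕ) (e : Expr) (s : State) : e.Fits W s →
      Exec W (.assign x e) s ⟨Function.update s.var x (e.eval s), s.arr⟩ (e.cost + 1)
  | write (a : ℕ) (i e : Expr) (s : State) : i.Fits W s → e.Fits W s →
      Exec W (.write a i e) s
        ⟨s.var, Function.update s.arr a (Function.update (s.arr a) (i.eval s) (e.eval s))⟩
        (i.cost + e.cost + 1)
  | seq (p q : Prog) (s₁ s₂ s₃ : State) (t₁ t₂ : ℕ) : Exec W p s₁ s₂ t₁ → Exec W q s₂ s₃ t₂ →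
      Exec W (.seq p q) s₁ s₃ (t₁ + t₂)
  | ite_true (e : Expr) (p q : Prog) (s s' : State) (t : ℕ) : e.Fits W s → e.eval s ≠ 0 →
      Exec W p s s' t → Exec W (.ite e p q) s s' (e.cost + 1 + t)
  | ite_false (e : Expr) (p q : Prog) (s s' : State) (t : ℕ) : e.Fits W s → e.eval s = 0 →
      Exec W q s s' t → Exec W (.ite e p q) s s' (e.cost + 1 + t)
  | while_true (e : Expr) (p : Prog) (s₁ s₂ s₃ : State) (t₁ t₂ : ℕ) : e.Fits W s₁ →
      e.eval s₁ ≠ 0 → Exec W p s₁ s₂ t₁ → Exec W (.while e p) s₂ s₃ t₂ →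
      Exec W (.while e p) s₁ s₃ (e.cost + 1 + t₁ + t₂)
  | while_false (e : Expr) (p : Prog) (s : State) : e.Fits W s → e.eval s = 0 →
      Exec W (.while e p) s s (e.cost + 1)

open Classical in
/-- The input `(G, k)`: variable `0` holds the number `n` of vertices, variable `1` holds `k`,
array `0` holds the adjacency matrix row by row (entry `(i, j)` in cell `i * n + j`), and
everything else is `0`. -/
noncomputable def inputState {n : ℕ} (G : SimpleGraph (Fin n)) (k : ℕ) : State where
  var x := if x = 0 then n else if x = 1 then k else 0
  arr a c := if a = 0 ∧ ∃ i j : Fin n, c = i.val * n + j.val ∧ G.Adj i j then 1 else 0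

/-- Started on the input `(G, k)` with words bounded by `W`, the program halts after at most `t`
steps with the correct answer, `1` for yes and `0` for no, in variable `0`. -/
def DecidesWithin (p : Prog) {n : ℕ} (G : SimpleGraph (Fin n)) (k W t : ℕ) : Prop :=
  ∃ (s' : State) (t' : ℕ), Exec W p (inputState G k) s' t' ∧ t' ≤ t ∧
    (YesInstance G k → s'.var 0 = 1) ∧ (¬ YesInstance G k → s'.var 0 = 0)

/-! ## Exchanging a vertex of a path -/

open Classical in
/-- The sequence `P` with the vertex `p` replaced by `p'`. -/
noncomputable def exchange {V : Type} (P : List V) (p p' : V) : List V :=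
  P.map fun x => if x = p then p' else x

end MESP

namespace MESP

/-!
Two vertices of a common module have the same distance to every vertex outside of it. Hence a vertex
of a path can be exchanged for another one of its module, and a shortest path that meets a module
twice has at most one vertex outside of it, so that it is no better than an edge leaving the module.
One representative of each module is therefore enough.

If no vertex or edge dominates the graph, then the maximal proper modules partition it, and no
expression for the graph has fewer operands in its outermost nontrivial substitution than there are
such modules: their number is at most the modular width `w`. The class of a vertex `a` can be
computed without knowing an expression, because the smallest module containing `a` and `b` is found
by a closure process. It remains to test the at most `2 ^ w` sets of representatives, each of them
in cubic time: a set is the vertex set of a shortest path if and only if, for some `u` in it, the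
distances from `u` map it isometrically onto an initial segment of the naturals.

If a vertex or an edge dominates the graph, every positive bound is attained. The bound `0` is
attained if and only if some shortest path contains all `n` vertices, that is, if and only if some
two vertices have distance `n - 1`.
-/

/-! ## A total-correctness logic for programs -/

/-- The state after an assignment of `v` to the variable `x`. -/
def State.setVar (s : State) (x v : ℕ) : State := ⟨Function.update s.var x v, s.arr⟩

/-- The state after an assignment of `v` to the cell `i` of the array `a`. -/
def State.setCell (s : State) (a i v : ℕ) : State :=
  ⟨s.var, Function.update s.arr a (Function.update (s.arr a) i v)⟩

@[simp] theorem State.setVar_var (s : State) (x v y : ℕ) :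
    (s.setVar x v).var y = if y = x then v else s.var y := by
  simp only [State.setVar, Function.update_apply]

@[simp] theorem State.setVar_arr (s : State) (x v : ℕ) : (s.setVar x v).arr = s.arr := rfl

@[simp] theorem State.setCell_var (s : State) (a i v : ℕ) : (s.setCell a i v).var = s.var := rfl

@[simp] theorem State.setCell_arr (s : State) (a i v b j : ℕ) :
    (s.setCell a i v).arr b j = if b = a ∧ j = i then v else s.arr b j := by
  by_cases h : b = a
  · subst h
    simp only [State.setCell, Function.update_self, Function.update_apply, true_and]
  · simp only [State.setCell, Function.update_of_ne h, h, false_and, if_false]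

theorem Expr.eval_lt_ne_zero_iff {e f : Expr} {s : State} :
    (Expr.lt e f).eval s ≠ 0 ↔ e.eval s < f.eval s := by
  simp only [Expr.eval, ne_eq, ite_eq_right_iff, one_ne_zero, imp_false, not_not]

theorem Expr.eval_eq_ne_zero_iff {e f : Expr} {s : State} :
    (Expr.eq e f).eval s ≠ 0 ↔ e.eval s = f.eval s := by
  simp only [Expr.eval, ne_eq, ite_eq_right_iff, one_ne_zero, imp_false, not_not]

/-- The total-correctness triple: started in `s` with words bounded by `W`, the program `p` halts
within `t` steps in a state that satisfies `Q`. -/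
def Runs (W : ℕ) (p : Prog) (s : State) (t : ℕ) (Q : State → Prop) : Prop :=
  ∃ (s' : State) (t' : ℕ), Exec W p s s' t' ∧ t' ≤ t ∧ Q s'

namespace Runs

variable {W : ℕ} {p q : Prog} {e : Expr} {s : State} {t t₁ t₂ : ℕ} {Q R : State → Prop}

theorem imp (h : Runs W p s t R) (hQ : ∀ s', R s' → Q s') : Runs W p s t Q := by
  obtain ⟨s', u, he, hu, hR⟩ := h
  exact ⟨s', u, he, hu, hQ s' hR⟩

theorem le_time (h : Runs W p s t₁ Q) (ht : t₁ ≤ t₂) : Runs W p s t₂ Q := by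
  obtain ⟨s', u, he, hu, hQ⟩ := h
  exact ⟨s', u, he, hu.trans ht, hQ⟩

theorem skip (h : Q s) : Runs W .skip s 1 Q :=
  ⟨s, 1, .skip s, le_rfl, h⟩

theorem assign {x : ℕ} (hf : e.Fits W s) (h : Q (s.setVar x (e.eval s))) :
    Runs W (.assign x e) s (e.cost + 1) Q :=
  ⟨_, _, .assign x e s hf, le_rfl, h⟩

theorem write {a : ℕ} {i : Expr} (hi : i.Fits W s) (hf : e.Fits W s)
    (h : Q (s.setCell a (i.eval s) (e.eval s))) :
    Runs W (.write a i e) s (i.cost + e.cost + 1) Q :=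
  ⟨_, _, .write a i e s hi hf, le_rfl, h⟩

theorem seq (hp : Runs W p s t₁ R) (hq : ∀ s', R s' → Runs W q s' t₂ Q) :
    Runs W (.seq p q) s (t₁ + t₂) Q := by
  obtain ⟨s', u, he, hu, hR⟩ := hp
  obtain ⟨s'', u', he', hu', hQ⟩ := hq s' hR
  exact ⟨s'', u + u', .seq p q s s' s'' u u' he he', Nat.add_le_add hu hu', hQ⟩

theorem ite (hf : e.Fits W s) (hp : e.eval s ≠ 0 → Runs W p s t Q)
    (hq : e.eval s = 0 → Runs W q s t Q) : Runs W (.ite e p q) s (e.cost + 1 + t) Q := by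
  by_cases h : e.eval s = 0
  · obtain ⟨s', u, he, hu, hQ⟩ := hq h
    exact ⟨s', _, .ite_false e p q s s' u hf h he, Nat.add_le_add_left hu _, hQ⟩
  · obtain ⟨s', u, he, hu, hQ⟩ := hp h
    exact ⟨s', _, .ite_true e p q s s' u hf h he, Nat.add_le_add_left hu _, hQ⟩

/-- The invariant `I` is indexed by the number of rounds that are left. -/
theorem while_loop (I : ℕ → State → Prop) (hf : ∀ m s, I m s → e.Fits W s)
    (hstep : ∀ m s, I (m + 1) s → e.eval s ≠ 0 ∧ Runs W p s t (I m))
    (hend : ∀ s, I 0 s → e.eval s = 0) {m : ℕ} (h : I m s) :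
    Runs W (.while e p) s (m * (e.cost + 1 + t) + (e.cost + 1)) (I 0) := by
  induction m generalizing s with
  | zero => exact ⟨s, _, .while_false e p s (hf 0 s h) (hend s h), by omega, h⟩
  | succ m ih =>
    obtain ⟨hne, s', u, he, hu, hI⟩ := hstep m s h
    obtain ⟨s'', u', he', hu', hQ⟩ := ih hI
    refine ⟨s'', _, .while_true e p s s' s'' u u' (hf _ s h) hne he he', ?_, hQ⟩
    rw [Nat.add_mul]
    omega

end Runs

/-- The variables on the left of the assignments in a program. -/
def Prog.writtenVars : Prog → List ℕ
  | .skip => []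
  | .assign x _ => [x]
  | .write _ _ _ => []
  | .seq p q => p.writtenVars ++ q.writtenVars
  | .ite _ p q => p.writtenVars ++ q.writtenVars
  | .while _ p => p.writtenVars

/-- The arrays on the left of the assignments in a program. -/
def Prog.writtenArrs : Prog → List ℕ
  | .skip => []
  | .assign _ _ => []
  | .write a _ _ => [a]
  | .seq p q => p.writtenArrs ++ q.writtenArrs
  | .ite _ p q => p.writtenArrs ++ q.writtenArrs
  | .while _ p => p.writtenArrs

/-- The states `s` and `s'` agree on everything that does not occur on the left of an assignment
in `p`. -/
structure Prog.Frame (p : Prog) (s s' : State) : Prop where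
  var : ∀ x, x ∉ p.writtenVars → s'.var x = s.var x
  arr : ∀ a, a ∉ p.writtenArrs → s'.arr a = s.arr a

namespace Prog.Frame

variable {p q : Prog} {s s₁ s₂ s₃ : State}

theorem refl (p : Prog) (s : State) : p.Frame s s :=
  ⟨fun _ _ => rfl, fun _ _ => rfl⟩

theorem trans (h₁ : p.Frame s₁ s₂) (h₂ : p.Frame s₂ s₃) : p.Frame s₁ s₃ :=
  ⟨fun x hx => (h₂.var x hx).trans (h₁.var x hx), fun a ha => (h₂.arr a ha).trans (h₁.arr a ha)⟩

theorem mono (h : p.Frame s₁ s₂) (hv : p.writtenVars ⊆ q.writtenVars)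
    (ha : p.writtenArrs ⊆ q.writtenArrs) : q.Frame s₁ s₂ :=
  ⟨fun x hx => h.var x fun hp => hx (hv hp), fun a hq => h.arr a fun hp => hq (ha hp)⟩

theorem setVar {x : ℕ} (hx : x ∈ p.writtenVars) (v : ℕ) : p.Frame s (s.setVar x v) := by
  refine ⟨fun y hy => ?_, fun _ _ => rfl⟩
  rw [State.setVar_var, if_neg (by rintro rfl; exact hy hx)]

theorem setCell {a : ℕ} (ha : a ∈ p.writtenArrs) (i v : ℕ) : p.Frame s (s.setCell a i v) := by
  refine ⟨fun _ _ => rfl, fun b hb => funext fun j => ?_⟩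
  rw [State.setCell_arr, if_neg (by rintro ⟨rfl, -⟩; exact hb ha)]

end Prog.Frame

theorem Exec.frame {W : ℕ} {p : Prog} {s s' : State} {t : ℕ} (h : Exec W p s s' t) :
    p.Frame s s' := by
  induction h with
  | skip => exact .refl _ _
  | assign => exact .setVar (List.mem_singleton_self _) _
  | write => exact .setCell (List.mem_singleton_self _) _ _
  | seq p q _ _ _ _ _ _ _ ih₁ ih₂ =>
    exact (ih₁.mono (List.subset_append_left _ _) (List.subset_append_left _ _)).trans
      (ih₂.mono (List.subset_append_right _ _) (List.subset_append_right _ _))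
  | ite_true _ _ _ _ _ _ _ _ _ ih =>
    exact ih.mono (List.subset_append_left _ _) (List.subset_append_left _ _)
  | ite_false _ _ _ _ _ _ _ _ _ ih =>
    exact ih.mono (List.subset_append_right _ _) (List.subset_append_right _ _)
  | while_true _ _ _ _ _ _ _ _ _ _ _ ih₁ ih₂ => exact Prog.Frame.trans ⟨ih₁.var, ih₁.arr⟩ ih₂
  | while_false => exact .refl _ _

theorem Runs.frame {W : ℕ} {p : Prog} {s : State} {t : ℕ} {Q : State → Prop}
    (h : Runs W p s t Q) : Runs W p s t (fun s' => p.Frame s s' ∧ Q s') := by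
  obtain ⟨s', u, he, hu, hq⟩ := h
  exact ⟨s', u, he, hu, he.frame, hq⟩

/-- Run `p` for the values `0, …, b - 1` of the variable `x`, where `b` is a variable. -/
def Prog.forLt (x b : ℕ) (p : Prog) : Prog :=
  .seq (.assign x (.const 0)) (.while (.lt (.var x) (.var b))
    (.seq p (.assign x (.add (.var x) (.const 1)))))

theorem Runs.forLt_of_invariant {W x b N t : ℕ} {p : Prog} {s₀ : State} (I : ℕ → State → Prop)
    (hN : N ≤ W) (hW : 1 ≤ W) (hI : ∀ i s, I i s → s.var x = i ∧ s.var b = N)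
    (h0 : I 0 (s₀.setVar x 0))
    (step : ∀ i s, i < N → I i s →
      Runs W p s t (fun s' => s'.var x = i ∧ I (i + 1) (s'.setVar x (i + 1)))) :
    Runs W (.forLt x b p) s₀ (N * (t + 8) + 6) (I N) := by
  have hloop : Runs W (.while (.lt (.var x) (.var b))
      (.seq p (.assign x (.add (.var x) (.const 1))))) (s₀.setVar x 0)
      (N * (4 + (t + 4)) + 4) (fun s => I (N - 0) s ∧ 0 ≤ N) := by
    refine Runs.while_loop (fun m s => I (N - m) s ∧ m ≤ N) ?_ ?_ ?_ ⟨by simpa using h0, le_rfl⟩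
    · rintro m s ⟨h, hm⟩
      obtain ⟨hx, hb⟩ := hI _ _ h
      simp only [Expr.Fits, hx, hb]
      omega
    · rintro m s ⟨h, hm⟩
      obtain ⟨hx, hb⟩ := hI _ _ h
      have hlt : N - (m + 1) < N := by omega
      refine ⟨Expr.eval_lt_ne_zero_iff.2 (by simpa only [Expr.eval, hx, hb] using hlt),
        (step _ s hlt h).seq ?_⟩
      rintro s' ⟨hx', hI'⟩
      refine Runs.assign ?_ ⟨?_, by omega⟩
      · simp only [Expr.Fits, Expr.eval, hx']
        omega
      · simp only [Expr.eval, hx']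
        rwa [show N - m = N - (m + 1) + 1 by omega]
    · rintro s ⟨h, -⟩
      obtain ⟨hx, hb⟩ := hI _ _ h
      simp only [Expr.eval, hx, hb, Nat.sub_zero, lt_irrefl, if_false]
  have hinit : Runs W (.assign x (.const 0)) s₀ 2 (· = s₀.setVar x 0) :=
    Runs.assign (Nat.zero_le W) rfl
  refine ((hinit.seq fun s hs => hs ▸ hloop).imp fun s h => h.1).le_time ?_
  linarith

theorem Runs.forLt {W x b N t : ℕ} {p : Prog} {s₀ : State} (I : ℕ → State → Prop)
    (hx : x ∉ p.writtenVars) (hb : b ∉ (Prog.forLt x b p).writtenVars) (hbN : s₀.var b = N)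
    (hN : N ≤ W) (hW : 1 ≤ W) (h0 : I 0 (s₀.setVar x 0))
    (step : ∀ i s, i < N → s.var x = i → (Prog.forLt x b p).Frame s₀ s → I i s →
      Runs W p s t (fun s' => I (i + 1) (s'.setVar x (i + 1)))) :
    Runs W (.forLt x b p) s₀ (N * (t + 8) + 6) (I N) := by
  have hmem : x ∈ (Prog.forLt x b p).writtenVars := List.mem_cons_self
  refine (Runs.forLt_of_invariant
    (fun i s => s.var x = i ∧ (Prog.forLt x b p).Frame s₀ s ∧ I i s) hN hW ?_ ?_ ?_).imp
    fun _ h => h.2.2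
  · rintro i s ⟨hi, hF, -⟩
    exact ⟨hi, (hF.var b hb).trans hbN⟩
  · exact ⟨by simp only [State.setVar_var, if_true], .setVar hmem 0, h0⟩
  · rintro i s hi ⟨hxi, hF, hI⟩
    refine (step i s hi hxi hF hI).frame.imp fun s' ⟨hF', hinv⟩ => ?_
    have hp : (Prog.forLt x b p).Frame s s' := hF'.mono
      (List.subset_append_of_subset_right [x] (List.subset_append_left _ _))
      (List.subset_append_of_subset_right [] (List.subset_append_left _ _))
    exact ⟨(hF'.var x hx).trans hxi, by simp only [State.setVar_var, if_true],
      (hF.trans hp).trans (.setVar hmem _), hinv⟩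

/-! ## Programs that evaluate formulas with bounded quantifiers -/

/-- The word `x` encodes the truth value of `p`: it is 1 if `p` holds and 0 otherwise. -/
def IsTruthValue (x : ℕ) (p : Prop) : Prop := x ≤ 1 ∧ (x ≠ 0 ↔ p)

namespace IsTruthValue

variable {x y : ℕ} {p q : Prop}

theorem congr (h : IsTruthValue x p) (hpq : p ↔ q) : IsTruthValue x q :=
  ⟨h.1, h.2.trans hpq⟩

theorem zero (hp : ¬ p) : IsTruthValue 0 p :=
  ⟨Nat.zero_le 1, iff_of_false (fun h => h rfl) hp⟩

theorem one (hp : p) : IsTruthValue 1 p :=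
  ⟨le_rfl, iff_of_true one_ne_zero hp⟩

theorem ite [Decidable p] : IsTruthValue (if p then 1 else 0) p := by
  by_cases hp : p
  · rw [if_pos hp]
    exact one hp
  · rw [if_neg hp]
    exact zero hp

theorem not (h : IsTruthValue x p) : IsTruthValue (1 - x) (¬ p) :=
  ⟨Nat.sub_le 1 x, by rw [← h.2]; omega⟩

theorem and (hx : IsTruthValue x p) (hy : IsTruthValue y q) : IsTruthValue (x * y) (p ∧ q) :=
  ⟨Nat.mul_le_mul hx.1 hy.1, by rw [Nat.mul_ne_zero_iff, hx.2, hy.2]⟩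

theorem eq_one (h : IsTruthValue x p) (hp : p) : x = 1 := by
  have := h.1
  have := h.2.2 hp
  omega

theorem eq_zero (h : IsTruthValue x p) (hp : ¬ p) : x = 0 := by
  by_contra hx
  exact hp (h.2.1 hx)

theorem eq_zero_iff (h : IsTruthValue x p) : x = 0 ↔ ¬ p :=
  not_ne_iff.symm.trans h.2.not

theorem eq_iff (hx : IsTruthValue x p) (hy : IsTruthValue y q) : x = y ↔ (p ↔ q) := by
  have := hx.1
  have := hy.1
  rw [← hx.2, ← hy.2]
  omega

end IsTruthValue

/-- Formulas about states, with quantifiers over the natural numbers below a variable. -/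
inductive Formula : Type
  | atom (e : Expr) : Formula
  | and (φ ψ : Formula) : Formula
  | neg (φ : Formula) : Formula
  | ex (x b : ℕ) (φ : Formula) : Formula

/-- Bounded universal quantification. -/
def Formula.all (x b : ℕ) (φ : Formula) : Formula := .neg (.ex x b (.neg φ))

/-- The truth of a formula in a state; `ex x b φ` says that `φ` holds for some value of the
variable `x` below the value of the variable `b`. -/
def Formula.Holds (s : State) : Formula → Prop
  | .atom e => e.eval s ≠ 0
  | .and φ ψ => φ.Holds s ∧ ψ.Holds s
  | .neg φ => ¬ φ.Holds s
  | .ex x b φ => ∃ i < s.var b, φ.Holds (s.setVar x i)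

theorem Formula.holds_all (s : State) (x b : ℕ) (φ : Formula) :
    (Formula.all x b φ).Holds s ↔ ∀ i < s.var b, φ.Holds (s.setVar x i) := by
  simp only [Formula.all, Formula.Holds, not_exists, not_and, not_not]

/-- All numbers that occur in the evaluation of a formula are at most `W`, and all quantifiers are
bounded by at most `N`. -/
def Formula.Fits (W N : ℕ) (s : State) : Formula → Prop
  | .atom e => e.Fits W s
  | .and φ ψ => φ.Fits W N s ∧ ψ.Fits W N s
  | .neg φ => φ.Fits W N s
  | .ex x b φ => s.var b ≤ N ∧ ∀ i < s.var b, φ.Fits W N (s.setVar x i)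

/-- All variables that occur in the expression are less than `B`. -/
def Expr.VarsLt (B : ℕ) : Expr → Prop
  | .const _ => True
  | .var x => x < B
  | .read _ i => i.VarsLt B
  | .add e f => e.VarsLt B ∧ f.VarsLt B
  | .sub e f => e.VarsLt B ∧ f.VarsLt B
  | .mul e f => e.VarsLt B ∧ f.VarsLt B
  | .lt e f => e.VarsLt B ∧ f.VarsLt B
  | .eq e f => e.VarsLt B ∧ f.VarsLt B

/-- The free variables of the formula are less than `B`, and its bound variables are numbered by
their nesting depth, starting from `B` and staying below `o`. -/
def Formula.WF (o : ℕ) : ℕ → Formula → Prop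
  | B, .atom e => e.VarsLt B
  | B, .and φ ψ => φ.WF o B ∧ ψ.WF o B
  | B, .neg φ => φ.WF o B
  | B, .ex x b φ => b < B ∧ x = B ∧ B < o ∧ φ.WF o (B + 1)

/-- The program that computes the truth value of a formula in the variable `o`. -/
def Formula.prog (o : ℕ) : Formula → Prog
  | .atom e => .assign o (.lt (.const 0) e)
  | .and φ ψ => .seq (φ.prog o) (.ite (.var o) (ψ.prog o) .skip)
  | .neg φ => .seq (φ.prog o) (.assign o (.sub (.const 1) (.var o)))
  | .ex x b φ => .seq (.assign o (.const 0)) (.forLt x b (.ite (.var o) .skip (φ.prog o)))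

/-- An upper bound for the running time of `Formula.prog` if all quantifiers are bounded by at
most `N`. -/
def Formula.cost (N : ℕ) : Formula → ℕ
  | .atom e => e.cost + 3
  | .and φ ψ => φ.cost N + ψ.cost N + 2
  | .neg φ => φ.cost N + 4
  | .ex _ _ φ => N * (φ.cost N + 10) + 8

theorem Formula.cost_pos (N : ℕ) (φ : Formula) : 1 ≤ φ.cost N := by
  cases φ <;> simp only [Formula.cost] <;> omega

/-- The states agree on all arrays and on the variables less than `B`. -/
structure Agree (B : ℕ) (s s' : State) : Prop where
  var : ∀ y < B, s'.var y = s.var y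
  arr : s'.arr = s.arr

namespace Agree

variable {B x : ℕ} {s s' s₁ s₂ s₃ : State}

theorem refl (B : ℕ) (s : State) : Agree B s s :=
  ⟨fun _ _ => rfl, rfl⟩

theorem trans (h₁ : Agree B s₁ s₂) (h₂ : Agree B s₂ s₃) : Agree B s₁ s₃ :=
  ⟨fun y hy => (h₂.var y hy).trans (h₁.var y hy), h₂.arr.trans h₁.arr⟩

theorem mono {B' : ℕ} (h : Agree B s s') (hB : B' ≤ B) : Agree B' s s' :=
  ⟨fun y hy => h.var y (hy.trans_le hB), h.arr⟩

theorem setVar_right (h : Agree B s s') (hx : B ≤ x) (v : ℕ) : Agree B s (s'.setVar x v) :=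
  ⟨fun y hy => by rw [State.setVar_var, if_neg (hy.trans_le hx).ne, h.var y hy], h.arr⟩

theorem setVar (h : Agree B s s') (v : ℕ) : Agree (B + 1) (s.setVar B v) (s'.setVar B v) := by
  refine ⟨fun y hy => ?_, h.arr⟩
  rcases Nat.lt_succ_iff_lt_or_eq.1 hy with hy | rfl
  · simp only [State.setVar_var, h.var y hy]
  · simp only [State.setVar_var, if_true]

theorem setVar_left (h : Agree B s s') : Agree (B + 1) (s.setVar B (s'.var B)) s' := by
  refine ⟨fun y hy => ?_, h.arr⟩
  rcases Nat.lt_succ_iff_lt_or_eq.1 hy with hy | rfl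
  · rw [State.setVar_var, if_neg hy.ne, h.var y hy]
  · rw [State.setVar_var, if_pos rfl]

theorem eval_eq (h : Agree B s s') {e : Expr} (he : e.VarsLt B) : e.eval s' = e.eval s := by
  induction e with
  | const c => rfl
  | var x => exact h.var x he
  | read a i ih => simp only [Expr.eval, ih he, h.arr]
  | add e f ih₁ ih₂ | sub e f ih₁ ih₂ | mul e f ih₁ ih₂ | lt e f ih₁ ih₂ | eq e f ih₁ ih₂ =>
    simp only [Expr.eval, ih₁ he.1, ih₂ he.2]

theorem fits_iff (h : Agree B s s') {W : ℕ} {e : Expr} (he : e.VarsLt B) :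
    e.Fits W s' ↔ e.Fits W s := by
  induction e with
  | const c => rfl
  | var x => simp only [Expr.Fits, h.var x he]
  | read a i ih => simp only [Expr.Fits, ih he, h.arr, h.eval_eq (e := i) he]
  | add e f ih₁ ih₂ | sub e f ih₁ ih₂ | mul e f ih₁ ih₂ | lt e f ih₁ ih₂ | eq e f ih₁ ih₂ =>
    simp only [Expr.Fits, ih₁ he.1, ih₂ he.2, h.eval_eq he.1, h.eval_eq he.2]

theorem holds_iff (h : Agree B s s') {o : ℕ} {φ : Formula} (hφ : φ.WF o B) :
    φ.Holds s' ↔ φ.Holds s := by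
  induction φ generalizing B s s' with
  | atom e => simp only [Formula.Holds, h.eval_eq (e := e) hφ]
  | and φ ψ ih₁ ih₂ => simp only [Formula.Holds, ih₁ h hφ.1, ih₂ h hφ.2]
  | neg φ ih => simp only [Formula.Holds, ih h hφ]
  | ex x b φ ih =>
    obtain ⟨hb, rfl, -, hφ⟩ := hφ
    simp only [Formula.Holds, h.var b hb, ih (h.setVar _) hφ]

theorem formulaFits_iff (h : Agree B s s') {W N o : ℕ} {φ : Formula} (hφ : φ.WF o B) :
    φ.Fits W N s' ↔ φ.Fits W N s := by
  induction φ generalizing B s s' with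
  | atom e => exact h.fits_iff (e := e) hφ
  | and φ ψ ih₁ ih₂ => simp only [Formula.Fits, ih₁ h hφ.1, ih₂ h hφ.2]
  | neg φ ih => exact ih h hφ
  | ex x b φ ih =>
    obtain ⟨hb, rfl, -, hφ⟩ := hφ
    simp only [Formula.Fits, h.var b hb, ih (h.setVar _) hφ]

end Agree

namespace Formula

variable {W N o B : ℕ} {s : State} {φ ψ : Formula}

/-- What is required of the program of a formula `φ` with free variables below `B`: it puts the
truth value of `φ` into the variable `o` and does not change what a formula can refer to. -/
def Computes (W N o B : ℕ) (φ : Formula) (s : State) : Prop :=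
  Runs W (φ.prog o) s (φ.cost N) fun s' => Agree B s s' ∧ IsTruthValue (s'.var o) (φ.Holds s)

theorem computes_atom {e : Expr} (hW : 1 ≤ W) (ho : B ≤ o) (hf : e.Fits W s) :
    (atom e).Computes W N o B s := by
  refine (Runs.assign (e := .lt (.const 0) e) ⟨Nat.zero_le W, hf, hW⟩
    ⟨(Agree.refl B s).setVar_right ho _, ?_⟩).le_time (by simp only [Expr.cost, cost]; omega)
  simp only [State.setVar_var, if_true, Expr.eval, Holds, ← Nat.pos_iff_ne_zero]
  exact .ite

theorem Computes.and (hW : 1 ≤ W) (hφ : φ.Computes W N o B s)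
    (hψ : ∀ s', Agree B s s' → ψ.Computes W N o B s') (hψB : ψ.WF o B) :
    (Formula.and φ ψ).Computes W N o B s := by
  have hψ_pos := ψ.cost_pos N
  refine (hφ.seq (t₂ := 2 + ψ.cost N) fun s₁ ⟨hs₁, hval⟩ =>
    Runs.ite (e := .var o) (hval.1.trans hW) ?_ ?_).le_time (by simp only [cost]; omega)
  · intro h
    have hφs : φ.Holds s := hval.2.1 h
    exact (hψ s₁ hs₁).imp fun s₂ ⟨hs₂, hval₂⟩ =>
      ⟨hs₁.trans hs₂, hval₂.congr (by simp only [Holds, hφs, hs₁.holds_iff hψB, true_and])⟩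
  · intro h
    have hφs : ¬ φ.Holds s := fun hφs => hval.2.2 hφs h
    exact (Runs.skip ⟨hs₁, hval.congr (by simp only [Holds, hφs, false_and])⟩).le_time hψ_pos

theorem Computes.neg (hW : 1 ≤ W) (ho : B ≤ o) (hφ : φ.Computes W N o B s) :
    (Formula.neg φ).Computes W N o B s := by
  refine hφ.seq fun s₁ ⟨hs₁, hval⟩ => Runs.assign (e := .sub (.const 1) (.var o))
    ⟨hW, hval.1.trans hW⟩
    ⟨hs₁.setVar_right ho _, ?_⟩
  simpa only [State.setVar_var, if_true, Expr.eval, Holds] using hval.not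

theorem Computes.ex {b : ℕ} (hW : 1 ≤ W) (hN : N ≤ W) (ho : B < o) (hb : b < B) (hbN : s.var b ≤ N)
    (hφ : ∀ i < s.var b, ∀ s', Agree (B + 1) (s.setVar B i) s' → φ.Computes W N o (B + 1) s')
    (hφB : φ.WF o (B + 1)) : (Formula.ex B b φ).Computes W N o B s := by
  have hφ_pos := φ.cost_pos N
  have hinit : Runs W (.assign o (.const 0)) s 2 (· = s.setVar o 0) :=
    Runs.assign (Nat.zero_le W) rfl
  refine (hinit.seq fun s₀ hs₀ => ?_).le_time (t₁ := 2 + (s.var b * (2 + φ.cost N + 8) + 6)) ?_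
  · subst hs₀
    refine (Runs.forLt_of_invariant (fun i s' => s'.var B = i ∧ Agree B s s' ∧
      IsTruthValue (s'.var o) (∃ j < i, φ.Holds (s.setVar B j))) (hbN.trans hN) hW ?_ ?_ ?_).imp
      fun s' h => h.2
    · exact fun i s' h => ⟨h.1, h.2.1.var b hb⟩
    · refine ⟨by simp only [State.setVar_var, if_true],
        ((Agree.refl B s).setVar_right ho.le 0).setVar_right le_rfl 0, ?_⟩
      simp only [State.setVar_var, ho.ne', if_false, if_true]
      exact .zero (by simp only [Nat.not_lt_zero, false_and, exists_false, not_false_eq_true])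
    · rintro i s' hi ⟨rfl, hs', hval⟩
      refine Runs.ite (hval.1.trans hW) (fun h => ?_) fun h => ?_
      · refine (Runs.skip ⟨rfl, by simp only [State.setVar_var, if_true],
          hs'.setVar_right le_rfl _, ?_⟩).le_time hφ_pos
        rw [State.setVar_var, if_neg ho.ne']
        obtain ⟨j, hj, hφj⟩ := hval.2.1 h
        exact hval.congr (iff_of_true ⟨j, hj, hφj⟩ ⟨j, hj.trans (Nat.lt_succ_self _), hφj⟩)
      · have hnot : ¬ ∃ j < s'.var B, φ.Holds (s.setVar B j) := fun hex => hval.2.2 hex h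
        refine (hφ _ hi s' hs'.setVar_left).imp fun s'' ⟨hs'', hval'⟩ => ?_
        refine ⟨hs''.var B (Nat.lt_succ_self B), by simp only [State.setVar_var, if_true],
          (hs'.trans (hs''.mono (Nat.le_succ B))).setVar_right le_rfl _, ?_⟩
        rw [State.setVar_var, if_neg ho.ne']
        refine hval'.congr ?_
        rw [Nat.exists_lt_succ_right, or_iff_right hnot, hs'.setVar_left.holds_iff hφB]
  · have := Nat.mul_le_mul_right (φ.cost N + 10) hbN
    simp only [cost, show 2 + φ.cost N + 8 = φ.cost N + 10 by omega]
    omega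

theorem runs_prog (hW : 1 ≤ W) (hN : N ≤ W) (ho : B ≤ o) (hφB : φ.WF o B) (hφ : φ.Fits W N s) :
    Runs W (φ.prog o) s (φ.cost N)
      fun s' => Agree B s s' ∧ IsTruthValue (s'.var o) (φ.Holds s) := by
  induction φ generalizing B s with
  | atom e => exact computes_atom hW ho hφ
  | and φ ψ ih₁ ih₂ =>
    exact Computes.and hW (ih₁ ho hφB.1 hφ.1)
      (fun s' hs' => ih₂ ho hφB.2 ((hs'.formulaFits_iff hφB.2).2 hφ.2)) hφB.2
  | neg φ ih => exact Computes.neg hW ho (ih ho hφB hφ)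
  | ex x b φ ih =>
    obtain ⟨hb, rfl, hxo, hφx⟩ := hφB
    exact Computes.ex hW hN hxo hb hφ.1
      (fun i hi s' hs' => ih hxo hφx ((hs'.formulaFits_iff hφx).2 (hφ.2 i hi))) hφx

end Formula

/-! ## Shortest paths as lists of vertices -/

section ShortestPath

variable {V : Type} {G : SimpleGraph V} {P Q : List V}

theorem isShortestPath_iff :
    IsShortestPath G P ↔ P ≠ [] ∧ ∀ (i j : ℕ) (hij : i ≤ j) (hj : j < P.length),
      G.dist (P[i]'(hij.trans_lt hj)) P[j] = j - i := by
  constructor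
  · rintro ⟨u, v, p, hp, rfl⟩
    refine ⟨p.support_ne_nil, fun i j hij hj => ?_⟩
    have hsub : ((p.drop i).take (j - i)).IsSubwalk p :=
      ((p.drop i).isSubwalk_take _).trans (p.isSubwalk_drop i)
    have hdist := SimpleGraph.length_eq_dist_of_subwalk hp hsub
    rw [SimpleGraph.Walk.length_support] at hj
    rw [SimpleGraph.Walk.take_length, SimpleGraph.Walk.drop_length,
      SimpleGraph.Walk.drop_getVert, Nat.add_sub_cancel' hij] at hdist
    simp only [SimpleGraph.Walk.support_getElem_eq_getVert]
    omega
  · rintro ⟨hne, h⟩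
    have hlen := List.length_pos_iff.2 hne
    have hchain : P.IsChain G.Adj := List.isChain_iff_getElem.2 fun i hi =>
      SimpleGraph.dist_eq_one_iff_adj.1 (by rw [h i (i + 1) (by omega) hi]; omega)
    refine ⟨_, _, .ofSupport P hne hchain, ?_, SimpleGraph.Walk.support_ofSupport hne hchain⟩
    rw [SimpleGraph.Walk.length_ofSupport, List.head_eq_getElem, List.getLast_eq_getElem,
      h 0 (P.length - 1) (by omega) (by omega)]
    omega

theorem IsShortestPath.ne_nil (hP : IsShortestPath G P) : P ≠ [] :=
  (isShortestPath_iff.1 hP).1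

theorem IsShortestPath.dist_getElem (hP : IsShortestPath G P) {i j : ℕ} (hi : i < P.length)
    (hj : j < P.length) : G.dist P[i] P[j] = (j - i) + (i - j) := by
  rcases le_total i j with h | h
  · rw [(isShortestPath_iff.1 hP).2 i j h hj]
    omega
  · rw [SimpleGraph.dist_comm, (isShortestPath_iff.1 hP).2 j i h hi]
    omega

theorem isShortestPath_singleton (v : V) : IsShortestPath G [v] :=
  ⟨v, v, .nil, SimpleGraph.dist_self.symm, rfl⟩

theorem isShortestPath_pair {a b : V} (h : G.Adj a b) : IsShortestPath G [a, b] :=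
  ⟨a, b, .cons h .nil, (SimpleGraph.dist_eq_one_iff_adj.2 h).symm, rfl⟩

theorem IsShortestPath.map {V' : Type} {G' : SimpleGraph V'} (hP : IsShortestPath G P) (g : V → V')
    (h : ∀ x ∈ P, ∀ y ∈ P, G'.dist (g x) (g y) = G.dist x y) : IsShortestPath G' (P.map g) := by
  rw [isShortestPath_iff] at hP ⊢
  refine ⟨by simpa only [ne_eq, List.map_eq_nil_iff] using hP.1, fun i j hij hj => ?_⟩
  rw [List.length_map] at hj
  rw [List.getElem_map, List.getElem_map, h _ (List.getElem_mem _) _ (List.getElem_mem _),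
    hP.2 i j hij hj]

theorem pathEcc_le_iff (hG : G.Connected) (k : ℕ) :
    pathEcc G P ≤ k ↔ ∀ u, ∃ s ∈ P, G.dist u s ≤ k := by
  simp only [pathEcc, setEcc, distToSet, iSup_le_iff]
  refine forall_congr' fun u => ⟨fun h => ?_, ?_⟩
  · by_contra! hc
    have hle : ((k + 1 : ℕ) : ℕ∞) ≤ ⨅ s ∈ {v | v ∈ P}, G.edist u s := by
      refine le_iInf₂ fun s hs => ?_
      rw [← (hG u s).coe_dist_eq_edist]
      exact_mod_cast hc s hs
    exact (Nat.lt_succ_self k).not_ge (by exact_mod_cast hle.trans h)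
  · rintro ⟨s, hs, h⟩
    refine (iInf₂_le s hs).trans ?_
    rw [← (hG u s).coe_dist_eq_edist]
    exact_mod_cast h

theorem pathEcc_le_of_forall (h : ∀ k : ℕ, pathEcc G Q ≤ k → pathEcc G P ≤ k) :
    pathEcc G P ≤ pathEcc G Q := by
  cases hQ : pathEcc G Q with
  | top => exact le_top
  | coe k => exact h k hQ.le

theorem exchange_self (P : List V) (p : V) : exchange P p p = P := by
  classical
  exact (List.map_congr_left fun x _ => ite_eq_right_iff.2 Eq.symm).trans (List.map_id P)

end ShortestPath

/-! ## Substitutions -/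

/-- The connected graph `G` is the substitution of the vertices of the pattern `T`, of which there
are at least three, by the graphs induced on the (nonempty) fibres of `f`. -/
structure IsSubst {V ι : Type} (G : SimpleGraph V) (T : SimpleGraph ι) (f : V → ι) : Prop where
  connected : G.Connected
  surjective : Function.Surjective f
  adj_iff : ∀ {x y}, f x ≠ f y → (G.Adj x y ↔ T.Adj (f x) (f y))
  exists_third : ∀ i j : ι, ∃ l, l ≠ i ∧ l ≠ j

namespace IsSubst

variable {V ι : Type} {G : SimpleGraph V} {T : SimpleGraph ι} {f : V → ι} {P Q : List V}

theorem exists_walk_proj (h : IsSubst G T f) {x y : V} (p : G.Walk x y) :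
    ∃ q : T.Walk (f x) (f y), q.length ≤ p.length := by
  induction p with
  | nil => exact ⟨.nil, le_rfl⟩
  | @cons u v w hadj p ih =>
    obtain ⟨q, hq⟩ := ih
    by_cases huv : f u = f v
    · refine ⟨q.copy huv.symm rfl, ?_⟩
      rw [SimpleGraph.Walk.length_copy, SimpleGraph.Walk.length_cons]
      omega
    · exact ⟨.cons ((h.adj_iff huv).1 hadj) q, Nat.succ_le_succ hq⟩

theorem exists_walk_lift (h : IsSubst G T f) {i j : ι} (q : T.Walk i j) (hij : i ≠ j) :
    ∀ x y, f x = i → f y = j → ∃ p : G.Walk x y, p.length ≤ q.length := by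
  induction q with
  | nil => exact absurd rfl hij
  | @cons u v w hadj q ih =>
    rintro x y rfl rfl
    by_cases hv : v = f y
    · subst hv
      exact ⟨.cons ((h.adj_iff hij).2 hadj) .nil, Nat.succ_le_succ (Nat.zero_le _)⟩
    · obtain ⟨z, rfl⟩ := h.surjective v
      obtain ⟨p, hp⟩ := ih hv z y rfl rfl
      exact ⟨.cons ((h.adj_iff hadj.ne).2 hadj) p, Nat.succ_le_succ hp⟩

theorem pattern_connected (h : IsSubst G T f) : T.Connected := by
  have : Nonempty ι := h.connected.nonempty.map f
  refine ⟨fun i j => ?_⟩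
  obtain ⟨x, rfl⟩ := h.surjective i
  obtain ⟨y, rfl⟩ := h.surjective j
  obtain ⟨p⟩ := h.connected x y
  exact ⟨(h.exists_walk_proj p).choose⟩

theorem dist_eq (h : IsSubst G T f) {x y : V} (hxy : f x ≠ f y) :
    G.dist x y = T.dist (f x) (f y) := by
  refine le_antisymm ?_ ?_
  · obtain ⟨q, hq⟩ := h.pattern_connected.exists_walk_length_eq_dist (f x) (f y)
    obtain ⟨p, hp⟩ := h.exists_walk_lift q hxy x y rfl rfl
    exact (SimpleGraph.dist_le p).trans (hp.trans hq.le)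
  · obtain ⟨p, hp⟩ := h.connected.exists_walk_length_eq_dist x y
    obtain ⟨q, hq⟩ := h.exists_walk_proj p
    exact (SimpleGraph.dist_le q).trans (hq.trans hp.le)

theorem dist_congr_right (h : IsSubst G T f) {x y y' : V} (hy : f y = f y') (hxy : f x ≠ f y) :
    G.dist x y = G.dist x y' := by
  rw [h.dist_eq hxy, h.dist_eq (hy ▸ hxy), hy]

theorem dist_congr_left (h : IsSubst G T f) {x x' y : V} (hx : f x = f x') (hxy : f x ≠ f y) :
    G.dist x y = G.dist x' y := by
  rw [G.dist_comm, G.dist_comm (u := x'), h.dist_congr_right hx hxy.symm]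

theorem adj_of_pattern_adj (h : IsSubst G T f) {x y : V} (hxy : T.Adj (f x) (f y)) : G.Adj x y :=
  (h.adj_iff hxy.ne).2 hxy

theorem exists_pattern_adj (h : IsSubst G T f) (x : V) : ∃ y, T.Adj (f x) (f y) := by
  obtain ⟨i, hi, -⟩ := h.exists_third (f x) (f x)
  have : Nontrivial ι := ⟨i, f x, hi⟩
  obtain ⟨j, hj⟩ := h.pattern_connected.preconnected.exists_adj_of_nontrivial (f x)
  obtain ⟨y, rfl⟩ := h.surjective j
  exact ⟨y, hj⟩

theorem exists_notMem_module_ne (h : IsSubst G T f) (i : ι) (w : V) : ∃ z, f z ≠ i ∧ z ≠ w := by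
  obtain ⟨l, hl, hlw⟩ := h.exists_third i (f w)
  obtain ⟨z, rfl⟩ := h.surjective l
  exact ⟨z, hl, ne_of_apply_ne f hlw⟩

theorem dist_le_two (h : IsSubst G T f) {x y : V} (hf : f x = f y) : G.dist x y ≤ 2 := by
  obtain ⟨w, hw⟩ := h.exists_pattern_adj x
  have htri := h.connected.dist_triangle (u := x) (v := w) (w := y)
  rwa [SimpleGraph.dist_eq_one_iff_adj.2 (h.adj_of_pattern_adj hw),
    SimpleGraph.dist_eq_one_iff_adj.2 (h.adj_of_pattern_adj (y := w) (hf ▸ hw)).symm] at htri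

theorem eq_of_two_mem_module (h : IsSubst G T f) (hP : IsShortestPath G P) {s t q : ℕ}
    (hs : s < P.length) (ht : t < P.length) (hq : q < P.length) (hst : s ≠ t)
    (hf : f P[s] = f P[t]) (hne : f P[q] ≠ f P[s]) : s + t = 2 * q ∧ s - t ≤ 2 ∧ t - s ≤ 2 := by
  have hqst := h.dist_congr_left hf hne.symm
  have hst_le := h.dist_le_two hf
  rw [hP.dist_getElem hs hq, hP.dist_getElem ht hq] at hqst
  rw [hP.dist_getElem hs ht] at hst_le
  omega

theorem exists_pattern_adj_of_two_mem_module (h : IsSubst G T f) (hP : IsShortestPath G P) {x y : V}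
    (hx : x ∈ P) (hy : y ∈ P) (hxy : x ≠ y) (hf : f x = f y) :
    ∃ w, T.Adj (f x) (f w) ∧ ∀ z ∈ P, f z = f x ∨ z = w := by
  by_cases hall : ∀ z ∈ P, f z = f x
  · obtain ⟨w, hw⟩ := h.exists_pattern_adj x
    exact ⟨w, hw, fun z hz => Or.inl (hall z hz)⟩
  push Not at hall
  obtain ⟨w, hw, hwx⟩ := hall
  obtain ⟨s, hs, rfl⟩ := List.mem_iff_getElem.1 hx
  obtain ⟨t, ht, rfl⟩ := List.mem_iff_getElem.1 hy
  obtain ⟨q, hq, rfl⟩ := List.mem_iff_getElem.1 hw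
  have hst : s ≠ t := by
    rintro rfl
    exact hxy rfl
  have hpos := h.eq_of_two_mem_module hP hs ht hq hst hf hwx
  refine ⟨P[q], (h.adj_iff hwx.symm).1 ?_, fun z hz => or_iff_not_imp_left.2 fun hzx => ?_⟩
  · rw [← SimpleGraph.dist_eq_one_iff_adj, hP.dist_getElem hs hq]
    omega
  · obtain ⟨q', hq', rfl⟩ := List.mem_iff_getElem.1 hz
    have hpos' := h.eq_of_two_mem_module hP hs ht hq' hst hf hzx
    obtain rfl : q' = q := by omega
    rfl

theorem exists_notMem_of_two_mem_module (h : IsSubst G T f) (hP : IsShortestPath G P) {x y : V}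
    (hx : x ∈ P) (hy : y ∈ P) (hxy : x ≠ y) (hf : f x = f y) : ∃ z, z ∉ P := by
  obtain ⟨w, -, hsub⟩ := h.exists_pattern_adj_of_two_mem_module hP hx hy hxy hf
  obtain ⟨z, hzx, hzw⟩ := h.exists_notMem_module_ne (f x) w
  exact ⟨z, fun hz => (hsub z hz).elim hzx hzw⟩

theorem pathEcc_le_pathEcc (h : IsSubst G T f) (hPQ : P.map f ⊆ Q.map f)
    (hadj : ∀ i ∈ Q.map f, ∃ j ∈ Q.map f, T.Adj i j) (hall : (∀ z, z ∈ P) → ∀ z, z ∈ Q) :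
    pathEcc G Q ≤ pathEcc G P := by
  refine pathEcc_le_of_forall fun k hk => ?_
  rw [pathEcc_le_iff h.connected] at hk ⊢
  intro u
  rcases k.eq_zero_or_pos with rfl | hk_pos
  · refine ⟨u, hall (fun z => ?_) u, G.dist_self.le⟩
    obtain ⟨s, hs, hd⟩ := hk z
    exact (h.connected.dist_eq_zero_iff.1 (Nat.le_zero.1 hd)) ▸ hs
  · obtain ⟨s, hs, hd⟩ := hk u
    obtain ⟨t, ht, hts⟩ := List.mem_map.1 (hPQ (List.mem_map_of_mem hs))
    by_cases hu : f u = f s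
    · obtain ⟨j, hj, hij⟩ := hadj (f t) (List.mem_map_of_mem ht)
      obtain ⟨w, hw, rfl⟩ := List.mem_map.1 hj
      refine ⟨w, hw, ?_⟩
      rwa [SimpleGraph.dist_eq_one_iff_adj.2 (h.adj_of_pattern_adj (hu ▸ hts ▸ hij))]
    · exact ⟨t, ht, by rwa [← h.dist_congr_right hts.symm hu]⟩

theorem exists_injOn_of_subset (h : IsSubst G T f) {a w : V} (haw : T.Adj (f a) (f w))
    (hsub : ∀ z ∈ P, f z = f a ∨ z = w) :
    ∃ Q, IsShortestPath G Q ∧ 2 ≤ Q.length ∧ (∀ x ∈ Q, ∀ y ∈ Q, f x = f y → x = y) ∧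
      pathEcc G Q ≤ pathEcc G P := by
  refine ⟨[a, w], isShortestPath_pair (h.adj_of_pattern_adj haw), le_rfl, ?_,
    h.pathEcc_le_pathEcc (fun i hi => ?_) ?_ fun hall => ?_⟩
  · simp [haw.ne, haw.ne']
  · obtain ⟨z, hz, rfl⟩ := List.mem_map.1 hi
    rcases hsub z hz with hz | rfl <;> simp [*]
  · simp [haw, haw.symm]
  · obtain ⟨z, hza, hzw⟩ := h.exists_notMem_module_ne (f a) w
    exact absurd (hsub z (hall z)) (not_or.2 ⟨hza, hzw⟩)

theorem exists_injOn (h : IsSubst G T f) (hP : IsShortestPath G P) :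
    ∃ Q, IsShortestPath G Q ∧ 2 ≤ Q.length ∧ (∀ x ∈ Q, ∀ y ∈ Q, f x = f y → x = y) ∧
      pathEcc G Q ≤ pathEcc G P := by
  by_cases hinj : ∀ x ∈ P, ∀ y ∈ P, f x = f y → x = y
  · by_cases hlen : 2 ≤ P.length
    · exact ⟨P, hP, hlen, hinj, le_rfl⟩
    · have hlen_pos := List.length_pos_iff.2 hP.ne_nil
      obtain ⟨a, rfl⟩ := List.length_eq_one_iff.1 (show P.length = 1 by omega)
      obtain ⟨w, hw⟩ := h.exists_pattern_adj a
      exact h.exists_injOn_of_subset hw fun z hz => Or.inl (by rw [List.mem_singleton.1 hz])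
  · push Not at hinj
    obtain ⟨x, hx, y, hy, hf, hxy⟩ := hinj
    obtain ⟨w, hw, hsub⟩ := h.exists_pattern_adj_of_two_mem_module hP hx hy hxy hf
    exact h.exists_injOn_of_subset hw hsub

theorem exists_isMinEccShortestPath_injOn (h : IsSubst G T f) :
    ∃ P, IsMinEccShortestPath G P ∧ ∀ x ∈ P, ∀ y ∈ P, f x = f y → x = y := by
  obtain ⟨v⟩ := h.connected.nonempty
  have hne : {P | IsShortestPath G P}.Nonempty := ⟨[v], isShortestPath_singleton v⟩
  obtain ⟨Q, hQ, -, hinj, hle⟩ := h.exists_injOn (Function.argminOn_mem (pathEcc G) _ hne)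
  exact ⟨Q, ⟨hQ, fun R hR => hle.trans (Function.argminOn_le (pathEcc G) _ hR)⟩, hinj⟩

theorem exists_pattern_adj_mem_map (h : IsSubst G T f) (hP : IsShortestPath G P)
    (hnot : ∀ i, ∃ x ∈ P, f x ≠ i) : ∀ i ∈ P.map f, ∃ j ∈ P.map f, T.Adj i j := by
  classical
  intro i hi
  obtain ⟨p, hp, rfl⟩ := List.mem_map.1 hi
  obtain ⟨x, hx, hxp⟩ := hnot (f p)
  obtain ⟨u, v, W, -, rfl⟩ := hP
  suffices H : ∃ d ∈ W.darts, (f d.fst = f p ∧ f d.snd ≠ f p) ∨ (f d.fst ≠ f p ∧ f d.snd = f p) by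
    obtain ⟨d, hd, ⟨hfst, hsnd⟩ | ⟨hfst, hsnd⟩⟩ := H
    · exact ⟨_, List.mem_map_of_mem (W.dart_snd_mem_support_of_mem_darts hd),
        hfst ▸ (h.adj_iff (hfst ▸ hsnd.symm)).1 d.adj⟩
    · exact ⟨_, List.mem_map_of_mem (W.dart_fst_mem_support_of_mem_darts hd),
        hsnd ▸ (h.adj_iff (hsnd ▸ hfst.symm)).1 d.adj.symm⟩
  by_cases hu : f u = f p
  · obtain ⟨d, hd, hfst, hsnd⟩ := (W.takeUntil x hx).exists_boundary_dart {z | f z = f p} hu hxp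
    exact ⟨d, W.darts_takeUntil_subset_darts hx hd, Or.inl ⟨hfst, hsnd⟩⟩
  · obtain ⟨d, hd, hfst, hsnd⟩ := (W.takeUntil p hp).exists_boundary_dart {z | f z ≠ f p} hu
      (not_not.2 rfl)
    exact ⟨d, W.darts_takeUntil_subset_darts hp hd, Or.inr ⟨hfst, not_not.1 hsnd⟩⟩

theorem map_exchange {p p' : V} (hf : f p = f p') : (exchange P p p').map f = P.map f := by
  rw [exchange, List.map_map]
  refine List.map_congr_left fun x _ => ?_
  by_cases hx : x = p
  · simp only [Function.comp_apply, hx, if_true, hf]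
  · simp only [Function.comp_apply, hx, if_false]

theorem pathEcc_exchange (h : IsSubst G T f) (hP : IsShortestPath G P) {p p' : V} (hp : p ∈ P)
    (hf : f p = f p') (hx : ∃ x ∈ P, f x ≠ f p) :
    pathEcc G (exchange P p p') = pathEcc G P := by
  have hadj := h.exists_pattern_adj_mem_map hP fun i =>
    (eq_or_ne (f p) i).elim (fun hi => hi ▸ hx) fun hi => ⟨p, hp, hi⟩
  have hmap := map_exchange (P := P) hf
  rcases eq_or_ne p p' with rfl | hpp
  · rw [exchange_self]
  refine le_antisymm (h.pathEcc_le_pathEcc (by rw [hmap]; exact List.Subset.refl _)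
      (by rwa [hmap]) fun hall => ?_)
    (h.pathEcc_le_pathEcc (by rw [hmap]; exact List.Subset.refl _) hadj fun hall => ?_)
  · obtain ⟨z, hz⟩ := h.exists_notMem_of_two_mem_module hP hp (hall p') hpp hf
    exact absurd (hall z) hz
  · obtain ⟨x, -, hx⟩ := List.mem_map.1 (hall p)
    split_ifs at hx with hxp
    exacts [absurd hx.symm hpp, absurd hx hxp]

theorem isShortestPath_exchange (h : IsSubst G T f) (hP : IsShortestPath G P) {p p' : V}
    (hf : f p = f p') (honly : ∀ x ∈ P, f x = f p → x = p) :
    IsShortestPath G (exchange P p p') := by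
  refine hP.map _ fun x hx y hy => ?_
  by_cases hxp : x = p <;> by_cases hyp : y = p
  · simp only [hxp, hyp, G.dist_self]
  · have hne : f p ≠ f y := fun h' => hyp (honly y hy h'.symm)
    simp only [hxp, hyp, if_true, if_false, h.dist_congr_left hf hne]
  · have hne : f x ≠ f p := fun h' => hxp (honly x hx h')
    simp only [hxp, hyp, if_true, if_false, h.dist_congr_right hf hne]
  · simp only [hxp, hyp, if_false]

theorem isShortestPath_map_proj (h : IsSubst G T f) (hP : IsShortestPath G P)
    (hinj : ∀ x ∈ P, ∀ y ∈ P, f x = f y → x = y) : IsShortestPath T (P.map f) := by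
  refine hP.map f fun x hx y hy => ?_
  rcases eq_or_ne x y with rfl | hxy
  · rw [T.dist_self, G.dist_self]
  · rw [h.dist_eq (mt (hinj x hx y hy) hxy)]

theorem isShortestPath_map_section (h : IsSubst G T f) {r : ι → V} (hr : Function.RightInverse r f)
    {π : List ι} (hπ : IsShortestPath T π) : IsShortestPath G (π.map r) := by
  refine hπ.map r fun i _ j _ => ?_
  rcases eq_or_ne i j with rfl | hij
  · rw [T.dist_self, G.dist_self]
  · rw [h.dist_eq (by rwa [hr, hr]), hr, hr]

theorem pathEcc_map_section_le (h : IsSubst G T f) {r : ι → V} (hr : Function.RightInverse r f)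
    (hP : IsShortestPath G P) (hlen : 2 ≤ P.length)
    (hinj : ∀ x ∈ P, ∀ y ∈ P, f x = f y → x = y) :
    pathEcc G ((P.map f).map r) ≤ pathEcc G P := by
  have hmap : ((P.map f).map r).map f = P.map f := by
    rw [List.map_map (l := P.map f), hr.comp_eq_id, List.map_id]
  have hnot : ∀ i, ∃ x ∈ P, f x ≠ i := by
    by_contra! hc
    obtain ⟨i, hi⟩ := hc
    have h01 : P[0] = P[1] := hinj _ (List.getElem_mem _) _ (List.getElem_mem _)
      ((hi _ (List.getElem_mem _)).trans (hi _ (List.getElem_mem _)).symm)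
    have hdist := hP.dist_getElem (i := 0) (j := 1) (by omega) (by omega)
    rw [h01, G.dist_self] at hdist
    omega
  refine h.pathEcc_le_pathEcc (by rw [hmap]; exact List.Subset.refl _)
    (by rw [hmap]; exact h.exists_pattern_adj_mem_map hP hnot) fun hall z => ?_
  have hz : r (f z) = z := hinj _ (hall _) _ (hall z) (hr (f z))
  exact List.mem_map.2 ⟨f z, List.mem_map_of_mem (hall z), hz⟩

theorem yesInstance_iff (h : IsSubst G T f) {r : ι → V} (hr : Function.RightInverse r f) (k : ℕ) :
    YesInstance G k ↔ ∃ π : List ι, IsShortestPath T π ∧ 2 ≤ π.length ∧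
      IsShortestPath G (π.map r) ∧ pathEcc G (π.map r) ≤ k := by
  constructor
  · rintro ⟨P₀, hP₀, hk⟩
    obtain ⟨P, hP, hlen, hinj, hle⟩ := h.exists_injOn hP₀
    have hπ := h.isShortestPath_map_proj hP hinj
    exact ⟨P.map f, hπ, by rwa [List.length_map], h.isShortestPath_map_section hr hπ,
      ((h.pathEcc_map_section_le hr hP hlen hinj).trans hle).trans hk⟩
  · rintro ⟨π, -, -, hP, hk⟩
    exact ⟨_, hP, hk⟩

end IsSubst

theorem isSubst_substGraph {ι : Type} {T : SimpleGraph ι} {V : ι → Type} [∀ i, Nonempty (V i)]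
    {H : ∀ i, SimpleGraph (V i)} (hι : 3 ≤ ENat.card ι) (hG : (substGraph T H).Connected) :
    IsSubst (substGraph T H) T Sigma.fst where
  connected := hG
  surjective i := ⟨⟨i, Classical.arbitrary _⟩, rfl⟩
  adj_iff := by
    rintro x y hxy
    refine ⟨?_, Or.inl⟩
    rintro (h | ⟨i, a, b, -, rfl, rfl⟩)
    · exact h
    · exact absurd rfl hxy
  exists_third i j := by
    by_contra! h
    have hsub : (Set.univ : Set ι) ⊆ {i, j} := fun l _ => or_iff_not_imp_left.2 (h l)
    have hle := (Set.encard_le_encard hsub).trans (Set.encard_insert_le {j} i)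
    rw [Set.encard_univ, Set.encard_singleton] at hle
    exact absurd (hι.trans hle) (by decide)

/-! ## Modules and the modular width -/

section Modules

variable {V W : Type} {G : SimpleGraph V} {H : SimpleGraph W} {a b c x x' y y' : V}

/-- The vertices outside of `M` do not distinguish between the vertices of `M`. -/
def IsModule (G : SimpleGraph V) (M : Set V) : Prop :=
  ∀ x ∉ M, ∀ a ∈ M, ∀ b ∈ M, G.Adj x a → G.Adj x b

/-- Some module other than the set of all vertices contains both vertices. -/
def Together (G : SimpleGraph V) (a b : V) : Prop :=
  ∃ M, IsModule G M ∧ a ∈ M ∧ b ∈ M ∧ ∃ z, z ∉ M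

/-- Some vertex or edge dominates the graph, that is, every other vertex is adjacent to it. -/
def Dominated (G : SimpleGraph V) : Prop :=
  ∃ u v, (u = v ∨ G.Adj u v) ∧ ∀ x, (u = x ∨ G.Adj u x) ∨ (v = x ∨ G.Adj v x)

theorem IsModule.union {A B : Set V} (hA : IsModule G A) (hB : IsModule G B) (hbA : b ∈ A)
    (hbB : b ∈ B) : IsModule G (A ∪ B) := by
  intro x hx y hy z hz hxy
  rw [Set.mem_union, not_or] at hx
  have hxb : G.Adj x b := hy.elim (fun h => hA x hx.1 y h b hbA hxy)
    fun h => hB x hx.2 y h b hbB hxy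
  exact hz.elim (fun h => hA x hx.1 b hbA z h hxb) fun h => hB x hx.2 b hbB z h hxb

/-- If two modules cover the graph, then an edge between their differences dominates it. -/
theorem exists_notMem_union (hG : G.Connected) (hD : ¬ Dominated G) {A B : Set V}
    (hA : IsModule G A) (hB : IsModule G B) (hA' : ∃ z, z ∉ A) (hB' : ∃ z, z ∉ B) :
    ∃ z, z ∉ A ∪ B := by
  by_contra! hcover
  obtain ⟨y, hy⟩ := hA'
  obtain ⟨x, hx⟩ := hB'
  have hxA : x ∈ A := (hcover x).resolve_right hx
  obtain ⟨p⟩ := hG x y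
  obtain ⟨d, -, hs, ht⟩ := p.exists_boundary_dart A hxA hy
  have htB : d.snd ∈ B := (hcover _).resolve_left ht
  have htA : ∀ z ∈ A, G.Adj d.snd z := fun z hz => hA _ ht _ hs z hz d.adj.symm
  have hxt : G.Adj x d.snd := (htA x hxA).symm
  exact hD ⟨x, d.snd, Or.inr hxt, fun z => (hcover z).elim (fun hz => Or.inr (Or.inr (htA z hz)))
    fun hz => Or.inl (Or.inr (hB x hx _ htB z hz hxt))⟩

theorem Together.symm (h : Together G a b) : Together G b a := by
  obtain ⟨M, hM, ha, hb, hz⟩ := h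
  exact ⟨M, hM, hb, ha, hz⟩

theorem Together.refl (hD : ¬ Dominated G) (a : V) : Together G a a := by
  refine ⟨{a}, ?_, rfl, rfl, ?_⟩
  · rintro x - _ rfl _ rfl h
    exact h
  · by_contra! hall
    exact hD ⟨a, a, Or.inl rfl, fun x => Or.inl (Or.inl (hall x).symm)⟩

theorem Together.trans (hG : G.Connected) (hD : ¬ Dominated G)
    (hab : Together G a b) (hbc : Together G b c) : Together G a c := by
  obtain ⟨A, hA, ha, hb, hA'⟩ := hab
  obtain ⟨B, hB, hb', hc, hB'⟩ := hbc
  exact ⟨A ∪ B, hA.union hB hb hb', Or.inl ha, Or.inr hc, exists_notMem_union hG hD hA hB hA' hB'⟩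

theorem Together.adj_of_adj (hx : Together G x x') (hy : Together G y y') (hxy : ¬ Together G x y)
    (hxy' : ¬ Together G x' y') (h : G.Adj x' y') : G.Adj x y := by
  obtain ⟨M, hM, hxM, hxM', hM'⟩ := hx
  obtain ⟨N, hN, hyN, hyN', hN'⟩ := hy
  have hy'M : y' ∉ M := fun hm => hxy' ⟨M, hM, hxM', hm, hM'⟩
  have hxN : x ∉ N := fun hm => hxy ⟨N, hN, hm, hyN, hN'⟩
  exact hN x hxN y' hyN' y hyN (hM y' hy'M x' hxM' x hxM h.symm).symm

theorem exists_not_together [Finite V] (hG : G.Connected) (hD : ¬ Dominated G) (a : V) :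
    ∃ z, ¬ Together G z a := by
  by_contra! hall
  obtain ⟨M, hM, ha, -, hM'⟩ := Together.refl hD a
  obtain ⟨N, -, hN⟩ := (Set.toFinite {N | IsModule G N ∧ a ∈ N ∧ ∃ z, z ∉ N}).exists_le_maximal
    ⟨hM, ha, hM'⟩
  obtain ⟨hNm, haN, z, hz⟩ := hN.prop
  obtain ⟨B, hB, hzB, haB, hB'⟩ := hall z
  have hle := hN.le_of_ge (y := N ∪ B) ⟨hNm.union hB haN haB, Or.inl haN,
    exists_notMem_union hG hD hNm hB ⟨z, hz⟩ hB'⟩ Set.subset_union_left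
  exact hz (hle (Or.inr hzB))

theorem exists_not_together_and_not_together [Finite V] (hG : G.Connected) (hD : ¬ Dominated G)
    (a b : V) : ∃ z, ¬ Together G z a ∧ ¬ Together G z b := by
  by_contra! hcover
  obtain ⟨z, hz⟩ := exists_not_together hG hD a
  have hab : ¬ Together G a b := fun h => hz ((hcover z hz).trans hG hD h.symm)
  obtain ⟨p⟩ := hG a b
  obtain ⟨d, -, hs, ht⟩ := p.exists_boundary_dart {l | Together G l a} (Together.refl hD a)
    fun h : Together G b a => hab h.symm
  replace hs : Together G d.fst a := hs
  have hadj : ∀ x y, Together G x a → Together G y b → G.Adj x y := fun x y hx hy =>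
    Together.adj_of_adj (hx.trans hG hD hs.symm) (hy.trans hG hD (hcover _ ht).symm)
      (fun h => hab (hx.symm.trans hG hD (h.trans hG hD hy)))
      (fun h => ht (h.symm.trans hG hD hs)) d.adj
  refine hD ⟨a, b, Or.inr (hadj a b (.refl hD a) (.refl hD b)), fun x => ?_⟩
  by_cases hx : Together G x a
  · exact Or.inr (Or.inr (hadj x b hx (.refl hD b)).symm)
  · exact Or.inl (Or.inr (hadj a x (.refl hD a) (hcover x hx)))

/-- The partition of a connected graph without a dominating edge into its maximal proper
modules. -/
def togetherSetoid (hG : G.Connected) (hD : ¬ Dominated G) : Setoid V where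
  r := Together G
  iseqv := ⟨Together.refl hD, Together.symm, Together.trans hG hD⟩

theorem isSubst_togetherSetoid [Finite V] (hG : G.Connected) (hD : ¬ Dominated G) :
    IsSubst G (G.comap Quotient.out) (Quotient.mk (togetherSetoid hG hD)) where
  connected := hG
  surjective := Quotient.mk_surjective
  adj_iff {x y} hxy := by
    have hout : ∀ z, Together G (Quotient.mk (togetherSetoid hG hD) z).out z := fun z =>
      Quotient.mk_out (s := togetherSetoid hG hD) z
    have hne : ¬ Together G x y := fun h => hxy (Quotient.sound h)
    have hne' : ¬ Together G (Quotient.mk (togetherSetoid hG hD) x).out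
        (Quotient.mk (togetherSetoid hG hD) y).out := fun h =>
      hne ((hout x).symm.trans hG hD (h.trans hG hD (hout y)))
    exact ⟨(hout x).adj_of_adj (hout y) hne' hne,
      (hout x).symm.adj_of_adj (hout y).symm hne hne'⟩
  exists_third i j := by
    obtain ⟨a, rfl⟩ := Quotient.mk_surjective i
    obtain ⟨b, rfl⟩ := Quotient.mk_surjective j
    obtain ⟨z, hza, hzb⟩ := exists_not_together_and_not_together hG hD a b
    exact ⟨Quotient.mk _ z, fun h => hza (Quotient.exact h), fun h => hzb (Quotient.exact h)⟩

theorem Dominated.map (e : G ≃g H) (h : Dominated G) : Dominated H := by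
  obtain ⟨u, v, huv, hx⟩ := h
  refine ⟨e u, e v, ?_, fun x => ?_⟩
  · rwa [e.map_adj_iff, e.injective.eq_iff]
  · obtain ⟨x, rfl⟩ := e.surjective x
    rw [e.map_adj_iff, e.map_adj_iff, e.injective.eq_iff, e.injective.eq_iff]
    exact hx x

theorem Together.map (e : G ≃g H) (h : Together G a b) : Together H (e a) (e b) := by
  obtain ⟨M, hM, ha, hb, z, hz⟩ := h
  refine ⟨e '' M, ?_, Set.mem_image_of_mem e ha, Set.mem_image_of_mem e hb, e z, ?_⟩
  · rintro y hy _ ⟨a, ha, rfl⟩ _ ⟨b, hb, rfl⟩ hya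
    obtain ⟨x, rfl⟩ := e.surjective y
    rw [e.injective.mem_set_image] at hy
    rw [e.map_adj_iff] at hya ⊢
    exact hM x hy a ha b hb hya
  · rwa [e.injective.mem_set_image]

/-- If the graph is connected and has no dominating edge, then it has at most `w` maximal proper
modules; this bounds the size of each set of vertices of pairwise distinct ones. -/
def FewModules (G : SimpleGraph V) (w : ℕ) : Prop :=
  G.Connected → ¬ Dominated G → ∀ R : Finset V,
    (∀ x ∈ R, ∀ y ∈ R, Together G x y → x = y) → R.card ≤ w

theorem FewModules.of_iso (e : G ≃g H) {w : ℕ} (h : FewModules G w) : FewModules H w := by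
  intro hH hD R hR
  rw [← Finset.card_map e.symm.toEquiv.toEmbedding]
  refine h (e.connected_iff.2 hH) (mt (Dominated.map e) hD) _ fun x hx y hy hxy => ?_
  obtain ⟨a, ha, rfl⟩ := Finset.mem_map.1 hx
  obtain ⟨b, hb, rfl⟩ := Finset.mem_map.1 hy
  have hab : Together H (e (e.symm a)) (e (e.symm b)) := hxy.map e
  rw [e.apply_symm_apply, e.apply_symm_apply] at hab
  exact congrArg _ (hR a ha b hb hab)

theorem FewModules.mono {w w' : ℕ} (h : FewModules G w) (hw : w ≤ w') : FewModules G w' :=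
  fun hG hD R hR => (h hG hD R hR).trans hw

theorem dominated_joinGraph [hV : Nonempty V] [hW : Nonempty W] (G : SimpleGraph V)
    (H : SimpleGraph W) : Dominated (joinGraph G H) := by
  obtain ⟨v⟩ := hV
  obtain ⟨w⟩ := hW
  have hadj : ∀ v w, (joinGraph G H).Adj (Sum.inl v) (Sum.inr w) := fun v w => Or.inr (by simp)
  refine ⟨Sum.inl v, Sum.inr w, Or.inr (hadj v w), ?_⟩
  rintro (x | x)
  · exact Or.inr (Or.inr (hadj x w).symm)
  · exact Or.inl (Or.inr (hadj v x))

theorem not_connected_sum [hV : Nonempty V] [hW : Nonempty W] (G : SimpleGraph V)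
    (H : SimpleGraph W) : ¬ (SimpleGraph.sum G H).Connected := by
  obtain ⟨v⟩ := hV
  obtain ⟨w⟩ := hW
  intro h
  obtain ⟨p⟩ := h (Sum.inl v) (Sum.inr w)
  obtain ⟨d, -, ⟨x, hx⟩, ht⟩ := p.exists_boundary_dart (Set.range Sum.inl) ⟨v, rfl⟩ (by simp)
  have hadj := d.adj
  rw [← hx] at hadj
  cases hd : d.snd with
  | inl y => exact ht ⟨y, hd.symm⟩
  | inr y => simp [hd] at hadj

section substGraph

variable {ι : Type} (T : SimpleGraph ι) {V : ι → Type} (H : ∀ i, SimpleGraph (V i))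

theorem isModule_fibre (i : ι) : IsModule (substGraph T H) {x | x.1 = i} := by
  rintro x hx a rfl b hb (h | ⟨j, c, d, -, rfl, rfl⟩)
  · exact Or.inl (by rwa [show b.1 = a.1 from hb])
  · exact absurd rfl hx

theorem fewModules_substGraph [Fintype ι] [Nontrivial ι] [∀ i, Nonempty (V i)] :
    FewModules (substGraph T H) (Fintype.card ι) := by
  intro _ _ R hR
  refine Finset.card_le_card_of_injOn Sigma.fst (fun _ _ => Finset.mem_coe.2 (Finset.mem_univ _))
    fun x hx y hy hxy => hR x hx y hy ⟨_, isModule_fibre T H x.1, rfl, hxy.symm, ?_⟩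
  obtain ⟨j, hj⟩ := exists_ne x.1
  exact ⟨⟨j, Classical.arbitrary _⟩, hj⟩

/-- A substitution into a pattern with a single vertex does nothing. -/
def substGraphUniqueIso [Unique ι] : H default ≃g substGraph T H where
  toEquiv := (Equiv.uniqueSigma V).symm
  map_rel_iff' {a b} := by
    constructor
    · rintro (h | ⟨i, a', b', h, ha, hb⟩)
      · exact absurd h (T.loopless.irrefl _)
      · obtain rfl := Unique.default_eq i
        obtain rfl := eq_of_heq (Sigma.mk.inj ha).2
        obtain rfl := eq_of_heq (Sigma.mk.inj hb).2
        exact h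
    · exact fun h => Or.inr ⟨default, a, b, h, rfl, rfl⟩

end substGraph

theorem ModExpr.nonempty_carrier (A : ModExpr) : Nonempty A.Carrier := by
  induction A with
  | vertex => exact ⟨()⟩
  | union A B ihA _ => exact ihA.map Sum.inl
  | join A B ihA _ => exact ihA.map Sum.inl
  | subst r T A ih => exact (ih 0).map fun a => ⟨0, a⟩

theorem ModExpr.fewModules (A : ModExpr) : FewModules A.graph A.width := by
  have := ModExpr.nonempty_carrier
  induction A with
  | vertex => exact fun _ hD => absurd ⟨(), (), Or.inl rfl, fun _ => Or.inl (Or.inl rfl)⟩ hD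
  | union A B _ _ => exact fun hG => absurd hG (not_connected_sum A.graph B.graph)
  | join A B _ _ => exact fun _ hD => absurd (dominated_joinGraph A.graph B.graph) hD
  | subst r T A ih =>
    rcases r with _ | r
    · have : Unique (Fin (0 + 1)) := inferInstanceAs (Unique (Fin 1))
      refine (FewModules.of_iso (substGraphUniqueIso T _) (ih _)).mono ?_
      exact (Finset.le_sup (f := fun i => (A i).width) (Finset.mem_univ _)).trans
        (le_max_right _ _)
    · refine (fewModules_substGraph T _).mono ?_
      rw [Fintype.card_fin]
      exact le_max_left _ _

theorem fewModules_modularWidth {n : ℕ} {G : SimpleGraph (Fin n)} (hn : 0 < n) :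
    FewModules G (modularWidth G) := by
  obtain ⟨A, hA, ⟨e⟩⟩ := exists_modExpr hn G
  exact (FewModules.of_iso e A.fewModules).mono hA

end Modules

/-! ## The distance matrix -/

theorem Runs.forLt_forLt {W x y b N t : ℕ} {p : Prog} {s₀ : State} (I : ℕ → State → Prop)
    (hx : x ∉ (Prog.forLt y b p).writtenVars) (hy : y ∉ p.writtenVars)
    (hb : b ∉ (Prog.forLt x b (Prog.forLt y b p)).writtenVars)
    (hbN : s₀.var b = N) (hN : N ≤ W) (hW : 1 ≤ W)
    (hI : ∀ c s v, I c s → I c (s.setVar x v) ∧ I c (s.setVar y v)) (h0 : I 0 s₀)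
    (step : ∀ i j s, i < N → j < N → s.var x = i → s.var y = j →
      (Prog.forLt x b (Prog.forLt y b p)).Frame s₀ s → I (i * N + j) s →
      Runs W p s t (I (i * N + j + 1))) :
    Runs W (.forLt x b (.forLt y b p)) s₀ (N * (N * (t + 8) + 14) + 6) (I (N * N)) := by
  have hvars : (Prog.forLt y b p).writtenVars ⊆
      (Prog.forLt x b (Prog.forLt y b p)).writtenVars :=
    List.subset_append_of_subset_right [x] (List.subset_append_left _ _)
  have harrs : (Prog.forLt y b p).writtenArrs ⊆
      (Prog.forLt x b (Prog.forLt y b p)).writtenArrs :=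
    List.subset_append_of_subset_right [] (List.subset_append_left _ _)
  refine (Runs.forLt (t := N * (t + 8) + 6) (fun i s => I (i * N) s) hx hb hbN hN hW
    (hI _ _ _ ((zero_mul N).symm ▸ h0)).1 ?_).le_time (by simp only [Nat.add_assoc]; rfl)
  intro i s hi hxi hF hIs
  refine (Runs.forLt (fun j s' => I (i * N + j) s') hy (fun h => hb (hvars h))
    ((hF.var b hb).trans hbN) hN hW (hI _ _ _ hIs).2 fun j s₁ hj hyj hF₁ hI₁ => ?_).imp
    fun s' h => ?_
  · exact (step i j s₁ hi hj ((hF₁.var x hx).trans hxi) hyj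
      (hF.trans (hF₁.mono hvars harrs)) hI₁).imp fun s' h => (hI _ _ _ h).2
  · rw [Nat.succ_mul]
    exact (hI _ _ _ h).1

theorem index_inj {n i j i' j' : ℕ} (hj : j < n) (hj' : j' < n) :
    i * n + j = i' * n + j' ↔ i = i' ∧ j = j' := by
  refine ⟨fun h => ?_, by rintro ⟨rfl, rfl⟩; rfl⟩
  have hdiv : ∀ i j, j < n → (i * n + j) / n = i := fun i j hj => by
    rw [mul_comm, Nat.mul_add_div (by omega), Nat.div_eq_of_lt hj, add_zero]
  have hi : i = i' := by rw [← hdiv i j hj, h, hdiv i' j' hj']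
  subst hi
  exact ⟨rfl, Nat.add_left_cancel h⟩

theorem index_lt {n i j : ℕ} (hi : i < n) (hj : j < n) : i * n + j < n * n := by
  have := Nat.mul_le_mul_right n (Nat.succ_le_of_lt hi)
  rw [Nat.succ_mul] at this
  omega

namespace Reg

@[simp] abbrev order : ℕ := 0
@[simp] abbrev bound : ℕ := 1
@[simp] abbrev row : ℕ := 2
@[simp] abbrev col : ℕ := 3
@[simp] abbrev mid : ℕ := 4

end Reg

namespace Arr

@[simp] abbrev adj : ℕ := 0
@[simp] abbrev dist : ℕ := 1

end Arr

namespace Expr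

/-- The position of the entry in row `e` and column `f` of a matrix with `Reg.order` columns that
is stored row by row. -/
def index (e f : Expr) : Expr := .add (.mul e (.var Reg.order)) f

/-- The entry in row `e` and column `f` of the matrix stored in the array `a`. -/
def entry (a : ℕ) (e f : Expr) : Expr := .read a (.index e f)

variable {W n : ℕ} {e f : Expr} {s : State}

theorem eval_index (hn : s.var Reg.order = n) (e f : Expr) :
    (index e f).eval s = e.eval s * n + f.eval s := by
  rw [← hn]
  rfl

theorem eval_entry (hn : s.var Reg.order = n) (a : ℕ) (e f : Expr) :
    (entry a e f).eval s = s.arr a (e.eval s * n + f.eval s) := by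
  rw [← hn]
  rfl

theorem cost_index (e f : Expr) : (index e f).cost = e.cost + f.cost + 3 := by
  simp only [index, cost]
  omega

theorem cost_entry (a : ℕ) (e f : Expr) : (entry a e f).cost = e.cost + f.cost + 4 := by
  simp only [entry, cost, cost_index]

theorem fits_index (hn : s.var Reg.order = n) (hW : n * n ≤ W) (he : e.Fits W s)
    (hf : f.Fits W s) (hen : e.eval s < n) (hfn : f.eval s < n) : (index e f).Fits W s := by
  have hidx := index_lt hen hfn
  have hnn : n ≤ n * n := Nat.le_mul_self n
  refine ⟨⟨he, ?_, ?_⟩, hf, ?_⟩ <;> simp only [Fits, eval, hn] <;> omega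

theorem fits_entry {a : ℕ} (hn : s.var Reg.order = n) (hW : n * n ≤ W) (he : e.Fits W s)
    (hf : f.Fits W s) (hen : e.eval s < n) (hfn : f.eval s < n)
    (ha : s.arr a (e.eval s * n + f.eval s) ≤ W) : (entry a e f).Fits W s :=
  ⟨fits_index hn hW he hf hen hfn, (eval_index hn e f).symm ▸ ha⟩

theorem fits_index_var {x y : ℕ} (hn : s.var Reg.order = n) (hW : n * n ≤ W)
    (hx : s.var x < n) (hy : s.var y < n) : (index (.var x) (.var y)).Fits W s := by
  have hnn : n ≤ n * n := Nat.le_mul_self n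
  exact fits_index hn hW ((hx.le.trans hnn).trans hW) ((hy.le.trans hnn).trans hW) hx hy

theorem fits_entry_var {a x y : ℕ} (hn : s.var Reg.order = n) (hW : n * n ≤ W)
    (hx : s.var x < n) (hy : s.var y < n) (ha : s.arr a (s.var x * n + s.var y) ≤ W) :
    (entry a (.var x) (.var y)).Fits W s :=
  ⟨fits_index_var hn hW hx hy, (eval_index hn _ _).symm ▸ ha⟩

end Expr

section Distance

variable {n : ℕ} {G : SimpleGraph (Fin n)}

/-- The matrix `D` bounds the lengths of the paths all of whose inner vertices are less than
`k`. -/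
def PathBound (G : SimpleGraph (Fin n)) (k : ℕ) (D : ℕ → ℕ) : Prop :=
  ∀ (i j : Fin n) (p : G.Walk i j), p.IsPath → (∀ x ∈ p.support, x ≠ i → x ≠ j → x.val < k) →
    D (i * n + j) ≤ p.length

theorem PathBound.zero {D : ℕ → ℕ} (h₀ : ∀ i : Fin n, D (i * n + i) = 0)
    (h₁ : ∀ i j, G.Adj i j → D (i * n + j) ≤ 1) : PathBound G 0 D := by
  intro i j p hp hx
  cases p with
  | nil => exact (h₀ i).le
  | @cons _ v _ hadj q =>
    cases q with
    | nil => exact h₁ _ _ hadj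
    | @cons _ w _ hadj' q =>
      rw [SimpleGraph.Walk.cons_isPath_iff, SimpleGraph.Walk.cons_isPath_iff] at hp
      have hvj : v ≠ j := by
        rintro rfl
        exact hp.1.2 q.end_mem_support
      have hv : v ∈ (SimpleGraph.Walk.cons hadj (.cons hadj' q)).support :=
        List.mem_cons_of_mem _ List.mem_cons_self
      exact absurd (hx v hv hadj.ne.symm hvj) (Nat.not_lt_zero _)

theorem PathBound.succ {D D' : ℕ → ℕ} (k : Fin n) (h : PathBound G k D)
    (hle : ∀ i j : Fin n, D' (i * n + j) ≤ D (i * n + j))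
    (hk : ∀ i j : Fin n, D' (i * n + j) ≤ D (i * n + k) + D (k * n + j)) :
    PathBound G (k + 1) D' := by
  intro i j p hp hx
  have hx' : ∀ x ∈ p.support, x ≠ i → x ≠ j → x ≠ k → x.val < k := fun x hxp hxi hxj hxk =>
    (Nat.lt_succ_iff_lt_or_eq.1 (hx x hxp hxi hxj)).resolve_right (Fin.val_ne_of_ne hxk)
  by_cases hkp : k ∈ p.support ∧ k ≠ i ∧ k ≠ j
  · obtain ⟨hkp, hki, hkj⟩ := hkp
    have hlen : (p.takeUntil k hkp).length + (p.dropUntil k hkp).length = p.length := by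
      rw [← SimpleGraph.Walk.length_append, p.take_spec hkp]
    refine (hk i j).trans (hlen ▸ Nat.add_le_add (h i k _ (hp.takeUntil hkp) ?_)
      (h k j _ (hp.dropUntil hkp) ?_))
    · intro x hxp hxi hxk
      refine hx' x (p.support_takeUntil_subset_support hkp hxp) hxi ?_ hxk
      rintro rfl
      exact SimpleGraph.Walk.endpoint_notMem_support_takeUntil hp hkp hkj.symm hxp
    · intro x hxp hxk hxj
      refine hx' x (p.support_dropUntil_subset_support hkp hxp) ?_ hxj hxk
      rintro rfl
      have hnodup := hp.support_nodup
      rw [← p.take_spec hkp, SimpleGraph.Walk.support_append, List.nodup_append] at hnodup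
      rw [← SimpleGraph.Walk.cons_tail_support, List.mem_cons] at hxp
      exact hnodup.2.2 _ (SimpleGraph.Walk.start_mem_support _) _
        (hxp.resolve_left hki.symm) rfl
  · refine (hle i j).trans (h i j p hp fun x hxp hxi hxj => hx' x hxp hxi hxj ?_)
    rintro rfl
    exact hkp ⟨hxp, hxi, hxj⟩

theorem PathBound.le_dist (hG : G.Connected) {D : ℕ → ℕ} (h : PathBound G n D) (i j : Fin n) :
    D (i * n + j) ≤ G.dist i j := by
  obtain ⟨p, hp, hlen⟩ := hG.exists_path_of_dist i j
  exact hlen ▸ h i j p hp fun x _ _ _ => x.2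

/-- The matrix in an array is between the distance matrix and `n`. -/
def DistBound (G : SimpleGraph (Fin n)) (D : ℕ → ℕ) : Prop :=
  ∀ i j : Fin n, G.dist i j ≤ D (i * n + j) ∧ D (i * n + j) ≤ n

theorem dist_lt (hG : G.Connected) (i j : Fin n) : G.dist i j < n := by
  obtain ⟨p, hp, hlen⟩ := hG.exists_path_of_dist i j
  simpa only [← hlen, Fintype.card_fin] using hp.length_lt

open Classical in
/-- The entries of the distance matrix before the first round of the algorithm. -/
noncomputable def initialDist (G : SimpleGraph (Fin n)) (i j : Fin n) : ℕ :=
  if i = j then 0 else if G.Adj i j then 1 else n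

theorem initialDist_le (G : SimpleGraph (Fin n)) (i j : Fin n) : initialDist G i j ≤ n := by
  have := i.pos
  unfold initialDist
  split_ifs <;> omega

theorem distBound_of_eq_initialDist (hG : G.Connected) {D : ℕ → ℕ}
    (hD : ∀ i j : Fin n, D (i * n + j) = initialDist G i j) : DistBound G D := by
  intro i j
  refine ⟨?_, (hD i j).trans_le (initialDist_le G i j)⟩
  rw [hD, initialDist]
  split_ifs with hij hadj
  · rw [hij, SimpleGraph.dist_self]
  · exact (SimpleGraph.dist_eq_one_iff_adj.2 hadj).le
  · exact (dist_lt hG i j).le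

theorem pathBound_of_eq_initialDist {D : ℕ → ℕ}
    (hD : ∀ i j : Fin n, D (i * n + j) = initialDist G i j) : PathBound G 0 D := by
  refine .zero (fun i => ?_) fun i j hij => ?_
  · rw [hD, initialDist, if_pos rfl]
  · rw [hD, initialDist, if_neg hij.ne, if_pos hij]

/-- The array `Arr.adj` holds the adjacency matrix of `G` and the variable `Reg.order` the number
of vertices. -/
structure HasInput (G : SimpleGraph (Fin n)) (s : State) : Prop where
  order : s.var Reg.order = n
  adj : ∀ i j : Fin n, IsTruthValue (s.arr Arr.adj (i * n + j)) (G.Adj i j)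

theorem HasInput.of_frame {s s' : State} {p : Prog} (h : HasInput G s) (hF : p.Frame s s')
    (hp : Reg.order ∉ p.writtenVars) (hp' : Arr.adj ∉ p.writtenArrs) : HasInput G s' :=
  ⟨(hF.var _ hp).trans h.order, fun i j => (hF.arr _ hp').symm ▸ h.adj i j⟩

/-- The expression for `initialDist`, branch-free. -/
def initialDistExpr : Expr :=
  .mul (.sub (.const 1) (.eq (.var Reg.row) (.var Reg.col)))
    (.add (.entry Arr.adj (.var Reg.row) (.var Reg.col))
      (.mul (.sub (.const 1) (.entry Arr.adj (.var Reg.row) (.var Reg.col))) (.var Reg.order)))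

theorem HasInput.eval_initialDistExpr {s : State} (h : HasInput G s) {i j : Fin n}
    (hi : s.var Reg.row = i) (hj : s.var Reg.col = j) :
    initialDistExpr.eval s = initialDist G i j := by
  simp only [initialDistExpr, Expr.eval, Expr.eval_entry h.order, h.order, hi, hj, initialDist,
    ← Fin.ext_iff]
  by_cases hij : i = j
  · simp only [hij, if_true, Nat.sub_self, zero_mul]
  by_cases hadj : G.Adj i j
  · simp [hij, hadj, (h.adj i j).eq_one hadj]
  · simp [hij, hadj, (h.adj i j).eq_zero hadj]

theorem HasInput.fits_initialDistExpr {W : ℕ} (hW : n * n + n + 1 ≤ W) {s : State}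
    (h : HasInput G s) {i j : Fin n} (hi : s.var Reg.row = i) (hj : s.var Reg.col = j) :
    initialDistExpr.Fits W s := by
  have hadj := (h.adj i j).1
  have horder := h.order
  have hentry : (Expr.entry Arr.adj (.var Reg.row) (.var Reg.col)).Fits W s := by
    refine Expr.fits_entry_var h.order (by omega) (hi ▸ i.2) (hj ▸ j.2) ?_
    rw [hi, hj]
    omega
  have hmul : (1 - s.arr Arr.adj (i * n + j)) * n ≤ n :=
    (Nat.mul_le_mul_right n (Nat.sub_le 1 _)).trans_eq (one_mul n)
  have hval : initialDistExpr.eval s ≤ W := by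
    rw [h.eval_initialDistExpr hi hj]
    exact (initialDist_le G i j).trans (by omega)
  have hW1 : 1 ≤ W := by omega
  have hrow : s.var Reg.row ≤ W := by omega
  have hcol : s.var Reg.col ≤ W := by omega
  refine ⟨⟨hW1, hrow, hcol, hW1⟩,
    ⟨hentry, ⟨⟨hW1, hentry⟩, (by omega : s.var Reg.order ≤ W), ?_⟩, ?_⟩, hval⟩ <;>
  · simp only [Expr.eval, Expr.eval_entry h.order, h.order, hi, hj]
    omega

/-- The program that puts the matrix `initialDist` into the array `Arr.dist`. -/
def distInitProg : Prog :=
  .forLt Reg.row Reg.order (.forLt Reg.col Reg.order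
    (.write Arr.dist (.index (.var Reg.row) (.var Reg.col)) initialDistExpr))

theorem runs_distInitProg {W : ℕ} (hW : n * n + n + 1 ≤ W) {s : State} (hs : HasInput G s) :
    Runs W distInitProg s (n * (n * 40 + 14) + 6)
      (fun s' => ∀ i j : Fin n, s'.arr Arr.dist (i * n + j) = initialDist G i j) := by
  refine (Runs.forLt_forLt (t := 32) (fun c s' => ∀ i j : Fin n, i.val * n + j < c →
    s'.arr Arr.dist (i * n + j) = initialDist G i j) (by decide) (by decide) (by decide)
    hs.order (by omega) (by omega) (fun _ _ _ h => ⟨h, h⟩)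
    (fun i j h => absurd h (Nat.not_lt_zero _)) ?_).imp
    fun s' h i j => h i j (index_lt i.2 j.2)
  intro i j s₁ hi hj hxi hyj hF hI
  lift i to Fin n using hi
  lift j to Fin n using hj
  have hs₁ : HasInput G s₁ := hs.of_frame hF (by decide) (by decide)
  refine (Runs.write (Expr.fits_index_var hs₁.order (by omega) (hxi ▸ i.2) (hyj ▸ j.2))
    (hs₁.fits_initialDistExpr hW hxi hyj) fun i' j' hlt => ?_).le_time (by decide)
  rw [State.setCell_arr, Expr.eval_index hs₁.order, hs₁.eval_initialDistExpr hxi hyj]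
  simp only [Expr.eval, hxi, hyj, true_and, index_inj j'.2 j.2, ← Fin.ext_iff]
  split_ifs with heq
  · rw [heq.1, heq.2]
  · refine hI i' j' ((Nat.lt_succ_iff_lt_or_eq.1 hlt).resolve_right ?_)
    rwa [index_inj j'.2 j.2, ← Fin.ext_iff, ← Fin.ext_iff]

/-- The state of a round of the algorithm of Floyd and Warshall that started with the matrix `D`,
admits `k` as a new inner vertex, and has treated the first `c` entries. The round works in place:
an entry may be compared with entries that the same round has already changed. -/
structure Relaxed (G : SimpleGraph (Fin n)) (k : Fin n) (D : ℕ → ℕ) (c : ℕ) (D' : ℕ → ℕ) :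
    Prop where
  distBound : DistBound G D'
  le : ∀ i j : Fin n, D' (i * n + j) ≤ D (i * n + j)
  le_add : ∀ i j : Fin n, i.val * n + j < c → D' (i * n + j) ≤ D (i * n + k) + D (k * n + j)

theorem Relaxed.succ (hG : G.Connected) {k : Fin n} {D D₁ D₂ : ℕ → ℕ} {i j : Fin n}
    (h : Relaxed G k D (i * n + j) D₁)
    (hD₂ : ∀ i' j' : Fin n, D₂ (i' * n + j') = if i' = i ∧ j' = j
      then min (D₁ (i * n + j)) (D₁ (i * n + k) + D₁ (k * n + j)) else D₁ (i' * n + j')) :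
    Relaxed G k D (i * n + j + 1) D₂ := by
  have hle : ∀ i' j' : Fin n, D₂ (i' * n + j') ≤ D₁ (i' * n + j') := fun i' j' => by
    rw [hD₂]
    split_ifs with heq
    · exact heq.1 ▸ heq.2 ▸ min_le_left _ _
    · exact le_rfl
  refine ⟨fun i' j' => ⟨?_, (hle i' j').trans (h.distBound i' j').2⟩,
    fun i' j' => (hle i' j').trans (h.le i' j'), fun i' j' hlt => ?_⟩
  · rw [hD₂]
    split_ifs with heq
    · obtain ⟨rfl, rfl⟩ := heq
      exact le_min (h.distBound i' j').1 (hG.dist_triangle.trans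
        (Nat.add_le_add (h.distBound i' k).1 (h.distBound k j').1))
    · exact (h.distBound i' j').1
  · by_cases heq : i' = i ∧ j' = j
    · rw [hD₂, if_pos heq]
      obtain ⟨rfl, rfl⟩ := heq
      exact (min_le_right _ _).trans (Nat.add_le_add (h.le i' k) (h.le k j'))
    · refine (hle i' j').trans (h.le_add i' j' ?_)
      refine (Nat.lt_succ_iff_lt_or_eq.1 hlt).resolve_right ?_
      rwa [index_inj j'.2 j.2, ← Fin.ext_iff, ← Fin.ext_iff]

/-- The minimum of the current entry and the detour through `Reg.mid`: with truncated
subtraction, `min x y = x - (x - y)`. -/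
def relaxExpr : Expr :=
  .sub (.entry Arr.dist (.var Reg.row) (.var Reg.col))
    (.sub (.entry Arr.dist (.var Reg.row) (.var Reg.col))
      (.add (.entry Arr.dist (.var Reg.row) (.var Reg.mid))
        (.entry Arr.dist (.var Reg.mid) (.var Reg.col))))

theorem eval_relaxExpr {s : State} {i j k : Fin n} (hn : s.var Reg.order = n)
    (hi : s.var Reg.row = i) (hj : s.var Reg.col = j) (hk : s.var Reg.mid = k) :
    relaxExpr.eval s = min (s.arr Arr.dist (i * n + j))
      (s.arr Arr.dist (i * n + k) + s.arr Arr.dist (k * n + j)) := by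
  simp only [relaxExpr, Expr.eval, Expr.eval_entry hn, hi, hj, hk]
  omega

theorem DistBound.fits_relaxExpr {W : ℕ} (hW : n * n + 2 * n + 1 ≤ W) {s : State}
    (hD : DistBound G (s.arr Arr.dist)) {i j k : Fin n} (hn : s.var Reg.order = n)
    (hi : s.var Reg.row = i) (hj : s.var Reg.col = j) (hk : s.var Reg.mid = k) :
    relaxExpr.Fits W s := by
  have hentry : ∀ {x y : ℕ} {i j : Fin n}, s.var x = i → s.var y = j →
      (Expr.entry Arr.dist (.var x) (.var y)).Fits W s := fun {x y i j} hx hy => by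
    refine Expr.fits_entry_var hn (by omega) (hx ▸ i.2) (hy ▸ j.2) ?_
    rw [hx, hy]
    exact (hD i j).2.trans (by omega)
  refine ⟨hentry hi hj, hentry hi hj, hentry hi hk, hentry hk hj, ?_⟩
  simp only [Expr.eval_entry hn, Expr.eval, hi, hj, hk]
  have hik := (hD i k).2
  have hkj := (hD k j).2
  omega

/-- One round of the algorithm of Floyd and Warshall. -/
def distRoundProg : Prog :=
  .forLt Reg.row Reg.order (.forLt Reg.col Reg.order
    (.write Arr.dist (.index (.var Reg.row) (.var Reg.col)) relaxExpr))

theorem runs_distRoundProg (hG : G.Connected) {W : ℕ} (hW : n * n + 2 * n + 1 ≤ W) {s : State}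
    (hn : s.var Reg.order = n) (k : Fin n) (hk : s.var Reg.mid = k)
    (hD : DistBound G (s.arr Arr.dist)) (hP : PathBound G k (s.arr Arr.dist)) :
    Runs W distRoundProg s (n * (n * 48 + 14) + 6)
      (fun s' => DistBound G (s'.arr Arr.dist) ∧ PathBound G (k + 1) (s'.arr Arr.dist)) := by
  refine (Runs.forLt_forLt (t := 40) (fun c s' => Relaxed G k (s.arr Arr.dist) c (s'.arr Arr.dist))
    (by decide) (by decide) (by decide) hn (by omega) (by omega) (fun _ _ _ h => ⟨h, h⟩)
    ⟨hD, fun _ _ => le_rfl, fun i j h => absurd h (Nat.not_lt_zero _)⟩ ?_).imp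
    fun s' h => ⟨h.distBound, hP.succ k h.le fun i j => h.le_add i j (index_lt i.2 j.2)⟩
  intro i j s₁ hi hj hxi hyj hF hI
  lift i to Fin n using hi
  lift j to Fin n using hj
  have hn₁ : s₁.var Reg.order = n := (hF.var _ (by decide)).trans hn
  have hk₁ : s₁.var Reg.mid = k := (hF.var _ (by decide)).trans hk
  refine (Runs.write (Expr.fits_index_var hn₁ (by omega) (hxi ▸ i.2) (hyj ▸ j.2))
    (hI.distBound.fits_relaxExpr hW hn₁ hxi hyj hk₁) (hI.succ hG fun i' j' => ?_)).le_time
    (by decide)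
  rw [State.setCell_arr, Expr.eval_index hn₁, eval_relaxExpr hn₁ hxi hyj hk₁]
  simp only [Expr.eval, hxi, hyj, true_and, index_inj j'.2 j.2, ← Fin.ext_iff]

/-- The program that computes the distance matrix (Floyd and Warshall) in `Arr.dist`. -/
def distProg : Prog :=
  .seq distInitProg (.forLt Reg.mid Reg.order distRoundProg)

theorem runs_distProg (hG : G.Connected) {W : ℕ} (hW : n * n + 2 * n + 1 ≤ W) {s : State}
    (hs : HasInput G s) :
    Runs W distProg s (200 * n ^ 3)
      (fun s' => ∀ i j : Fin n, s'.arr Arr.dist (i * n + j) = G.dist i j) := by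
  have hn : 0 < n := Fin.pos_iff_nonempty.2 hG.nonempty
  refine ((runs_distInitProg (by omega) hs).frame.seq
    (t₂ := n * ((n * (n * 48 + 14) + 6) + 8) + 6) fun s₁ ⟨hF, hD⟩ => ?_).le_time (by nlinarith)
  have hn₁ : s₁.var Reg.order = n := (hF.var _ (by decide)).trans hs.order
  refine (Runs.forLt
    (fun i s' => DistBound G (s'.arr Arr.dist) ∧ PathBound G i (s'.arr Arr.dist))
    (by decide) (by decide) hn₁ (by omega) (by omega)
    ⟨distBound_of_eq_initialDist hG hD, pathBound_of_eq_initialDist hD⟩ ?_).imp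
    fun s₂ ⟨hD₂, hP₂⟩ i j => le_antisymm (hP₂.le_dist hG i j) (hD₂ i j).1
  rintro i s₂ hi hmid hF₂ ⟨hD₂, hP₂⟩
  exact runs_distRoundProg hG hW ((hF₂.var _ (by decide)).trans hn₁) ⟨i, hi⟩ hmid hD₂ hP₂

end Distance

/-! ## Lists of vertices in memory -/

namespace Reg

@[simp] abbrev queueSize : ℕ := 9

end Reg

namespace Arr

@[simp] abbrev mark : ℕ := 2
@[simp] abbrev queue : ℕ := 3

end Arr

/-- The first entries of the array `a` are the entries of the list `L`, whose length is the value
of the variable `x`. -/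
structure Stores {n : ℕ} (L : List (Fin n)) (a x : ℕ) (s : State) : Prop where
  length : s.var x = L.length
  get : ∀ j (hj : j < L.length), s.arr a j = L[j]

/-- Append the value of `e` to the list in the array `a` with length in the variable `x`. -/
def Prog.push (a x : ℕ) (e : Expr) : Prog :=
  .seq (.write a (.var x) e) (.assign x (.add (.var x) (.const 1)))

/-- Append the vertex in the variable `x` to the queue and mark it. -/
def enqueueProg (x : ℕ) : Prog :=
  .seq (.write Arr.mark (.var x) (.const 1)) (.push Arr.queue Reg.queueSize (.var x))

/-- The queue contains the list `L`, and a vertex is marked if and only if it is in `L`. -/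
structure Queued {n : ℕ} (L : List (Fin n)) (s : State) : Prop where
  stores : Stores L Arr.queue Reg.queueSize s
  mark : ∀ y : Fin n, IsTruthValue (s.arr Arr.mark y) (y ∈ L)

section Lists

variable {n : ℕ} {L : List (Fin n)} {a x W : ℕ} {s s' : State}

theorem Stores.congr (h : Stores L a x s) (hx : s'.var x = s.var x) (ha : s'.arr a = s.arr a) :
    Stores L a x s' :=
  ⟨hx.trans h.length, fun j hj => ha ▸ h.get j hj⟩

theorem Stores.of_frame {p : Prog} (h : Stores L a x s) (hF : p.Frame s s')
    (hx : x ∉ p.writtenVars) (ha : a ∉ p.writtenArrs) : Stores L a x s' :=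
  h.congr (hF.var x hx) (hF.arr a ha)

theorem Stores.nil (h : s.var x = 0) : Stores ([] : List (Fin n)) a x s :=
  ⟨h, fun _ hj => absurd hj (Nat.not_lt_zero _)⟩

theorem Stores.runs_push {y : ℕ} {v : Fin n} (h : Stores L a x s) (hy : s.var y = v)
    (hn : n ≤ W) (hL : L.length < W) :
    Runs W (.push a x (.var y)) s 7 (Stores (L ++ [v]) a x) := by
  have hx := h.length
  have hv := v.2
  refine Runs.seq (t₁ := 3) (t₂ := 4) (R := (· = s.setCell a L.length v))
    (Runs.write (i := .var x) (e := .var y) (hx.trans_le hL.le) (hy.trans_le (hv.le.trans hn))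
      (by simp only [Expr.eval, hx, hy])) ?_
  rintro _ rfl
  refine Runs.assign (e := .add (.var x) (.const 1)) ?_ ⟨?_, fun j hj => ?_⟩
  · simp only [Expr.Fits, Expr.eval, State.setCell_var, hx]
    omega
  · simp only [Expr.eval, State.setCell_var, State.setVar_var, if_true, hx, List.length_append,
      List.length_singleton]
  · rw [List.length_append, List.length_singleton, Nat.lt_succ_iff_lt_or_eq] at hj
    simp only [State.setVar_arr, State.setCell_arr, true_and]
    rcases hj with hj | rfl
    · rw [if_neg hj.ne, h.get j hj, List.getElem_append_left hj]
    · rw [if_pos rfl, List.getElem_concat_length rfl]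

theorem Queued.setVar (h : Queued L s) (hx : x ≠ Reg.queueSize) (v : ℕ) :
    Queued L (s.setVar x v) :=
  ⟨h.stores.congr (by rw [State.setVar_var, if_neg hx.symm]) rfl, h.mark⟩

theorem Queued.runs_enqueueProg {v : Fin n} (h : Queued L s) (hx : s.var x = v) (hn : n ≤ W)
    (hL : L.length < W) : Runs W (enqueueProg x) s 10 (Queued (L ++ [v])) := by
  have hv := v.2
  refine Runs.seq (t₁ := 3) (t₂ := 7) (R := (· = s.setCell Arr.mark v 1))
    (Runs.write (i := .var x) (e := .const 1) (hx.trans_le (hv.le.trans hn))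
      (Nat.one_le_of_lt hL) (by simp only [Expr.eval, hx])) ?_
  rintro _ rfl
  have hs : Stores L Arr.queue Reg.queueSize (s.setCell Arr.mark v 1) :=
    h.stores.congr rfl (funext fun j => by simp)
  refine (hs.runs_push hx hn hL).frame.imp fun s₂ ⟨hF, hs₂⟩ => ⟨hs₂, fun y => ?_⟩
  rw [hF.arr _ (by simp [Prog.push, Prog.writtenArrs]), State.setCell_arr, List.mem_append,
    List.mem_singleton]
  by_cases hy : y = v
  · subst hy
    simpa using IsTruthValue.one trivial
  · simpa [hy, ← Fin.ext_iff] using h.mark y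

end Lists

/-! ## The least module that contains two vertices -/

namespace Reg

@[simp] abbrev left : ℕ := 5
@[simp] abbrev right : ℕ := 6
@[simp] abbrev head : ℕ := 7
@[simp] abbrev scan : ℕ := 8

end Reg

section Closure

variable {n : ℕ} {G : SimpleGraph (Fin n)}

/-- The state of the computation of the least module that contains `r` and `v`: the list `L` of
the vertices found so far, after the comparison of the first `c` pairs of a vertex of `L` and a
vertex of `G`. A vertex outside `L` that distinguishes a vertex of `L` from `r` has to be added. -/
structure ClosureInv (G : SimpleGraph (Fin n)) (r v : Fin n) (c : ℕ) (L : List (Fin n)) :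
    Prop where
  left_mem : r ∈ L
  right_mem : v ∈ L
  nodup : L.Nodup
  least : ∀ N, IsModule G N → r ∈ N → v ∈ N → ∀ x ∈ L, x ∈ N
  adj_iff : ∀ j (_ : j < L.length) (y : Fin n), j * n + y < c → y ∉ L →
    (G.Adj L[j] y ↔ G.Adj r y)

namespace ClosureInv

variable {r v y : Fin n} {c h : ℕ} {L : List (Fin n)}

theorem start (hrv : r ≠ v) : ClosureInv G r v 0 [r, v] where
  left_mem := List.mem_cons_self
  right_mem := List.mem_cons_of_mem _ List.mem_cons_self
  nodup := List.nodup_cons.2 ⟨by simpa using hrv, List.nodup_singleton v⟩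
  least N _ hr hv x hx := by
    rcases List.mem_pair.1 hx with rfl | rfl
    exacts [hr, hv]
  adj_iff _ _ _ hc := absurd hc (Nat.not_lt_zero _)

theorem length_le (H : ClosureInv G r v c L) : L.length ≤ n := by
  simpa only [Fintype.card_fin] using H.nodup.length_le_card

theorem keep (H : ClosureInv G r v (h * n + y) L)
    (hy : ∀ hh : h < L.length, y ∉ L → (G.Adj L[h] y ↔ G.Adj r y)) :
    ClosureInv G r v (h * n + y + 1) L := by
  refine ⟨H.left_mem, H.right_mem, H.nodup, H.least, fun j hj z hc hz => ?_⟩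
  rcases Nat.lt_succ_iff_lt_or_eq.1 hc with hc | hc
  · exact H.adj_iff j hj z hc hz
  · obtain ⟨rfl, hzy⟩ := (index_inj z.2 y.2).1 hc
    obtain rfl := Fin.ext hzy
    exact hy hj hz

theorem extend (H : ClosureInv G r v (h * n + y) L) (hh : h < L.length) (hyL : y ∉ L)
    (hy : ¬ (G.Adj L[h] y ↔ G.Adj r y)) : ClosureInv G r v (h * n + y + 1) (L ++ [y]) where
  left_mem := List.mem_append_left _ H.left_mem
  right_mem := List.mem_append_left _ H.right_mem
  nodup := by
    rw [← List.concat_eq_append]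
    exact H.nodup.concat hyL
  least N hN hr hv x hx := by
    have hL := H.least N hN hr hv
    rcases List.mem_append.1 hx with hx | hx
    · exact hL x hx
    obtain rfl := List.mem_singleton.1 hx
    by_contra hxN
    have hhN := hL _ (List.getElem_mem hh)
    exact hy ⟨fun h' => (hN x hxN _ hhN r hr h'.symm).symm,
      fun h' => (hN x hxN r hr _ hhN h'.symm).symm⟩
  adj_iff j hj z hc hz := by
    rw [List.mem_append, List.mem_singleton, not_or] at hz
    have hc' : j * n + z < h * n + y := by
      refine (Nat.lt_succ_iff_lt_or_eq.1 hc).resolve_right fun heq => hz.2 ?_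
      exact Fin.ext ((index_inj z.2 y.2).1 heq).2
    have hjL : j < L.length := by
      have := y.2
      by_contra hj
      have : (h + 1) * n ≤ j * n := Nat.mul_le_mul_right n (by omega)
      rw [Nat.succ_mul] at this
      omega
    rw [List.getElem_append_left hjL]
    exact H.adj_iff j hjL z hc' hz.1

theorem isModule (H : ClosureInv G r v (n * n) L) : IsModule G {x | x ∈ L} := by
  have hr : ∀ a ∈ L, ∀ x ∉ L, (G.Adj a x ↔ G.Adj r x) := fun a ha x hx => by
    obtain ⟨j, hj, rfl⟩ := List.getElem_of_mem ha
    exact H.adj_iff j hj x (index_lt (hj.trans_le H.length_le) x.2) hx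
  intro x hx a ha b hb hxa
  exact ((hr b hb x hx).2 ((hr a ha x hx).1 hxa.symm)).symm

theorem length_lt_iff (H : ClosureInv G r v (n * n) L) : L.length < n ↔ Together G r v := by
  have hcard : L.toFinset.card = L.length := List.toFinset_card_of_nodup H.nodup
  constructor
  · intro hlt
    refine ⟨{x | x ∈ L}, H.isModule, H.left_mem, H.right_mem, ?_⟩
    obtain ⟨z, hz⟩ := Finset.exists_mem_notMem_of_card_lt_card
      (s := L.toFinset) (t := Finset.univ) (by rwa [hcard, Finset.card_fin])
    exact ⟨z, fun h => hz.2 (List.mem_toFinset.2 h)⟩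
  · rintro ⟨N, hN, hr, hv, z, hz⟩
    have hzL : z ∉ L.toFinset := fun h => hz (H.least N hN hr hv z (List.mem_toFinset.1 h))
    simpa only [hcard, Fintype.card_fin] using Finset.card_lt_univ_of_notMem hzL

end ClosureInv

/-- The vertex in `Reg.scan` is unmarked and distinguishes the vertices at `Reg.head` in the queue
and in `Reg.left`. -/
def splitExpr : Expr :=
  .mul (.eq (.read Arr.mark (.var Reg.scan)) (.const 0))
    (.sub (.const 1) (.eq (.entry Arr.adj (.read Arr.queue (.var Reg.head)) (.var Reg.scan))
      (.entry Arr.adj (.var Reg.left) (.var Reg.scan))))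

theorem HasInput.isTruthValue_splitExpr {s : State} (hs : HasInput G s) {L : List (Fin n)}
    (hL : Queued L s) {r y : Fin n} {h : ℕ} (hr : s.var Reg.left = r) (hh : s.var Reg.head = h)
    (hy : s.var Reg.scan = y) (hhL : h < L.length) :
    IsTruthValue (splitExpr.eval s) (y ∉ L ∧ ¬ (G.Adj L[h] y ↔ G.Adj r y)) := by
  simp only [splitExpr, Expr.eval, Expr.eval_entry hs.order, hr, hh, hy, hL.stores.get h hhL]
  exact (IsTruthValue.ite.congr (hL.mark y).eq_zero_iff).and
    (IsTruthValue.ite.congr ((hs.adj _ y).eq_iff (hs.adj r y))).not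

theorem HasInput.fits_splitExpr {W : ℕ} (hW : n * n + 1 ≤ W) {s : State} (hs : HasInput G s)
    {L : List (Fin n)} (hL : Queued L s) {r y : Fin n} {h : ℕ} (hr : s.var Reg.left = r)
    (hh : s.var Reg.head = h) (hy : s.var Reg.scan = y) (hhL : h < L.length) (hhn : h ≤ W) :
    splitExpr.Fits W s := by
  have hnn : n ≤ n * n := Nat.le_mul_self n
  have hadj : ∀ i j : Fin n, s.arr Arr.adj (i * n + j) ≤ W := fun i j =>
    (hs.adj i j).1.trans (by omega)
  have hLh := hL.stores.get h hhL
  have hyW : s.var Reg.scan ≤ W := by have := y.2; omega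
  have hW1 : 1 ≤ W := by omega
  refine ⟨⟨⟨hyW, ?_⟩, Nat.zero_le W, hW1⟩, ⟨hW1, ?_, ?_, hW1⟩,
    (hs.isTruthValue_splitExpr hL hr hh hy hhL).1.trans hW1⟩
  · rw [Expr.eval, hy]
    exact (hL.mark y).1.trans hW1
  · refine Expr.fits_entry hs.order (by omega) ⟨hh.trans_le hhn, ?_⟩ hyW ?_ (hy.trans_lt y.2) ?_ <;>
      simp only [Expr.eval, hh, hLh, hy]
    · have := L[h].2
      omega
    · exact L[h].2
    · exact hadj _ y
  · refine Expr.fits_entry_var hs.order (by omega) (hr ▸ r.2) (hy ▸ y.2) ?_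
    rw [hr, hy]
    exact hadj r y

/-- Add the vertex in `Reg.scan` to the queue if `splitExpr` holds. -/
def closureStepProg : Prog :=
  .ite (.lt (.var Reg.head) (.var Reg.queueSize))
    (.ite splitExpr (enqueueProg Reg.scan) .skip) .skip

theorem runs_closureStepProg {W : ℕ} (hW : n * n + n + 2 ≤ W) {s : State} (hs : HasInput G s)
    {r v y : Fin n} {h : ℕ} (hhn : h < n) (hr : s.var Reg.left = r) (hh : s.var Reg.head = h)
    (hy : s.var Reg.scan = y) {L : List (Fin n)} (hL : Queued L s)
    (H : ClosureInv G r v (h * n + y) L) :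
    Runs W closureStepProg s 36
      (fun s' => ∃ L', Queued L' s' ∧ ClosureInv G r v (h * n + y + 1) L') := by
  have hlen := H.length_le
  have hsize := hL.stores.length
  have hcond : Expr.eval s (.lt (.var Reg.head) (.var Reg.queueSize)) ≠ 0 ↔ h < L.length := by
    rw [Expr.eval_lt_ne_zero_iff, Expr.eval, Expr.eval, hh, hsize]
  refine (Runs.ite (e := .lt (.var Reg.head) (.var Reg.queueSize)) (t := 32) ⟨?_, ?_, ?_⟩
    (fun hlt => ?_) fun hge => ?_).le_time le_rfl
  · simp only [Expr.Fits]; omega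
  · simp only [Expr.Fits]; omega
  · omega
  · have hhL := hcond.1 hlt
    have hsplit := hs.isTruthValue_splitExpr hL hr hh hy hhL
    refine (Runs.ite (t := 10) (hs.fits_splitExpr (by omega) hL hr hh hy hhL (by omega))
      (fun hne => ?_) fun heq => ?_).le_time (by decide)
    · obtain ⟨hyL, hadj⟩ := hsplit.2.1 hne
      exact (hL.runs_enqueueProg hy (by omega) (by omega)).imp fun s' hL' =>
        ⟨_, hL', H.extend hhL hyL hadj⟩
    · refine (Runs.skip ⟨L, hL, H.keep fun _ hyL => ?_⟩).le_time (by omega)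
      by_contra hadj
      exact hsplit.2.2 ⟨hyL, hadj⟩ heq
  · refine (Runs.skip ⟨L, hL, H.keep fun hhL => ?_⟩).le_time (by omega)
    exact absurd hge (hcond.2 hhL)

/-- Empty the queue. -/
def clearQueueProg : Prog :=
  .seq (.forLt Reg.scan Reg.order (.write Arr.mark (.var Reg.scan) (.const 0)))
    (.assign Reg.queueSize (.const 0))

theorem runs_clearQueueProg {W : ℕ} (hW : n < W) {s : State} (hn : s.var Reg.order = n) :
    Runs W clearQueueProg s (n * 11 + 8) (Queued ([] : List (Fin n))) := by
  refine Runs.seq (t₁ := n * 11 + 6) (t₂ := 2) (R := fun s' => ∀ y < n, s'.arr Arr.mark y = 0)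
    (Runs.forLt (t := 3) (fun x s' => ∀ y < x, s'.arr Arr.mark y = 0) (by decide) (by decide) hn
      (by omega) (by omega) (fun y hy => absurd hy (Nat.not_lt_zero y)) ?_) ?_
  · intro x s₁ hx hscan _ hmark
    refine Runs.write (i := .var Reg.scan) (e := .const 0) ?_ (Nat.zero_le W) fun y hy => ?_
    · simp only [Expr.Fits]; omega
    · simp only [State.setVar_arr, State.setCell_arr, Expr.eval, hscan, true_and]
      split_ifs with hyx
      · rfl
      · exact hmark y (by omega)
  · intro s₁ hmark
    refine Runs.assign (e := .const 0) (Nat.zero_le W) ⟨.nil ?_, fun y => ?_⟩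
    · simp only [State.setVar_var, if_true, Expr.eval]
    · rw [State.setVar_arr, hmark y y.2]
      exact .zero List.not_mem_nil

/-- The program that computes the least module that contains the vertices in `Reg.left` and
`Reg.right`; its size ends up in `Reg.queueSize`. -/
def closureProg : Prog :=
  .seq clearQueueProg (.seq (enqueueProg Reg.left) (.seq (enqueueProg Reg.right)
    (.forLt Reg.head Reg.order (.forLt Reg.scan Reg.order closureStepProg))))

theorem runs_closureProg {W : ℕ} (hW : n * n + n + 2 ≤ W) {s : State} (hs : HasInput G s)
    {r v : Fin n} (hrv : r ≠ v) (hr : s.var Reg.left = r) (hv : s.var Reg.right = v) :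
    Runs W closureProg s (100 * n ^ 2)
      (fun s' => s'.var Reg.queueSize ≤ n ∧ (s'.var Reg.queueSize < n ↔ Together G r v)) := by
  have hn : 2 ≤ n := by
    have := r.2
    have := v.2
    have := Fin.val_ne_of_ne hrv
    omega
  refine ((runs_clearQueueProg (by omega) hs.order).frame.seq
    (t₂ := 10 + (10 + (n * (n * 44 + 14) + 6))) fun s₁ ⟨hF₁, hL₁⟩ => ?_).le_time (by nlinarith)
  refine ((hL₁.runs_enqueueProg ((hF₁.var _ (by decide)).trans hr) (by omega)
    (by simp only [List.length_nil]; omega)).frame).seq fun s₂ ⟨hF₂, hL₂⟩ => ?_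
  refine ((hL₂.runs_enqueueProg (((hF₂.var _ (by decide)).trans (hF₁.var _ (by decide))).trans hv)
    (by omega) (by simp only [List.length_append, List.length_singleton, List.length_nil]; omega)
    ).frame).seq fun s₃ ⟨hF₃, hL₃⟩ => ?_
  have hs₃ : HasInput G s₃ := ((hs.of_frame hF₁ (by decide) (by decide)).of_frame hF₂ (by decide)
    (by decide)).of_frame hF₃ (by decide) (by decide)
  have hr₃ : s₃.var Reg.left = r := by
    rw [hF₃.var _ (by decide), hF₂.var _ (by decide), hF₁.var _ (by decide), hr]
  refine (Runs.forLt_forLt (t := 36) (fun c s' => ∃ L, Queued L s' ∧ ClosureInv G r v c L)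
    (by decide) (by decide) (by decide) hs₃.order (by omega) (by omega) ?_
    ⟨[r, v], hL₃, .start hrv⟩ ?_).imp ?_
  · rintro c s' x ⟨L, hL, H⟩
    exact ⟨⟨L, hL.setVar (by decide) x, H⟩, ⟨L, hL.setVar (by decide) x, H⟩⟩
  · rintro h y s₄ hh hy hhead hscan hF ⟨L, hL, H⟩
    lift y to Fin n using hy
    exact runs_closureStepProg hW (hs₃.of_frame hF (by decide) (by decide)) hh
      ((hF.var _ (by decide)).trans hr₃) hhead hscan hL H
  · rintro s₄ ⟨L, hL, H⟩
    rw [hL.stores.length]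
    exact ⟨H.length_le, H.length_lt_iff⟩

end Closure

/-! ## Representatives of the maximal modules -/

namespace Reg

@[simp] abbrev covered : ℕ := 11
@[simp] abbrev repIdx : ℕ := 12
@[simp] abbrev repCount : ℕ := 13

end Reg

namespace Arr

@[simp] abbrev reps : ℕ := 4

end Arr

section Representatives

variable {n : ℕ} {G : SimpleGraph (Fin n)}

/-- The list `L` contains exactly one vertex of each class of `Together G` that contains a vertex
less than `m`. -/
structure Represents (G : SimpleGraph (Fin n)) (m : ℕ) (L : List (Fin n)) : Prop where
  lt : ∀ x ∈ L, x.val < m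
  pairwise : L.Pairwise fun x y => ¬ Together G x y
  cover : ∀ u : Fin n, u.val < m → ∃ x ∈ L, Together G x u

namespace Represents

variable {m : ℕ} {L : List (Fin n)}

theorem nodup (hD : ¬ Dominated G) (H : Represents G m L) : L.Nodup :=
  H.pairwise.imp fun {x y} h (hxy : x = y) => h (hxy ▸ .refl hD x)

theorem length_le (hD : ¬ Dominated G) (H : Represents G m L) : L.length ≤ n := by
  simpa only [Fintype.card_fin] using (H.nodup hD).length_le_card

theorem length_le_modularWidth (hG : G.Connected) (hD : ¬ Dominated G) (H : Represents G m L) :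
    L.length ≤ modularWidth G := by
  rw [← List.toFinset_card_of_nodup (H.nodup hD)]
  refine fewModules_modularWidth (Fin.pos_iff_nonempty.2 hG.nonempty) hG hD _
    fun x hx y hy hxy => ?_
  have : Std.Symm fun x y => ¬ Together G x y := ⟨fun _ _ h h' => h h'.symm⟩
  by_contra hne
  exact H.pairwise.forall (List.mem_toFinset.1 hx) (List.mem_toFinset.1 hy)
    hne hxy

theorem keep {v : Fin n} (H : Represents G v L) (hv : ∃ x ∈ L, Together G x v) :
    Represents G (v + 1) L := by
  refine ⟨fun x hx => (H.lt x hx).trans (Nat.lt_succ_self _), H.pairwise, fun u hu => ?_⟩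
  rcases Nat.lt_succ_iff_lt_or_eq.1 hu with hu | hu
  · exact H.cover u hu
  · exact Fin.ext hu ▸ hv

theorem extend (hD : ¬ Dominated G) {v : Fin n} (H : Represents G v L)
    (hv : ¬ ∃ x ∈ L, Together G x v) : Represents G (v + 1) (L ++ [v]) := by
  refine ⟨fun x hx => ?_, ?_, fun u hu => ?_⟩
  · rcases List.mem_append.1 hx with hx | hx
    · exact (H.lt x hx).trans (Nat.lt_succ_self _)
    · exact List.mem_singleton.1 hx ▸ Nat.lt_succ_self _
  · refine List.pairwise_append.2 ⟨H.pairwise, List.pairwise_singleton _ _, fun x hx y hy hxy => ?_⟩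
    exact hv ⟨x, hx, List.mem_singleton.1 hy ▸ hxy⟩
  · rcases Nat.lt_succ_iff_lt_or_eq.1 hu with hu | hu
    · obtain ⟨x, hx, hxu⟩ := H.cover u hu
      exact ⟨x, List.mem_append_left _ hx, hxu⟩
    · exact ⟨v, List.mem_append_right _ (List.mem_singleton_self v), Fin.ext hu ▸ .refl hD u⟩

end Represents

/-- Set `Reg.covered` if the vertex in `Reg.right` and the representative number `Reg.repIdx` are
in a common module that is not the whole graph. -/
def coveredStepProg : Prog :=
  .seq (.assign Reg.left (.read Arr.reps (.var Reg.repIdx)))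
    (.seq closureProg
      (.ite (.lt (.var Reg.queueSize) (.var Reg.order)) (.assign Reg.covered (.const 1)) .skip))

theorem runs_coveredStepProg {W : ℕ} (hW : n * n + n + 2 ≤ W) {s : State} (hs : HasInput G s)
    {x v : Fin n} (hxv : x ≠ v) {i : ℕ} (hi : s.var Reg.repIdx = i) (hin : i ≤ n)
    (hx : s.arr Arr.reps i = x) (hv : s.var Reg.right = v) {p : Prop}
    (hp : IsTruthValue (s.var Reg.covered) p) :
    Runs W coveredStepProg s (100 * n ^ 2 + 9)
      (fun s' => IsTruthValue (s'.var Reg.covered) (p ∨ Together G x v)) := by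
  have := x.2
  refine (Runs.seq (t₁ := 3) (t₂ := 100 * n ^ 2 + 6) (R := (· = s.setVar Reg.left x))
    (Runs.assign (e := .read Arr.reps (.var Reg.repIdx)) ?_ ?_) ?_).le_time (by omega)
  · simp only [Expr.Fits, Expr.eval, hi, hx]
    omega
  · simp only [Expr.eval, hi, hx]
  rintro _ rfl
  have hs₁ : HasInput G (s.setVar Reg.left x) := ⟨hs.order, hs.adj⟩
  refine (runs_closureProg hW hs₁ hxv rfl hv).frame.seq fun s₂ ⟨hF, _, hiff⟩ => ?_
  have hn₂ : s₂.var Reg.order = n := (hF.var _ (by decide)).trans hs.order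
  have hp₂ : IsTruthValue (s₂.var Reg.covered) p := by
    rw [hF.var _ (by decide)]
    exact hp
  have hcond : Expr.eval s₂ (.lt (.var Reg.queueSize) (.var Reg.order)) ≠ 0 ↔ Together G x v := by
    rw [Expr.eval_lt_ne_zero_iff, Expr.eval, Expr.eval, hn₂, hiff]
  refine (Runs.ite (e := .lt (.var Reg.queueSize) (.var Reg.order)) (t := 2) ?_ (fun h => ?_)
    fun h => ?_).le_time le_rfl
  · simp only [Expr.Fits, hn₂]
    omega
  · refine Runs.assign (e := .const 1) (by simp only [Expr.Fits]; omega) ?_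
    simpa only [State.setVar_var, if_true, Expr.eval] using .one (.inr (hcond.1 h))
  · refine (Runs.skip (hp₂.congr ?_)).le_time one_le_two
    rw [or_iff_left fun hT => hcond.2 hT h]

/-- Set `Reg.covered` to the truth value of the statement that the vertex in `Reg.right` is
together with one of the representatives. -/
def coveredProg : Prog :=
  .seq (.assign Reg.covered (.const 0)) (.forLt Reg.repIdx Reg.repCount coveredStepProg)

theorem runs_coveredProg {W : ℕ} (hW : n * n + n + 2 ≤ W) (hD : ¬ Dominated G) {s : State}
    (hs : HasInput G s) {v : Fin n} (hv : s.var Reg.right = v) {L : List (Fin n)}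
    (hL : Stores L Arr.reps Reg.repCount s) (H : Represents G v L) :
    Runs W coveredProg s (L.length * (100 * n ^ 2 + 17) + 8)
      (fun s' => IsTruthValue (s'.var Reg.covered) (∃ x ∈ L, Together G x v)) := by
  have hlen := H.length_le hD
  refine (Runs.seq (t₁ := 2) (t₂ := L.length * (100 * n ^ 2 + 17) + 6)
    (R := (· = s.setVar Reg.covered 0)) (Runs.assign (e := .const 0) (Nat.zero_le W) rfl)
    ?_).le_time (by omega)
  rintro _ rfl
  have hL₁ : Stores L Arr.reps Reg.repCount (s.setVar Reg.covered 0) := hL.congr rfl rfl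
  refine (Runs.forLt (t := 100 * n ^ 2 + 9)
    (fun i s' => IsTruthValue (s'.var Reg.covered) (∃ x ∈ L.take i, Together G x v))
    (by decide) (by decide) hL₁.length (by omega) (by omega) ?_ ?_).imp
    fun s' h => by simpa only [List.take_length] using h
  · simpa using IsTruthValue.zero not_false
  · intro i s₁ hi hidx hF hI
    have hs₁ : HasInput G s₁ := HasInput.of_frame (s := s.setVar Reg.covered 0)
      ⟨hs.order, hs.adj⟩ hF (by decide) (by decide)
    have hxi : s₁.arr Arr.reps i = L[i] := by
      rw [hF.arr _ (by decide)]
      exact hL.get i hi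
    have hne : L[i] ≠ v := fun h => (h ▸ H.lt _ (List.getElem_mem hi)).false
    refine (runs_coveredStepProg hW hs₁ hne hidx (by omega) hxi
      ((hF.var _ (by decide)).trans hv) hI).imp fun s₂ h => ?_
    refine IsTruthValue.congr (by simpa using h) ?_
    simp only [List.take_succ_eq_append_getElem hi, List.mem_append, List.mem_singleton,
      or_and_right, exists_or, exists_eq_left]

/-- Append the vertex in `Reg.right` to the list of representatives if it is not together with one
of them. -/
def repsStepProg : Prog :=
  .seq coveredProg
    (.ite (.var Reg.covered) .skip (.push Arr.reps Reg.repCount (.var Reg.right)))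

theorem runs_repsStepProg {W : ℕ} (hW : n * n + n + 2 ≤ W) (hG : G.Connected)
    (hD : ¬ Dominated G) {s : State} (hs : HasInput G s) {v : Fin n}
    (hv : s.var Reg.right = v) {L : List (Fin n)} (hL : Stores L Arr.reps Reg.repCount s)
    (H : Represents G v L) :
    Runs W repsStepProg s (modularWidth G * (100 * n ^ 2 + 17) + 17)
      (fun s' => ∃ L', Stores L' Arr.reps Reg.repCount s' ∧ Represents G (v + 1) L') := by
  have hlen := H.length_le hD
  have htime := Nat.mul_le_mul_right (100 * n ^ 2 + 17) (H.length_le_modularWidth hG hD)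
  refine ((runs_coveredProg hW hD hs hv hL H).frame.seq (t₂ := 9) fun s₁ ⟨hF, hcov⟩ => ?_).le_time
    (by omega)
  have hL₁ : Stores L Arr.reps Reg.repCount s₁ := hL.of_frame hF (by decide) (by decide)
  have hv₁ : s₁.var Reg.right = v := (hF.var _ (by decide)).trans hv
  refine Runs.ite (e := .var Reg.covered) (t := 7) (hcov.1.trans (by omega)) (fun h => ?_)
    fun h => ?_
  · exact (Runs.skip ⟨L, hL₁, H.keep (hcov.2.1 h)⟩).le_time (by omega)
  · exact (hL₁.runs_push hv₁ (by omega) (by omega)).imp fun s₂ hL₂ =>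
      ⟨_, hL₂, H.extend hD (hcov.eq_zero_iff.1 h)⟩

/-- The program that lists representatives of the classes of `Together` in `Arr.reps`. -/
def repsProg : Prog :=
  .seq (.assign Reg.repCount (.const 0)) (.forLt Reg.right Reg.order repsStepProg)

theorem runs_repsProg {W : ℕ} (hW : n * n + n + 2 ≤ W) (hG : G.Connected)
    (hD : ¬ Dominated G) {s : State} (hs : HasInput G s) :
    Runs W repsProg s (200 * (2 ^ modularWidth G * n ^ 3))
      (fun s' => ∃ L, Stores L Arr.reps Reg.repCount s' ∧ Represents G n L) := by
  refine (Runs.seq (t₁ := 2)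
    (t₂ := n * ((modularWidth G * (100 * n ^ 2 + 17) + 17) + 8) + 6)
    (R := (· = s.setVar Reg.repCount 0)) (Runs.assign (e := .const 0) (Nat.zero_le W) rfl)
    ?_).le_time ?_
  · rintro _ rfl
    refine Runs.forLt
      (fun m s' => ∃ L, Stores L Arr.reps Reg.repCount s' ∧ Represents G m L) (by decide)
      (by decide) hs.order (by omega) (by omega) ?_ ?_
    · exact ⟨[], .nil rfl, fun _ h => absurd h List.not_mem_nil, List.Pairwise.nil,
        fun u hu => absurd hu (Nat.not_lt_zero _)⟩
    · rintro m s₁ hm hright hF ⟨L, hL, H⟩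
      lift m to Fin n using hm
      have hs₁ : HasInput G s₁ := HasInput.of_frame (s := s.setVar Reg.repCount 0)
        ⟨hs.order, hs.adj⟩ hF (by decide) (by decide)
      exact (runs_repsStepProg hW hG hD hs₁ hright hL H).imp fun s₂ ⟨L', hL', H'⟩ =>
        ⟨L', hL'.congr rfl rfl, H'⟩
  · have hn : 0 < n := Fin.pos_iff_nonempty.2 hG.nonempty
    have hpow : 1 ≤ 2 ^ modularWidth G := Nat.one_le_two_pow
    have hw : modularWidth G ≤ 2 ^ modularWidth G := Nat.lt_two_pow_self.le
    have hnn : n ≤ n ^ 3 := Nat.le_self_pow three_ne_zero n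
    have hwn₃ := Nat.mul_le_mul_right (n ^ 3) hw
    have hwn := Nat.mul_le_mul hw hnn
    have hn₃ := Nat.mul_le_mul hpow (le_refl (n ^ 3))
    nlinarith

end Representatives

/-! ## Vertex sets of shortest paths -/

section Geodesic

variable {V : Type} {G : SimpleGraph V} {S : Set V} {u : V} {k : ℕ}

/-- The distances from the vertex `u` map the set `S` isometrically onto an initial segment of `ℕ`.
Such sets are the vertex sets of the shortest paths from `u`. For `x = u` the truncated subtraction
makes the last condition void. -/
structure IsGeodesicFrom (G : SimpleGraph V) (u : V) (S : Set V) : Prop where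
  mem : u ∈ S
  isometry : ∀ x ∈ S, ∀ y ∈ S, G.dist x y = Nat.dist (G.dist u x) (G.dist u y)
  exists_pred : ∀ x ∈ S, ∃ z ∈ S, G.dist u z = G.dist u x - 1

namespace IsGeodesicFrom

theorem exists_dist_eq (h : IsGeodesicFrom G u S) {x : V} (hx : x ∈ S) {l : ℕ}
    (hl : l ≤ G.dist u x) : ∃ z ∈ S, G.dist u z = l := by
  induction hl using Nat.decreasingInduction with
  | self => exact ⟨x, hx, rfl⟩
  | of_succ l _ ih =>
    obtain ⟨z, hz, hzl⟩ := ih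
    obtain ⟨y, hy, hyz⟩ := h.exists_pred z hz
    exact ⟨y, hy, by rw [hyz, hzl, Nat.add_sub_cancel]⟩

theorem exists_isShortestPath [Finite V] (hG : G.Connected) (h : IsGeodesicFrom G u S) :
    ∃ P, IsShortestPath G P ∧ ∀ x ∈ S, x ∈ P := by
  obtain ⟨w, hw, hmax⟩ := S.toFinite.exists_maximalFor (G.dist u) S ⟨u, h.mem⟩
  have := hG.nonempty
  choose! g hgS hg using fun l (hl : l ≤ G.dist u w) => h.exists_dist_eq hw hl
  refine ⟨(List.range (G.dist u w + 1)).map g, isShortestPath_iff.2 ⟨?_, fun i j hij hj => ?_⟩,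
    fun x hx => ?_⟩
  · simp only [ne_eq, List.map_eq_nil_iff, List.range_eq_nil, Nat.add_one_ne_zero,
      not_false_eq_true]
  · simp only [List.length_map, List.length_range] at hj
    simp only [List.getElem_map, List.getElem_range]
    rw [h.isometry _ (hgS i (by omega)) _ (hgS j (by omega)), hg i (by omega), hg j (by omega),
      Nat.dist_eq_sub_of_le hij]
  · have hxw : G.dist u x ≤ G.dist u w := (le_total _ _).elim id (hmax hx)
    refine List.mem_map.2
      ⟨G.dist u x, List.mem_range.2 (Nat.lt_succ_of_le hxw), hG.dist_eq_zero_iff.1 ?_⟩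
    rw [h.isometry _ (hgS _ hxw) _ hx, hg _ hxw, Nat.dist_self]

end IsGeodesicFrom

theorem IsShortestPath.isGeodesicFrom {P : List V} (hP : IsShortestPath G P) :
    IsGeodesicFrom G (P.head hP.ne_nil) {x | x ∈ P} := by
  have hdist : ∀ (i : ℕ) (hi : i < P.length), G.dist (P.head hP.ne_nil) P[i] = i := by
    intro i hi
    rw [List.head_eq_getElem, hP.dist_getElem (by omega) hi]
    omega
  refine ⟨List.head_mem _, fun x hx y hy => ?_, fun x hx => ?_⟩
  · obtain ⟨i, hi, rfl⟩ := List.mem_iff_getElem.1 hx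
    obtain ⟨j, hj, rfl⟩ := List.mem_iff_getElem.1 hy
    rw [hdist, hdist, hP.dist_getElem hi hj, Nat.dist, Nat.add_comm]
  · obtain ⟨i, hi, rfl⟩ := List.mem_iff_getElem.1 hx
    exact ⟨P[i - 1], List.getElem_mem (by omega), by rw [hdist, hdist]⟩

/-- The set `S` is the vertex set of a shortest path of eccentricity at most `k`. -/
def IsSolution (G : SimpleGraph V) (k : ℕ) (S : Set V) : Prop :=
  (∃ u, IsGeodesicFrom G u S) ∧ ∀ v, ∃ x ∈ S, G.dist x v ≤ k

theorem IsSolution.yesInstance [Finite V] (hG : G.Connected) (h : IsSolution G k S) :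
    YesInstance G k := by
  obtain ⟨⟨u, hu⟩, hcover⟩ := h
  obtain ⟨P, hP, hSP⟩ := hu.exists_isShortestPath hG
  refine ⟨P, hP, (pathEcc_le_iff hG k).2 fun v => ?_⟩
  obtain ⟨x, hx, hxv⟩ := hcover v
  exact ⟨x, hSP x hx, by rwa [SimpleGraph.dist_comm]⟩

theorem IsShortestPath.isSolution {P : List V} (hG : G.Connected) (hP : IsShortestPath G P)
    (hk : pathEcc G P ≤ k) : IsSolution G k {x | x ∈ P} := by
  refine ⟨⟨_, hP.isGeodesicFrom⟩, fun v => ?_⟩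
  obtain ⟨x, hx, hxv⟩ := (pathEcc_le_iff hG k).1 hk v
  exact ⟨x, hx, by rwa [SimpleGraph.dist_comm]⟩

end Geodesic

section Selections

variable {n : ℕ} {G : SimpleGraph (Fin n)} {L : List (Fin n)} {k : ℕ}

theorem Represents.yesInstance_iff (hG : G.Connected) (hD : ¬ Dominated G)
    (H : Represents G n L) : YesInstance G k ↔ ∃ S ⊆ {x | x ∈ L}, IsSolution G k S := by
  refine ⟨fun hk => ?_, fun ⟨S, _, hS⟩ => hS.yesInstance hG⟩
  have hrep : ∀ q : Quotient (togetherSetoid hG hD), ∃ x ∈ L, Quotient.mk _ x = q := by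
    refine Quotient.ind fun u => ?_
    obtain ⟨x, hx, hxu⟩ := H.cover u u.2
    exact ⟨x, hx, Quotient.sound hxu⟩
  choose r hrL hr using hrep
  obtain ⟨π, -, -, hP, hecc⟩ := ((isSubst_togetherSetoid hG hD).yesInstance_iff hr k).1 hk
  refine ⟨_, fun x hx => ?_, hP.isSolution hG hecc⟩
  obtain ⟨q, -, rfl⟩ := List.mem_map.1 hx
  exact hrL q

/-- The entries of `L` at the positions of the binary digits 1 of `c`. -/
def selection (L : List (Fin n)) (c : ℕ) : Set (Fin n) :=
  {x | ∃ i : Fin L.length, c.testBit i ∧ L[i] = x}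

theorem exists_eq_selection {S : Set (Fin n)} (hS : S ⊆ {x | x ∈ L}) :
    ∃ c < 2 ^ L.length, S = selection L c := by
  classical
  let β : Fin L.length → Bool := fun i => L[i] ∈ S
  refine ⟨Nat.ofBits β, Nat.ofBits_lt_two_pow _, Set.ext fun x => ?_⟩
  have hβ : ∀ i : Fin L.length, (Nat.ofBits β).testBit i ↔ L[i] ∈ S := fun i => by
    rw [Nat.testBit_ofBits_lt β i i.2]
    exact decide_eq_true_iff
  constructor
  · intro hx
    obtain ⟨i, hi, rfl⟩ := List.mem_iff_getElem.1 (hS hx)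
    exact ⟨⟨i, hi⟩, (hβ _).2 hx, rfl⟩
  · rintro ⟨i, hi, rfl⟩
    exact (hβ i).1 hi

theorem selection_subset (L : List (Fin n)) (c : ℕ) : selection L c ⊆ {x | x ∈ L} := by
  rintro _ ⟨i, -, rfl⟩
  exact List.getElem_mem _

theorem Represents.yesInstance_iff_selection (hG : G.Connected) (hD : ¬ Dominated G)
    (H : Represents G n L) :
    YesInstance G k ↔ ∃ c < 2 ^ L.length, IsSolution G k (selection L c) := by
  refine (H.yesInstance_iff hG hD).trans ⟨?_, ?_⟩
  · rintro ⟨S, hSL, hS⟩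
    obtain ⟨c, hc, rfl⟩ := exists_eq_selection hSL
    exact ⟨c, hc, hS⟩
  · rintro ⟨c, -, hS⟩
    exact ⟨_, selection_subset L c, hS⟩

end Selections

/-! ## Formulas about distances -/

section DistanceFormulas

variable {n : ℕ} {G : SimpleGraph (Fin n)}

theorem dist_lt_two_iff {V : Type} {G : SimpleGraph V} (hG : G.Connected) {u v : V} :
    G.dist u v < 2 ↔ u = v ∨ G.Adj u v := by
  rw [← hG.dist_eq_zero_iff, ← SimpleGraph.dist_eq_one_iff_adj]
  omega

theorem yesInstance_zero_iff (hG : G.Connected) :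
    YesInstance G 0 ↔ ∃ u v, G.dist u v + 1 = n := by
  have hzero (P : List (Fin n)) : pathEcc G P ≤ (0 : ℕ) ↔ ∀ u, u ∈ P := by
    simp only [pathEcc_le_iff hG, Nat.le_zero, hG.dist_eq_zero_iff, exists_eq_right']
  constructor
  · rintro ⟨P, ⟨u, v, p, hp, rfl⟩, hecc⟩
    have hham := (p.isPath_of_length_eq_dist hp).isHamiltonian_of_mem ((hzero _).1 hecc)
    refine ⟨u, v, ?_⟩
    rw [← hp, ← p.length_support, hham.length_support, Fintype.card_fin]
  · rintro ⟨u, v, huv⟩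
    obtain ⟨p, hp, hlen⟩ := hG.exists_path_of_dist u v
    refine ⟨p.support, ⟨u, v, p, hlen, rfl⟩, (hzero _).2 fun w => ?_⟩
    have hcard : p.support.toFinset.card = Fintype.card (Fin n) := by
      rw [List.toFinset_card_of_nodup hp.support_nodup, p.length_support, hlen, huv,
        Fintype.card_fin]
    rw [← List.mem_toFinset, (Finset.card_eq_iff_eq_univ _).1 hcard]
    exact Finset.mem_univ w

theorem Dominated.yesInstance {V : Type} {G : SimpleGraph V} (hG : G.Connected)
    (h : Dominated G) {k : ℕ} (hk : 1 ≤ k) : YesInstance G k := by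
  obtain ⟨u, v, huv, h⟩ := h
  have hle {a x : V} (hax : a = x ∨ G.Adj a x) : G.dist x a ≤ k := by
    have := (dist_lt_two_iff hG).2 hax
    rw [SimpleGraph.dist_comm]
    omega
  have hpath : ∃ P, IsShortestPath G P ∧ u ∈ P ∧ v ∈ P := by
    rcases huv with rfl | huv
    · exact ⟨[u], isShortestPath_singleton u, List.mem_singleton_self u, List.mem_singleton_self u⟩
    · exact ⟨[u, v], isShortestPath_pair huv, List.mem_cons_self,
        List.mem_cons_of_mem u (List.mem_singleton_self v)⟩
  obtain ⟨P, hP, hu, hv⟩ := hpath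
  refine ⟨P, hP, (pathEcc_le_iff hG k).2 fun x => ?_⟩
  rcases h x with hux | hvx
  · exact ⟨u, hu, hle hux⟩
  · exact ⟨v, hv, hle hvx⟩

/-- The distance of the vertices in the variables `x` and `y`. -/
def vertexDistExpr (x y : ℕ) : Expr := .entry Arr.dist (.var x) (.var y)

/-- The vertices in the variables `x` and `y` are equal or adjacent. -/
def closeExpr (x y : ℕ) : Expr := .lt (vertexDistExpr x y) (.const 2)

/-- Some shortest path contains all vertices. -/
def spanningFormula : Formula :=
  .ex 20 Reg.order (.ex 21 Reg.order
    (.atom (.eq (.add (vertexDistExpr 20 21) (.const 1)) (.var Reg.order))))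

/-- The formula for `Dominated`. -/
def dominatedFormula : Formula :=
  .ex 20 Reg.order (.ex 21 Reg.order (.and (.atom (closeExpr 20 21))
    (.all 22 Reg.order (.atom (.add (closeExpr 20 22) (closeExpr 21 22))))))

theorem wf_spanningFormula : spanningFormula.WF 30 20 := by
  simp [spanningFormula, Formula.WF, vertexDistExpr, Expr.entry, Expr.index, Expr.VarsLt]

theorem wf_dominatedFormula : dominatedFormula.WF 30 20 := by
  simp [dominatedFormula, Formula.all, Formula.WF, closeExpr, vertexDistExpr, Expr.entry,
    Expr.index, Expr.VarsLt]

theorem cost_spanningFormula (hn : 0 < n) : spanningFormula.cost n ≤ 100 * n ^ 3 := by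
  have h₁ : n ≤ n ^ 3 := Nat.le_self_pow three_ne_zero n
  have h₂ : n ^ 2 ≤ n ^ 3 := Nat.pow_le_pow_right hn (by decide)
  have : 1 ≤ n ^ 3 := Nat.one_le_pow _ _ hn
  simp only [spanningFormula, Formula.cost, vertexDistExpr, Expr.cost_entry, Expr.cost]
  nlinarith

theorem cost_dominatedFormula (hn : 0 < n) : dominatedFormula.cost n ≤ 200 * n ^ 3 := by
  have h₁ : n ≤ n ^ 3 := Nat.le_self_pow three_ne_zero n
  have h₂ : n ^ 2 ≤ n ^ 3 := Nat.pow_le_pow_right hn (by decide)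
  have : 1 ≤ n ^ 3 := Nat.one_le_pow _ _ hn
  simp only [dominatedFormula, Formula.all, Formula.cost, closeExpr, vertexDistExpr,
    Expr.cost_entry, Expr.cost]
  nlinarith

/-- The variable `Reg.order` holds the number of vertices and the array `Arr.dist` the distance
matrix of `G`. -/
structure HasDist (G : SimpleGraph (Fin n)) (s : State) : Prop where
  order : s.var Reg.order = n
  dist : ∀ i j : Fin n, s.arr Arr.dist (i * n + j) = G.dist i j

namespace HasDist

variable {s s' : State} {x y W : ℕ} {φ : Formula} {i j : Fin n}

theorem congr (h : HasDist G s) (hx : s'.var Reg.order = s.var Reg.order)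
    (ha : s'.arr Arr.dist = s.arr Arr.dist) : HasDist G s' :=
  ⟨hx.trans h.order, ha ▸ h.dist⟩

theorem setVar (h : HasDist G s) (hx : 0 < x) (v : ℕ) : HasDist G (s.setVar x v) :=
  h.congr (by rw [State.setVar_var, if_neg hx.ne]) rfl

theorem holds_ex (h : HasDist G s) :
    (Formula.ex x Reg.order φ).Holds s ↔ ∃ v : Fin n, φ.Holds (s.setVar x v) := by
  simp only [Formula.Holds, h.order, Fin.exists_iff, exists_prop]

theorem holds_all (h : HasDist G s) :
    (Formula.all x Reg.order φ).Holds s ↔ ∀ v : Fin n, φ.Holds (s.setVar x v) := by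
  rw [Formula.holds_all, h.order, Fin.forall_iff]

theorem fits_ex (h : HasDist G s) (hφ : ∀ v : Fin n, φ.Fits W n (s.setVar x v)) :
    (Formula.ex x Reg.order φ).Fits W n s :=
  ⟨h.order.le, fun i hi => hφ ⟨i, h.order ▸ hi⟩⟩

theorem fits_all (h : HasDist G s) (hφ : ∀ v : Fin n, φ.Fits W n (s.setVar x v)) :
    (Formula.all x Reg.order φ).Fits W n s :=
  fits_ex (φ := .neg φ) h hφ

theorem eval_vertexDistExpr (h : HasDist G s) (hx : s.var x = i) (hy : s.var y = j) :
    (vertexDistExpr x y).eval s = G.dist i j := by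
  rw [vertexDistExpr, Expr.eval_entry h.order, Expr.eval, Expr.eval, hx, hy, h.dist]

theorem fits_vertexDistExpr (h : HasDist G s) (hG : G.Connected) (hW : n * n ≤ W)
    (hx : s.var x = i) (hy : s.var y = j) : (vertexDistExpr x y).Fits W s := by
  have hnn : n ≤ n * n := Nat.le_mul_self n
  have hdist := dist_lt hG i j
  refine Expr.fits_entry_var h.order hW (hx ▸ i.2) (hy ▸ j.2) ?_
  rw [hx, hy, h.dist]
  omega

theorem isTruthValue_closeExpr (h : HasDist G s) (hG : G.Connected) (hx : s.var x = i)
    (hy : s.var y = j) : IsTruthValue ((closeExpr x y).eval s) (i = j ∨ G.Adj i j) := by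
  rw [closeExpr, Expr.eval, h.eval_vertexDistExpr hx hy]
  exact IsTruthValue.ite.congr (dist_lt_two_iff hG)

theorem fits_closeExpr (h : HasDist G s) (hG : G.Connected) (hW : n * n + 2 ≤ W)
    (hx : s.var x = i) (hy : s.var y = j) : (closeExpr x y).Fits W s :=
  ⟨h.fits_vertexDistExpr hG (by omega) hx hy, by simp only [Expr.Fits]; omega, by omega⟩

theorem holds_spanningFormula (h : HasDist G s) :
    spanningFormula.Holds s ↔ ∃ u v, G.dist u v + 1 = n := by
  rw [spanningFormula, h.holds_ex]
  refine exists_congr fun u => ?_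
  have h₁ := h.setVar (x := 20) (by decide) u
  rw [h₁.holds_ex]
  refine exists_congr fun v => ?_
  have h₂ := h₁.setVar (x := 21) (by decide) v
  rw [Formula.Holds, Expr.eval_eq_ne_zero_iff, Expr.eval, Expr.eval, Expr.eval, h₂.order,
    h₂.eval_vertexDistExpr (i := u) (j := v) rfl rfl]

theorem fits_spanningFormula (h : HasDist G s) (hG : G.Connected) (hW : n * n + 1 ≤ W) :
    spanningFormula.Fits W n s := by
  have hnn : n ≤ n * n := Nat.le_mul_self n
  have hW₁ : 1 ≤ W := by omega
  refine h.fits_ex fun u => ?_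
  have h₁ := h.setVar (x := 20) (by decide) u
  refine h₁.fits_ex fun v => ?_
  have h₂ := h₁.setVar (x := 21) (by decide) v
  have hdist := dist_lt hG u v
  refine ⟨⟨h₂.fits_vertexDistExpr hG (i := u) (j := v) (by omega) rfl rfl, hW₁, ?_⟩,
    h₂.order.trans_le (by omega), hW₁⟩
  rw [h₂.eval_vertexDistExpr (i := u) (j := v) rfl rfl, Expr.eval]
  omega

theorem holds_dominatedFormula (h : HasDist G s) (hG : G.Connected) :
    dominatedFormula.Holds s ↔ Dominated G := by
  rw [dominatedFormula, h.holds_ex]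
  refine exists_congr fun u => ?_
  have h₁ := h.setVar (x := 20) (by decide) u
  rw [h₁.holds_ex]
  refine exists_congr fun v => ?_
  have h₂ := h₁.setVar (x := 21) (by decide) v
  rw [Formula.Holds, h₂.holds_all]
  refine and_congr (h₂.isTruthValue_closeExpr hG rfl rfl).2 (forall_congr' fun w => ?_)
  have h₃ := h₂.setVar (x := 22) (by decide) w
  have huw := h₃.isTruthValue_closeExpr hG (x := 20) (y := 22) (i := u) (j := w) rfl rfl
  have hvw := h₃.isTruthValue_closeExpr hG (x := 21) (y := 22) (i := v) (j := w) rfl rfl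
  rw [← huw.2, ← hvw.2, Formula.Holds, Expr.eval]
  omega

theorem fits_dominatedFormula (h : HasDist G s) (hG : G.Connected) (hW : n * n + 2 ≤ W) :
    dominatedFormula.Fits W n s := by
  refine h.fits_ex fun u => ?_
  have h₁ := h.setVar (x := 20) (by decide) u
  refine h₁.fits_ex fun v => ?_
  have h₂ := h₁.setVar (x := 21) (by decide) v
  refine ⟨h₂.fits_closeExpr hG hW (i := u) (j := v) rfl rfl, h₂.fits_all fun w => ?_⟩
  have h₃ := h₂.setVar (x := 22) (by decide) w
  have huw := (h₃.isTruthValue_closeExpr hG (x := 20) (y := 22) (i := u) (j := w) rfl rfl).1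
  have hvw := (h₃.isTruthValue_closeExpr hG (x := 21) (y := 22) (i := v) (j := w) rfl rfl).1
  exact ⟨h₃.fits_closeExpr hG hW (i := u) (j := w) rfl rfl,
    h₃.fits_closeExpr hG hW (i := v) (j := w) rfl rfl, by omega⟩

end HasDist

end DistanceFormulas

/-! ## The formula for one set of representatives -/

namespace Arr

@[simp] abbrev bits : ℕ := 5

end Arr

/-- The vertex of the representative number `x`. -/
def repExpr (x : ℕ) : Expr := .read Arr.reps (.var x)

/-- The distance of the representatives number `x` and `y`. -/
def repDistExpr (x y : ℕ) : Expr := .entry Arr.dist (repExpr x) (repExpr y)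

/-- There is a selected representative, put its number into the variable `x`, such that `φ`. -/
def Formula.exSelected (x : ℕ) (φ : Formula) : Formula :=
  .ex x Reg.repCount (.and (.atom (.read Arr.bits (.var x))) φ)

/-- For all selected representatives, with their number in the variable `x`, `φ`. -/
def Formula.allSelected (x : ℕ) (φ : Formula) : Formula := .neg (.exSelected x (.neg φ))

/-- The isometry condition of `IsGeodesicFrom`. -/
def isometryExpr (u x y : ℕ) : Expr :=
  .eq (repDistExpr x y) (.add (.sub (repDistExpr u x) (repDistExpr u y))
    (.sub (repDistExpr u y) (repDistExpr u x)))

/-- The predecessor condition of `IsGeodesicFrom`. -/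
def predExpr (u x z : ℕ) : Expr :=
  .eq (repDistExpr u z) (.sub (repDistExpr u x) (.const 1))

/-- The representative number `x` has distance at most `Reg.bound` from the vertex `v`. -/
def nearExpr (x v : ℕ) : Expr :=
  .lt (.entry Arr.dist (repExpr x) (.var v)) (.add (.var Reg.bound) (.const 1))

/-- The selected representatives form a set with `IsGeodesicFrom`. -/
def geodesicFormula : Formula :=
  .exSelected 20 (.allSelected 21 (.and (.allSelected 22 (.atom (isometryExpr 20 21 22)))
    (.exSelected 22 (.atom (predExpr 20 21 22)))))

/-- Every vertex is near to a selected representative. -/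
def coverFormula : Formula :=
  .all 20 Reg.order (.exSelected 21 (.atom (nearExpr 21 20)))

/-- The formula for `IsSolution`. -/
def solutionFormula : Formula := .and geodesicFormula coverFormula

theorem wf_solutionFormula : solutionFormula.WF 30 20 := by
  simp [solutionFormula, geodesicFormula, coverFormula, Formula.exSelected, Formula.allSelected,
    Formula.all, Formula.WF, isometryExpr, predExpr, nearExpr, repDistExpr, repExpr, Expr.entry,
    Expr.index, Expr.VarsLt]

theorem cost_solutionFormula {n : ℕ} (hn : 0 < n) : solutionFormula.cost n ≤ 1000 * n ^ 3 := by
  have h₁ : n ≤ n ^ 3 := Nat.le_self_pow three_ne_zero n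
  have h₂ : n ^ 2 ≤ n ^ 3 := Nat.pow_le_pow_right hn (by decide)
  have : 1 ≤ n ^ 3 := Nat.one_le_pow _ _ hn
  simp only [solutionFormula, geodesicFormula, coverFormula, Formula.exSelected,
    Formula.allSelected, Formula.all, Formula.cost, isometryExpr, predExpr, nearExpr, repDistExpr,
    repExpr, Expr.cost_entry, Expr.cost]
  nlinarith

/-- The memory holds the order of the graph, the bound `k`, the distance matrix, the
representatives `L`, and the binary digits of `c` that select some of them. -/
structure HasSelection {n : ℕ} (G : SimpleGraph (Fin n)) (k : ℕ) (L : List (Fin n)) (c : ℕ)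
    (s : State) : Prop extends HasDist G s where
  bound : s.var Reg.bound = k
  reps : Stores L Arr.reps Reg.repCount s
  bits : ∀ i < L.length, IsTruthValue (s.arr Arr.bits i) (c.testBit i)

namespace HasSelection

variable {n : ℕ} {G : SimpleGraph (Fin n)} {k c : ℕ} {L : List (Fin n)} {s s' : State}
  {x y z u v : ℕ} {φ : Formula} {W N : ℕ}

theorem of_agree (h : HasSelection G k L c s) (hA : Agree 14 s s') : HasSelection G k L c s' where
  toHasDist := h.toHasDist.congr (hA.var _ (by decide)) (by rw [hA.arr])
  bound := (hA.var _ (by decide)).trans h.bound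
  reps := h.reps.congr (hA.var _ (by decide)) (by rw [hA.arr])
  bits := hA.arr ▸ h.bits

theorem setVar (h : HasSelection G k L c s) (hx : 14 ≤ x) (v : ℕ) :
    HasSelection G k L c (s.setVar x v) :=
  h.of_agree ((Agree.refl 14 s).setVar_right hx v)

theorem holds_exSelected (h : HasSelection G k L c s) :
    (Formula.exSelected x φ).Holds s ↔
      ∃ i : Fin L.length, c.testBit i ∧ φ.Holds (s.setVar x i) := by
  simp only [Formula.exSelected, Formula.Holds, Expr.eval, State.setVar_var, if_true,
    State.setVar_arr, h.reps.length, Fin.exists_iff]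
  exact exists_congr fun i => ⟨fun ⟨hi, hb, hφ⟩ => ⟨hi, (h.bits i hi).2.1 hb, hφ⟩,
    fun ⟨hi, hb, hφ⟩ => ⟨hi, (h.bits i hi).2.2 hb, hφ⟩⟩

theorem holds_allSelected (h : HasSelection G k L c s) :
    (Formula.allSelected x φ).Holds s ↔
      ∀ i : Fin L.length, c.testBit i → φ.Holds (s.setVar x i) := by
  simp only [Formula.allSelected, Formula.Holds, h.holds_exSelected, not_exists, not_and, not_not]

theorem fits_exSelected (h : HasSelection G k L c s) (hL : L.length ≤ N) (hNW : N ≤ W)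
    (hW : 1 ≤ W) (hφ : ∀ i : Fin L.length, φ.Fits W N (s.setVar x i)) :
    (Formula.exSelected x φ).Fits W N s := by
  simp only [Formula.exSelected, Formula.Fits, Expr.Fits, Expr.eval, State.setVar_var, if_true,
    State.setVar_arr, h.reps.length]
  exact ⟨hL, fun i hi => ⟨⟨by omega, (h.bits i hi).1.trans hW⟩, hφ ⟨i, hi⟩⟩⟩

theorem eval_repExpr (h : HasSelection G k L c s) {i : Fin L.length} (hx : s.var x = i) :
    (repExpr x).eval s = L[i] := by
  rw [repExpr, Expr.eval, Expr.eval, hx]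
  exact h.reps.get i i.2

theorem eval_repDistExpr (h : HasSelection G k L c s) {i j : Fin L.length} (hx : s.var x = i)
    (hy : s.var y = j) : (repDistExpr x y).eval s = G.dist L[i] L[j] := by
  rw [repDistExpr, Expr.eval_entry h.order, h.eval_repExpr hx, h.eval_repExpr hy, h.dist]

theorem eval_isometryExpr_ne_zero_iff (h : HasSelection G k L c s) {i j l : Fin L.length}
    (hu : s.var u = i) (hx : s.var x = j) (hy : s.var y = l) :
    (isometryExpr u x y).eval s ≠ 0 ↔
      G.dist L[j] L[l] = Nat.dist (G.dist L[i] L[j]) (G.dist L[i] L[l]) := by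
  rw [isometryExpr, Expr.eval_eq_ne_zero_iff]
  simp only [Expr.eval, h.eval_repDistExpr hu hx,
    h.eval_repDistExpr hu hy, h.eval_repDistExpr hx hy, Nat.dist]

theorem eval_predExpr_ne_zero_iff (h : HasSelection G k L c s) {i j l : Fin L.length}
    (hu : s.var u = i) (hx : s.var x = j) (hz : s.var z = l) :
    (predExpr u x z).eval s ≠ 0 ↔ G.dist L[i] L[l] = G.dist L[i] L[j] - 1 := by
  rw [predExpr, Expr.eval_eq_ne_zero_iff]
  simp only [Expr.eval, h.eval_repDistExpr hu hx,
    h.eval_repDistExpr hu hz]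

theorem eval_nearExpr_ne_zero_iff (h : HasSelection G k L c s) {i : Fin L.length} {w : Fin n}
    (hx : s.var x = i) (hv : s.var v = w) :
    (nearExpr x v).eval s ≠ 0 ↔ G.dist L[i] w ≤ k := by
  rw [nearExpr, Expr.eval_lt_ne_zero_iff]
  simp only [Expr.eval_entry h.order, h.eval_repExpr hx,
    Expr.eval, hv, h.dist, h.bound, Nat.lt_succ_iff]

theorem holds_geodesicFormula (h : HasSelection G k L c s) :
    geodesicFormula.Holds s ↔ ∃ u, IsGeodesicFrom G u (selection L c) := by
  have holds_body : ∀ i j : Fin L.length,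
      (Formula.and (.allSelected 22 (.atom (isometryExpr 20 21 22)))
        (.exSelected 22 (.atom (predExpr 20 21 22)))).Holds ((s.setVar 20 i).setVar 21 j) ↔
      (∀ l : Fin L.length, c.testBit l →
        G.dist L[j] L[l] = Nat.dist (G.dist L[i] L[j]) (G.dist L[i] L[l])) ∧
      ∃ l : Fin L.length, c.testBit l ∧ G.dist L[i] L[l] = G.dist L[i] L[j] - 1 := by
    intro i j
    have h₁ := (h.setVar (x := 20) (by decide) i).setVar (x := 21) (by decide) j
    rw [Formula.Holds, h₁.holds_allSelected, h₁.holds_exSelected]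
    refine and_congr (forall₂_congr fun l _ => ?_)
      (exists_congr fun l => and_congr_right fun _ => ?_)
    · exact (h₁.setVar (by decide) l).eval_isometryExpr_ne_zero_iff rfl rfl rfl
    · exact (h₁.setVar (by decide) l).eval_predExpr_ne_zero_iff rfl rfl rfl
  simp only [geodesicFormula, h.holds_exSelected,
    (h.setVar (x := 20) (by decide) _).holds_allSelected, holds_body]
  constructor
  · rintro ⟨i, hi, hbody⟩
    refine ⟨L[i], ⟨i, hi, rfl⟩, ?_, ?_⟩
    · rintro _ ⟨j, hj, rfl⟩ _ ⟨l, hl, rfl⟩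
      exact (hbody j hj).1 l hl
    · rintro _ ⟨j, hj, rfl⟩
      obtain ⟨l, hl, hlj⟩ := (hbody j hj).2
      exact ⟨_, ⟨l, hl, rfl⟩, hlj⟩
  · rintro ⟨_, ⟨i, hi, rfl⟩, hiso, hpred⟩
    refine ⟨i, hi, fun j hj => ⟨fun l hl => hiso _ ⟨j, hj, rfl⟩ _ ⟨l, hl, rfl⟩, ?_⟩⟩
    obtain ⟨_, ⟨l, hl, rfl⟩, hlj⟩ := hpred _ ⟨j, hj, rfl⟩
    exact ⟨l, hl, hlj⟩

theorem holds_coverFormula (h : HasSelection G k L c s) :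
    coverFormula.Holds s ↔ ∀ v, ∃ x ∈ selection L c, G.dist x v ≤ k := by
  rw [coverFormula, h.holds_all]
  refine forall_congr' fun v => ?_
  have h₁ := h.setVar (x := 20) (by decide) v
  rw [h₁.holds_exSelected]
  have hnear : ∀ i : Fin L.length, (Formula.atom (nearExpr 21 20)).Holds
      ((s.setVar 20 v).setVar 21 i) ↔ G.dist L[i] v ≤ k := fun i =>
    (h₁.setVar (by decide) i).eval_nearExpr_ne_zero_iff rfl rfl
  simp only [hnear]
  constructor
  · rintro ⟨i, hi, hiv⟩
    exact ⟨_, ⟨i, hi, rfl⟩, hiv⟩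
  · rintro ⟨_, ⟨i, hi, rfl⟩, hiv⟩
    exact ⟨i, hi, hiv⟩

theorem holds_solutionFormula (h : HasSelection G k L c s) :
    solutionFormula.Holds s ↔ IsSolution G k (selection L c) :=
  and_congr h.holds_geodesicFormula h.holds_coverFormula

theorem fits_repExpr (h : HasSelection G k L c s) (hL : L.length ≤ n) (hW : n ≤ W)
    {i : Fin L.length} (hx : s.var x = i) : (repExpr x).Fits W s := by
  have := i.2
  have := L[i].2
  refine ⟨?_, (h.eval_repExpr hx).trans_le (by omega)⟩
  simp only [Expr.Fits, hx]
  omega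

theorem fits_repDistExpr (h : HasSelection G k L c s) (hG : G.Connected) (hL : L.length ≤ n)
    (hW : n * n ≤ W) {i j : Fin L.length} (hx : s.var x = i) (hy : s.var y = j) :
    (repDistExpr x y).Fits W s := by
  have hnn : n ≤ n * n := Nat.le_mul_self n
  have hdist := dist_lt hG L[i] L[j]
  refine Expr.fits_entry h.order hW (h.fits_repExpr hL (by omega) hx)
    (h.fits_repExpr hL (by omega) hy) ?_ ?_ ?_
  · exact h.eval_repExpr hx ▸ L[i].2
  · exact h.eval_repExpr hy ▸ L[j].2
  · rw [h.eval_repExpr hx, h.eval_repExpr hy, h.dist]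
    omega

theorem fits_isometryExpr (h : HasSelection G k L c s) (hG : G.Connected) (hL : L.length ≤ n)
    (hW : n * n ≤ W) {i j l : Fin L.length} (hu : s.var u = i) (hx : s.var x = j)
    (hy : s.var y = l) : (isometryExpr u x y).Fits W s := by
  have hnn : n ≤ n * n := Nat.le_mul_self n
  have hij := dist_lt hG L[i] L[j]
  have hil := dist_lt hG L[i] L[l]
  have hux := h.fits_repDistExpr hG hL hW hu hx
  have huy := h.fits_repDistExpr hG hL hW hu hy
  refine ⟨h.fits_repDistExpr hG hL hW hx hy, ⟨⟨hux, huy⟩, ⟨huy, hux⟩, ?_⟩, by omega⟩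
  simp only [Expr.eval, h.eval_repDistExpr hu hx, h.eval_repDistExpr hu hy]
  omega

theorem fits_predExpr (h : HasSelection G k L c s) (hG : G.Connected) (hL : L.length ≤ n)
    (hW : n * n + 1 ≤ W) {i j l : Fin L.length} (hu : s.var u = i) (hx : s.var x = j)
    (hz : s.var z = l) : (predExpr u x z).Fits W s := by
  have hW₁ : 1 ≤ W := by omega
  exact ⟨h.fits_repDistExpr hG hL (by omega) hu hz,
    ⟨h.fits_repDistExpr hG hL (by omega) hu hx, hW₁⟩, hW₁⟩

theorem fits_nearExpr (h : HasSelection G k L c s) (hG : G.Connected) (hL : L.length ≤ n)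
    (hW : n * n + k + 1 ≤ W) {i : Fin L.length} {w : Fin n} (hx : s.var x = i)
    (hv : s.var v = w) : (nearExpr x v).Fits W s := by
  have hnn : n ≤ n * n := Nat.le_mul_self n
  have hdist := dist_lt hG L[i] w
  have := w.2
  refine ⟨Expr.fits_entry h.order (by omega) (h.fits_repExpr hL (by omega) hx) ?_ ?_ ?_ ?_,
    ⟨?_, ?_, ?_⟩, by omega⟩
  · simp only [Expr.Fits, hv]
    omega
  · exact h.eval_repExpr hx ▸ L[i].2
  · simp only [Expr.eval, hv, Fin.is_lt]
  · rw [h.eval_repExpr hx, Expr.eval, hv, h.dist]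
    omega
  all_goals
    simp only [Expr.Fits, Expr.eval, h.bound]
    omega

theorem fits_solutionFormula (h : HasSelection G k L c s) (hG : G.Connected) (hL : L.length ≤ n)
    (hW : n * n + k + 1 ≤ W) : solutionFormula.Fits W n s := by
  have hnn : n ≤ n * n := Nat.le_mul_self n
  have hnW : n ≤ W := by omega
  have hW₁ : 1 ≤ W := by omega
  refine ⟨h.fits_exSelected hL hnW hW₁ fun i => ?_, h.fits_all fun v => ?_⟩
  · have h₁ := h.setVar (x := 20) (by decide) i
    refine h₁.fits_exSelected hL hnW hW₁ fun j => ?_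
    have h₂ := h₁.setVar (x := 21) (by decide) j
    exact ⟨h₂.fits_exSelected hL hnW hW₁ fun l => (h₂.setVar (by decide) l).fits_isometryExpr hG hL
        (by omega) rfl rfl rfl,
      h₂.fits_exSelected hL hnW hW₁ fun l => (h₂.setVar (by decide) l).fits_predExpr hG hL
        (by omega) rfl rfl rfl⟩
  · have h₁ := h.setVar (x := 20) (by decide) v
    exact h₁.fits_exSelected hL hnW hW₁ fun i => (h₁.setVar (by decide) i).fits_nearExpr hG hL hW
      (w := v) rfl rfl

end HasSelection

/-! ## The search over all sets of representatives -/

theorem two_pow_succ_dvd_succ_iff {i c : ℕ} :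
    2 ^ (i + 1) ∣ c + 1 ↔ c.testBit i ∧ 2 ^ i ∣ c + 1 := by
  rw [Nat.testBit_eq_decide_div_mod_eq, decide_eq_true_iff]
  constructor
  · intro h
    have hi : 2 ^ i ∣ c + 1 := (pow_dvd_pow 2 i.le_succ).trans h
    have heven : 2 ∣ (c + 1) / 2 ^ i := (Nat.dvd_div_iff_mul_dvd hi).2 h
    rw [Nat.succ_div_of_dvd hi] at heven
    exact ⟨by omega, hi⟩
  · rintro ⟨hbit, hi⟩
    refine (Nat.dvd_div_iff_mul_dvd hi).1 ?_
    rw [Nat.succ_div_of_dvd hi]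
    omega

theorem testBit_succ_iff {i c : ℕ} : (c + 1).testBit i ↔ ¬ (c.testBit i ↔ 2 ^ i ∣ c + 1) := by
  simp only [Nat.testBit_eq_decide_div_mod_eq, decide_eq_true_iff, Nat.succ_div]
  split_ifs with h
  · simp only [h, iff_true]
    omega
  · simp only [h, iff_false, not_not, Nat.add_zero]

namespace Reg

@[simp] abbrev running : ℕ := 14
@[simp] abbrev found : ℕ := 15
@[simp] abbrev carry : ℕ := 16
@[simp] abbrev bitIdx : ℕ := 17
@[simp] abbrev oldBit : ℕ := 18

end Reg

/-- The half adder for the digit `Reg.bitIdx` of the binary number in the array `Arr.bits`. -/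
def halfAdderProg : Prog :=
  .seq (.assign Reg.oldBit (.read Arr.bits (.var Reg.bitIdx))) (.seq
    (.write Arr.bits (.var Reg.bitIdx) (.sub (.const 1) (.eq (.var Reg.oldBit) (.var Reg.carry))))
    (.assign Reg.carry (.mul (.var Reg.oldBit) (.var Reg.carry))))

/-- Add one to the binary number in the array `Arr.bits`, which has `Reg.repCount` digits, and set
`Reg.running` to 0 in case of an overflow. -/
def incProg : Prog :=
  .seq (.assign Reg.carry (.const 1)) (.seq (.forLt Reg.bitIdx Reg.repCount halfAdderProg)
    (.assign Reg.running (.sub (.const 1) (.var Reg.carry))))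

section Increment

variable {W t c i : ℕ} {s : State}

/-- The digits below `i` have been updated. -/
structure IncInvariant (t c i : ℕ) (s : State) : Prop where
  carry : IsTruthValue (s.var Reg.carry) (2 ^ i ∣ c + 1)
  bits : ∀ j < t, IsTruthValue (s.arr Arr.bits j) ((if j < i then c + 1 else c).testBit j)

theorem IncInvariant.runs_halfAdderProg (h : IncInvariant t c i s) (hW : t + 2 ≤ W) (hi : i < t)
    (hx : s.var Reg.bitIdx = i) :
    Runs W halfAdderProg s 14
      (fun s' => IncInvariant t c (i + 1) (s'.setVar Reg.bitIdx (i + 1))) := by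
  have hbit : IsTruthValue (s.arr Arr.bits i) (c.testBit i) := by
    simpa only [lt_irrefl, if_false] using h.bits i hi
  have hcarry := h.carry
  generalize hb : s.arr Arr.bits i = b at hbit
  generalize ha : s.var Reg.carry = a at hcarry
  have hb_le := hbit.1
  have hcarry_le := hcarry.1
  have hnew_carry := hbit.and hcarry
  have hnew_carry_le := hnew_carry.1
  have hnew_bit : IsTruthValue (1 - if b = a then 1 else 0) ((c + 1).testBit i) :=
    IsTruthValue.ite.not.congr ((hbit.eq_iff hcarry).not.trans testBit_succ_iff.symm)
  refine Runs.seq (t₁ := 3) (t₂ := 11) (R := (· = s.setVar Reg.oldBit b))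
    (Runs.assign (e := .read Arr.bits (.var Reg.bitIdx)) ?_ ?_) ?_
  · simp only [Expr.Fits, Expr.eval, hx, hb]
    omega
  · simp only [Expr.eval, hx, hb]
  rintro _ rfl
  refine Runs.seq (t₁ := 7) (t₂ := 4) (R := (· = (s.setVar Reg.oldBit b).setCell Arr.bits i
      (1 - if b = a then 1 else 0)))
    (Runs.write (i := .var Reg.bitIdx)
      (e := .sub (.const 1) (.eq (.var Reg.oldBit) (.var Reg.carry))) ?_ ?_ ?_) ?_
  · simp only [Expr.Fits, Reg.oldBit, Reg.bitIdx, State.setVar_var, Nat.reduceEqDiff, if_false, hx]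
    omega
  · simp only [Expr.Fits, Reg.oldBit, Reg.carry, State.setVar_var, Nat.reduceEqDiff, if_false,
      if_true, ha]
    omega
  · simp [Expr.eval, hx, ha]
  rintro _ rfl
  refine Runs.assign (e := .mul (.var Reg.oldBit) (.var Reg.carry)) ?_ ⟨?_, fun j hj => ?_⟩
  · simp only [Expr.Fits, Expr.eval, Reg.oldBit, Reg.carry, State.setCell_var, State.setVar_var,
      Nat.reduceEqDiff, if_false, if_true, ha]
    omega
  · simpa [Expr.eval, ha] using hnew_carry.congr two_pow_succ_dvd_succ_iff.symm
  · simp only [State.setVar_arr, State.setCell_arr, true_and]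
    rcases eq_or_ne j i with rfl | hji
    · simpa only [if_true, Nat.lt_succ_self] using hnew_bit
    · simpa only [hji, if_false, Nat.lt_succ_iff_lt_or_eq, or_false] using h.bits j hj

theorem runs_incProg (hW : t + 2 ≤ W) (ht : s.var Reg.repCount = t)
    (hs : ∀ i < t, IsTruthValue (s.arr Arr.bits i) (c.testBit i)) :
    Runs W incProg s (t * 22 + 12) (fun s' =>
      (∀ i < t, IsTruthValue (s'.arr Arr.bits i) ((c + 1).testBit i)) ∧
        IsTruthValue (s'.var Reg.running) (¬ 2 ^ t ∣ c + 1)) := by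
  refine (Runs.seq (t₁ := 2) (t₂ := (t * (14 + 8) + 6) + 4) (R := (· = s.setVar Reg.carry 1))
    (Runs.assign (e := .const 1) (by simp only [Expr.Fits]; omega) rfl) ?_).le_time (by omega)
  rintro _ rfl
  refine Runs.seq (Runs.forLt (IncInvariant t c) (by decide) (by decide) ht (by omega) (by omega)
    ⟨?_, ?_⟩ fun i s hi hx _ h => h.runs_halfAdderProg hW hi hx) fun s' h => ?_
  · exact .one (by simp only [pow_zero, one_dvd])
  · simpa only [Nat.not_lt_zero, if_false, State.setVar_arr] using hs
  · have := h.carry.1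
    refine Runs.assign (e := .sub (.const 1) (.var Reg.carry)) ?_ ⟨fun i hi => ?_, h.carry.not⟩
    · simp only [Expr.Fits]
      omega
    · simpa only [hi, if_true, State.setVar_arr] using h.bits i hi

end Increment

/-- Set `Reg.found` to 1 if the selected representatives form a solution. -/
def checkProg : Prog :=
  .seq (solutionFormula.prog 30) (.ite (.var 30) (.assign Reg.found (.const 1)) .skip)

/-- Set `Reg.found` to 1 if some set of representatives is a solution, and to 0 otherwise. -/
def searchProg : Prog :=
  .seq (.assign Reg.found (.const 0)) (.seq (.assign Reg.running (.const 1))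
    (.while (.var Reg.running) (.seq checkProg incProg)))

section Search

variable {n : ℕ} {G : SimpleGraph (Fin n)} {W k c m : ℕ} {L : List (Fin n)} {s : State}

theorem runs_checkProg (hG : G.Connected) (hL : L.length ≤ n) (hW : n * n + k + 1 ≤ W)
    (hs : HasSelection G k L c s)
    (hfound : IsTruthValue (s.var Reg.found) (∃ d < c, IsSolution G k (selection L d))) :
    Runs W checkProg s (1000 * n ^ 3 + 4) (fun s' => HasSelection G k L c s' ∧
      IsTruthValue (s'.var Reg.found) (∃ d < c + 1, IsSolution G k (selection L d))) := by
  have hn : 0 < n := Fin.pos_iff_nonempty.2 hG.nonempty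
  have hnn : n ≤ n * n := Nat.le_mul_self n
  have hW₁ : 1 ≤ W := by omega
  refine Runs.seq ((Formula.runs_prog hW₁ (by omega) (by decide) wf_solutionFormula
    (hs.fits_solutionFormula hG hL hW)).le_time (cost_solutionFormula hn)) ?_
  rintro s' ⟨hA, hφ⟩
  rw [hs.holds_solutionFormula] at hφ
  have hs' : HasSelection G k L c s' := hs.of_agree (hA.mono (by decide))
  refine Runs.ite (t := 2) (e := .var 30) (hφ.1.trans hW₁) (fun h => ?_) fun h => ?_
  · exact Runs.assign (e := .const 1) hW₁ ⟨hs'.setVar (by decide) 1,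
      .one ⟨c, c.lt_succ_self, hφ.2.1 h⟩⟩
  · refine (Runs.skip ⟨hs', ?_⟩).le_time one_le_two
    rw [hA.var Reg.found (by decide)]
    refine hfound.congr ?_
    rw [Nat.exists_lt_succ_right, or_iff_left (hφ.eq_zero_iff.1 h)]

theorem HasSelection.runs_incProg (hW : L.length + 2 ≤ W) (hs : HasSelection G k L c s) :
    Runs W incProg s (L.length * 22 + 12) (fun s' => HasSelection G k L (c + 1) s' ∧
      IsTruthValue (s'.var Reg.running) (¬ 2 ^ L.length ∣ c + 1) ∧
      s'.var Reg.found = s.var Reg.found) := by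
  refine (MESP.runs_incProg hW hs.reps.length hs.bits).frame.imp ?_
  rintro s' ⟨hF, hbits, hrun⟩
  refine ⟨⟨?_, ?_, ?_, hbits⟩, hrun, hF.var _ (by decide)⟩
  · exact hs.toHasDist.congr (hF.var _ (by decide)) (hF.arr _ (by decide))
  · exact (hF.var _ (by decide)).trans hs.bound
  · exact hs.reps.of_frame hF (by decide) (by decide)

/-- The state of the search when `m` of the sets of representatives are left. -/
def SearchInvariant (G : SimpleGraph (Fin n)) (k : ℕ) (L : List (Fin n)) (m : ℕ) (s : State) :
    Prop :=
  ∃ c, c + m = 2 ^ L.length ∧ HasSelection G k L c s ∧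
    IsTruthValue (s.var Reg.running) (m ≠ 0) ∧
    IsTruthValue (s.var Reg.found) (∃ d < c, IsSolution G k (selection L d))

theorem SearchInvariant.runs_step (hG : G.Connected) (hL : L.length ≤ n)
    (hW : n * n + n + k + 2 ≤ W) (h : SearchInvariant G k L (m + 1) s) :
    Runs W (.seq checkProg incProg) s (1000 * n ^ 3 + 4 + (n * 22 + 12))
      (SearchInvariant G k L m) := by
  obtain ⟨c, hc, hs, -, hfound⟩ := h
  refine Runs.seq (runs_checkProg hG hL (by omega) hs hfound) ?_
  rintro s₁ ⟨hs₁, hfound₁⟩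
  refine ((hs₁.runs_incProg (by omega)).le_time (by omega)).imp ?_
  rintro s₂ ⟨hs₂, hrun, hfound₂⟩
  have hoverflow : 2 ^ L.length ∣ c + 1 ↔ m = 0 := by
    rw [← hc]
    constructor
    · intro hd
      have := Nat.le_of_dvd c.succ_pos hd
      omega
    · rintro rfl
      rw [Nat.zero_add]
  exact ⟨c + 1, by omega, hs₂, hrun.congr hoverflow.not, hfound₂ ▸ hfound₁⟩

theorem runs_searchProg (hG : G.Connected) (hL : L.length ≤ n) (hW : n * n + n + k + 2 ≤ W)
    (hs : HasSelection G k L 0 s) :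
    Runs W searchProg s (2000 * (2 ^ L.length * n ^ 3)) (fun s' =>
      IsTruthValue (s'.var Reg.found)
        (∃ c < 2 ^ L.length, IsSolution G k (selection L c))) := by
  have hn : 0 < n := Fin.pos_iff_nonempty.2 hG.nonempty
  have hW₁ : 1 ≤ W := by omega
  have htime : 2 + (2 + (2 ^ L.length * (1 + 1 + (1000 * n ^ 3 + 4 + (n * 22 + 12))) + (1 + 1))) ≤
      2000 * (2 ^ L.length * n ^ 3) := by
    have hn₁ : n ≤ n ^ 3 := Nat.le_self_pow three_ne_zero n
    have hn₂ : 1 ≤ n ^ 3 := Nat.one_le_pow _ _ hn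
    have hpow : 1 ≤ 2 ^ L.length := Nat.one_le_two_pow
    have := Nat.mul_le_mul_left (2 ^ L.length) hn₁
    have := Nat.mul_le_mul_left (2 ^ L.length) hn₂
    nlinarith
  refine (Runs.seq (R := (· = s.setVar Reg.found 0)) (Runs.assign (e := .const 0) (Nat.zero_le W)
    rfl) ?_).le_time htime
  rintro _ rfl
  refine Runs.seq (R := (· = (s.setVar Reg.found 0).setVar Reg.running 1))
    (Runs.assign (e := .const 1) hW₁ rfl) ?_
  rintro _ rfl
  refine (Runs.while_loop (SearchInvariant G k L) (m := 2 ^ L.length) ?_ ?_ ?_ ?_).imp ?_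
  · rintro m s ⟨c, -, -, hrun, -⟩
    exact hrun.1.trans hW₁
  · intro m s h
    obtain ⟨c, -, -, hrun, -⟩ := id h
    exact ⟨hrun.2.2 m.succ_ne_zero, h.runs_step hG hL hW⟩
  · rintro s ⟨c, -, -, hrun, -⟩
    exact hrun.eq_zero fun h => h rfl
  · refine ⟨0, Nat.zero_add _, (hs.setVar (by decide) 0).setVar (by decide) 1,
      .one (by positivity), .zero ?_⟩
    rintro ⟨d, hd, -⟩
    exact Nat.not_lt_zero d hd
  · rintro s ⟨c, rfl, -, -, hfound⟩
    exact hfound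

end Search

/-! ## The program for the Minimum Eccentricity Shortest Path problem -/

/-- The search for a shortest path through representatives; the answer is put into variable 0. -/
def repsSearchProg : Prog :=
  .seq repsProg (.seq searchProg (.assign Reg.order (.var Reg.found)))

/-- The program for positive bounds, run after `distProg`; the answer is put into variable 0. -/
def positiveProg : Prog :=
  .seq (dominatedFormula.prog 30)
    (.ite (.var 30) (.assign Reg.order (.const 1)) repsSearchProg)

/-- The program for the bound 0, run after `distProg`; the answer is put into variable 0. -/
def spanningProg : Prog :=
  .seq (spanningFormula.prog 30) (.assign Reg.order (.var 30))

/-- The program that decides the Minimum Eccentricity Shortest Path problem. -/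
def mespProg : Prog :=
  .seq distProg (.ite (.var Reg.bound) positiveProg spanningProg)

section Main

variable {n : ℕ} {G : SimpleGraph (Fin n)} {W k : ℕ} {s : State}

theorem runs_repsSearchProg (hG : G.Connected) (hD : ¬ Dominated G)
    (hW : n * n + n + k + 2 ≤ W) (hin : HasInput G s) (hd : HasDist G s)
    (hk : s.var Reg.bound = k) (hbits : ∀ i, s.arr Arr.bits i = 0) :
    Runs W repsSearchProg s (2300 * (2 ^ modularWidth G * n ^ 3))
      (fun s' => IsTruthValue (s'.var 0) (YesInstance G k)) := by
  have hn : 0 < n := Fin.pos_iff_nonempty.2 hG.nonempty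
  have hpos : 1 ≤ 2 ^ modularWidth G * n ^ 3 := Nat.one_le_iff_ne_zero.2 (by positivity)
  refine (Runs.seq (t₂ := 2000 * (2 ^ modularWidth G * n ^ 3) + 2)
    (runs_repsProg (by omega) hG hD hin).frame ?_).le_time (by omega)
  rintro s₁ ⟨hF, L, hL, H⟩
  have hs₁ : HasSelection G k L 0 s₁ := {
    hd.congr (hF.var _ (by decide)) (hF.arr _ (by decide)) with
    bound := (hF.var _ (by decide)).trans hk
    reps := hL
    bits := fun i _ => by
      rw [hF.arr _ (by decide), hbits]
      exact .zero (by simp only [Nat.zero_testBit, Bool.false_eq_true, not_false_eq_true]) }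
  have htime : 2000 * (2 ^ L.length * n ^ 3) ≤ 2000 * (2 ^ modularWidth G * n ^ 3) := by
    gcongr
    · exact one_le_two
    · exact H.length_le_modularWidth hG hD
  refine Runs.seq ((runs_searchProg hG (H.length_le hD) hW hs₁).le_time htime) fun s₂ hfound => ?_
  have hW₁ : 1 ≤ W := by omega
  exact Runs.assign (e := .var Reg.found) (hfound.1.trans hW₁)
    (hfound.congr (H.yesInstance_iff_selection hG hD).symm)

theorem runs_positiveProg (hG : G.Connected) (hk_pos : 0 < k) (hW : n * n + n + k + 2 ≤ W)
    (hin : HasInput G s) (hd : HasDist G s) (hk : s.var Reg.bound = k)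
    (hbits : ∀ i, s.arr Arr.bits i = 0) :
    Runs W positiveProg s (2600 * (2 ^ modularWidth G * n ^ 3))
      (fun s' => IsTruthValue (s'.var 0) (YesInstance G k)) := by
  have hn : 0 < n := Fin.pos_iff_nonempty.2 hG.nonempty
  have hn₃ : 1 ≤ n ^ 3 := Nat.one_le_pow _ _ hn
  have hle : n ^ 3 ≤ 2 ^ modularWidth G * n ^ 3 := Nat.le_mul_of_pos_left _ (by positivity)
  have hW₁ : 1 ≤ W := by omega
  refine (Runs.seq (t₂ := 2 + 2300 * (2 ^ modularWidth G * n ^ 3))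
    ((Formula.runs_prog hW₁ (by omega) (by decide) wf_dominatedFormula
      (hd.fits_dominatedFormula hG (by omega))).le_time (cost_dominatedFormula hn)) ?_).le_time
    (by omega)
  rintro s₁ ⟨hA, hφ⟩
  rw [hd.holds_dominatedFormula hG] at hφ
  refine Runs.ite (e := .var 30) (hφ.1.trans hW₁) (fun h => ?_) fun h => ?_
  · exact (Runs.assign (e := .const 1) hW₁
      (.one ((hφ.2.1 h).yesInstance hG hk_pos))).le_time (by simp only [Expr.cost]; omega)
  · have horder := hA.var Reg.order (by decide)
    exact runs_repsSearchProg hG (hφ.eq_zero_iff.1 h) hW ⟨horder.trans hin.order, hA.arr ▸ hin.adj⟩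
      (hd.congr horder (by rw [hA.arr])) ((hA.var _ (by decide)).trans hk) (hA.arr ▸ hbits)

theorem runs_spanningProg (hG : G.Connected) (hW : n * n + 1 ≤ W) (hd : HasDist G s) :
    Runs W spanningProg s (200 * n ^ 3)
      (fun s' => IsTruthValue (s'.var 0) (YesInstance G 0)) := by
  have hn : 0 < n := Fin.pos_iff_nonempty.2 hG.nonempty
  have hn₃ : 1 ≤ n ^ 3 := Nat.one_le_pow _ _ hn
  have hnn : n ≤ n * n := Nat.le_mul_self n
  have hW₁ : 1 ≤ W := by omega
  refine (Runs.seq (t₂ := 2) ((Formula.runs_prog hW₁ (by omega) (by decide) wf_spanningFormula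
    (hd.fits_spanningFormula hG hW)).le_time (cost_spanningFormula hn)) ?_).le_time (by omega)
  rintro s₁ ⟨-, hφ⟩
  rw [hd.holds_spanningFormula, ← yesInstance_zero_iff hG] at hφ
  exact Runs.assign (e := .var 30) (hφ.1.trans hW₁) hφ

open Classical in
theorem hasInput_inputState (G : SimpleGraph (Fin n)) (k : ℕ) : HasInput G (inputState G k) where
  order := rfl
  adj i j := by
    refine IsTruthValue.ite.congr ⟨?_, fun h => ⟨rfl, i, j, rfl, h⟩⟩
    rintro ⟨-, i', j', hidx, h⟩
    obtain ⟨hi, hj⟩ := (index_inj j.2 j'.2).1 hidx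
    rwa [Fin.ext hi, Fin.ext hj]

theorem runs_mespProg (hG : G.Connected) (hW : n * n + 2 * n + k + 2 ≤ W) :
    Runs W mespProg (inputState G k) (3000 * (2 ^ modularWidth G * n ^ 3))
      (fun s' => IsTruthValue (s'.var 0) (YesInstance G k)) := by
  have hn : 0 < n := Fin.pos_iff_nonempty.2 hG.nonempty
  have hn₃ : 1 ≤ n ^ 3 := Nat.one_le_pow _ _ hn
  have hle : n ^ 3 ≤ 2 ^ modularWidth G * n ^ 3 := Nat.le_mul_of_pos_left _ (by positivity)
  have hin := hasInput_inputState G k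
  refine (Runs.seq (t₂ := 2 + 2600 * (2 ^ modularWidth G * n ^ 3))
    (runs_distProg hG (by omega) hin).frame ?_).le_time (by omega)
  rintro s₁ ⟨hF, hdist⟩
  have hd : HasDist G s₁ := ⟨(hF.var _ (by decide)).trans hin.order, hdist⟩
  have hk : s₁.var Reg.bound = k := hF.var _ (by decide)
  refine Runs.ite (e := .var Reg.bound) (hk.trans_le (by omega)) (fun h => ?_) fun h => ?_
  · refine runs_positiveProg hG (Nat.pos_of_ne_zero (hk ▸ h)) (by omega)
      (hin.of_frame hF (by decide) (by decide)) hd hk fun i => ?_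
    rw [hF.arr _ (by decide)]
    simp only [inputState, Arr.bits, OfNat.ofNat_ne_zero, false_and, if_false]
  · obtain rfl : k = 0 := hk.symm.trans h
    exact (runs_spanningProg hG (by omega) hd).le_time (by omega)

theorem word_bound (n k : ℕ) : n * n + 2 * n + k + 2 ≤ (n + k + 2) ^ 4 :=
  calc n * n + 2 * n + k + 2 ≤ (n + k + 2) ^ 2 := by nlinarith
    _ ≤ (n + k + 2) ^ 4 := Nat.pow_le_pow_right (by omega) (by decide)

theorem decidesWithin_mespProg (hG : G.Connected) (k : ℕ) :
    DecidesWithin mespProg G k ((n + k + 2) ^ 4) (3000 * (2 ^ modularWidth G * n ^ 3)) := by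
  obtain ⟨s', t, hexec, ht, h⟩ := runs_mespProg hG (word_bound n k)
  exact ⟨s', t, hexec, ht, h.eq_one, h.eq_zero⟩

end Main

end MESP

theorem mainTheorem1_general :
    (∃ (p : MESP.Prog) (c C : ℕ), ∀ (n : ℕ) (G : SimpleGraph (Fin n)) (k : ℕ), G.Connected →
      MESP.DecidesWithin p G k ((n + k + 2) ^ c) (C * (2 ^ MESP.modularWidth G * n ^ 3))) ∧
    (∀ (ι : Type) (T : SimpleGraph ι) (V : ι → Type) [∀ i, Nonempty (V i)]
      (H : ∀ i, SimpleGraph (V i)), 3 ≤ ENat.card ι → (MESP.substGraph T H).Connected →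
      (∃ P : List (Σ i, V i), MESP.IsMinEccShortestPath (MESP.substGraph T H) P ∧
        ∀ x ∈ P, ∀ y ∈ P, x.1 = y.1 → x = y) ∧
      (∀ (P : List (Σ i, V i)) (i : ι) (p p' : V i),
        MESP.IsShortestPath (MESP.substGraph T H) P → (⟨i, p⟩ : Σ i, V i) ∈ P →
        (∃ x ∈ P, x.1 ≠ i) →
        MESP.pathEcc (MESP.substGraph T H) (MESP.exchange P ⟨i, p⟩ ⟨i, p'⟩) =
            MESP.pathEcc (MESP.substGraph T H) P ∧
          ((∀ x ∈ P, x.1 = i → x = ⟨i, p⟩) →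
            MESP.IsShortestPath (MESP.substGraph T H) (MESP.exchange P ⟨i, p⟩ ⟨i, p'⟩))) ∧
      (∀ (r : ∀ i, V i) (k : ℕ), MESP.YesInstance (MESP.substGraph T H) k ↔
        ∃ π : List ι, MESP.IsShortestPath T π ∧ 2 ≤ π.length ∧
          MESP.IsShortestPath (MESP.substGraph T H) (π.map fun i => ⟨i, r i⟩) ∧
          MESP.pathEcc (MESP.substGraph T H) (π.map fun i => ⟨i, r i⟩) ≤ k)) := by
  refine ⟨⟨MESP.mespProg, 4, 3000, fun n G k hG => MESP.decidesWithin_mespProg hG k⟩, ?_⟩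
  intro ι T V _ H hι hG
  have h := MESP.isSubst_substGraph hι hG
  refine ⟨h.exists_isMinEccShortestPath_injOn, ?_, fun r k => ?_⟩
  · intro P i p p' hP hp hx
    exact ⟨h.pathEcc_exchange hP hp rfl hx, h.isShortestPath_exchange (p := ⟨i, p⟩) hP rfl⟩
  · exact h.yesInstance_iff (r := fun i => ⟨i, r i⟩) (fun _ => rfl) k

theorem mainTheorem1 :
    -- MESP is decided in time `O(2 ^ w * n ^ 3)` with words of `O(log (n + k))` bits
    (∃ (p : MESP.Prog) (c C : ℕ), ∀ (n : ℕ) (G : SimpleGraph (Fin n)) (k : ℕ), G.Connected →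
      MESP.DecidesWithin p G k ((n + k + 2) ^ c) (C * (2 ^ MESP.modularWidth G * n ^ 3))) ∧
    -- the structure of connected graphs that arise by a substitution
    (∀ (ι : Type) [Fintype ι] (T : SimpleGraph ι) (V : ι → Type) [∀ i, Fintype (V i)]
      [∀ i, Nonempty (V i)] (H : ∀ i, SimpleGraph (V i)),
      3 ≤ Fintype.card ι → (MESP.substGraph T H).Connected →
      -- some optimal path has at most one vertex in each module
      (∃ P : List (Σ i, V i), MESP.IsMinEccShortestPath (MESP.substGraph T H) P ∧
        ∀ x ∈ P, ∀ y ∈ P, x.1 = y.1 → x = y) ∧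
      -- vertices of the same module are interchangeable
      (∀ (P : List (Σ i, V i)) (i : ι) (p p' : V i),
        MESP.IsShortestPath (MESP.substGraph T H) P → (⟨i, p⟩ : Σ i, V i) ∈ P →
        (∃ x ∈ P, x.1 ≠ i) →
        MESP.pathEcc (MESP.substGraph T H) (MESP.exchange P ⟨i, p⟩ ⟨i, p'⟩) =
            MESP.pathEcc (MESP.substGraph T H) P ∧
          ((∀ x ∈ P, x.1 = i → x = ⟨i, p⟩) →
            MESP.IsShortestPath (MESP.substGraph T H) (MESP.exchange P ⟨i, p⟩ ⟨i, p'⟩))) ∧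
      -- it suffices to enumerate the shortest paths of the pattern graph
      (∀ (r : ∀ i, V i) (k : ℕ), MESP.YesInstance (MESP.substGraph T H) k ↔
        ∃ π : List ι, MESP.IsShortestPath T π ∧ 2 ≤ π.length ∧
          MESP.IsShortestPath (MESP.substGraph T H) (π.map fun i => ⟨i, r i⟩) ∧
          MESP.pathEcc (MESP.substGraph T H) (π.map fun i => ⟨i, r i⟩) ≤ k)) := by
  refine ⟨mainTheorem1_general.1, fun ι _ T V _ _ H hι => mainTheorem1_general.2 ι T V H ?_⟩
  rwa [ENat.card_eq_coe_fintype_card, Nat.ofNat_le_cast]
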